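/- All sets are finite. A multipartite scenario $S=(I,X,Y)$ consists of measurement sites $I$, settings $X_i$ for each site $i\in I$, and outcomes $Y_{i,x}$ for each $x\in X_i$. A context $C$ assigns to each site at most one setting (the symbol $\bullet$ means "not measured"), and a local section $s\in\mathcal E_S(C)$ assigns an outcome to each measurement of $C$. A single-round game $\Phi=\sum_{C,A}\Phi_{C,A}\cdot(C,A)$ is a convex combination of contexts $C$ with accepting conditions $A\subseteq\mathcal E_S(C)$; a model $e=\{e_C\in\mathcal D(\mathcal E_S(C))\}_C$ succeeds with probability $p_S(e,\Phi)=\sum_{C,A}\Phi_{C,A}\,e_C(A)$. A model is non-contextual if its distributions are the marginals of one probability distribution on $\prod_{i,x}Y_{i,x}$. The classical bound $\gamma$ of $\Phi$ is the least upper bound of $p_S(e,\Phi)$ over non-contextual $e$. For $d\ge2$, an $I$-qudit unit vector $\psi$ (qudits of dimension $d$) and projective single-qudit measurements $\pi(i,x)$ with outcomes $Y_{i,x}$, let $e_{\psi,\pi}(C)(s)=\big\|\big[\bigotimes_{(i,x)\in C}\pi(i,x)_{s(i,x)}\big]\psi\big\|^2$. A qudit non-local game is such data with $\gamma<p_S(e_{\psi,\pi},\Phi)$.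 A two-round game is a convex combination of pairs of a two-round protocol (a context, and a second context depending on the joint outcome of the first, no site being measured twice) and a set of accepted runs. A two-round circuit strategy is a circuit with one classical input wire and one classical output wire for each site and round, in which the first-round outputs are not reachable from the second-round inputs, and in which an output is $\bullet$ if the corresponding input is $\bullet$ and is an outcome of $x$ if that input is the setting $x$. Its success probability is computed from the probabilities of the runs obtained by feeding in the settings of the run. Classical circuits are directed acyclic graphs of probabilistic gates that may share a random seed; quantum circuits act on qudits of dimension $d$, all initially in $|0\rangle$, by classically controlled unitary gates and projective measurement gates. A family of circuits is shallow if its depth and its maximal fan-in are bounded. For a finite connected graph $G=(V,E,r)$ with root $r$, write $|G|=|V|$ and let $T(S,G,d)$ be the scenario with sites $I\times V$ in which $(i,r)$ has the settings $x\in X_i$ (outcomes $Y_{i,x}$) and $w\in N_G(r)$ (outcomes $\mathbb Z_d^2$), and $(i,v)$ with $v\ne r$ has the settings $(x,w,p)\in X_i\times N_G(v)\times\mathbb Z_d^2$ (outcomes $Y_{i,x}$) and the pairs $(w,w')$ of distinct neighbours of $v$ (outcomes $\mathbb Z_d^2$). **Theorem.** Let $(e_{\psi,\pi},\Phi)$ be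 a qudit non-local game with classical bound $\gamma$, and let $\{G_n\}_{n\in\mathbb N}$ be a family of rooted graphs of bounded degree and unbounded size. Then $\gamma<1$, and there exist two-round games $\Phi_{G_n}$ on $T(S,G_n,d)$ and a shallow family $\{Q_n\}$ of two-round quantum circuit strategies for $T(S,G_n,d)$ such that 1. for all $n$, $p_S(Q_n,\Phi_{G_n})=p_S(e_{\psi,\pi},\Phi)$, and in particular $p_S(Q_n,\Phi_{G_n})>\gamma$; 2. for every shallow family $\{C_n\}$ of two-round classical circuit strategies for $T(S,G_n,d)$ there is a sequence $\epsilon_n\in O(|G_n|^{-1})$ such that $p_S(C_n,\Phi_{G_n})\le\gamma+\epsilon_n$ for all $n$. -/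

import Mathlib

open Matrix Filter Asymptotics

noncomputable section

/-! ## Multipartite scenarios, empirical models and games -/

/-- A (finite) multipartite scenario `(I, X, Y)`: measurement sites, for each site a set of
measurement settings, and for each setting a set of outcomes. -/
structure Scenario where
  Site : Type
  Setting : Site → Type
  Outcome : (i : Site) → Setting i → Type
  [decEqSite : DecidableEq Site]
  [fintypeSite : Fintype Site]
  [fintypeSetting : ∀ i, Fintype (Setting i)]
  [fintypeOutcome : ∀ i x, Fintype (Outcome i x)]

attribute [instance] Scenario.decEqSite Scenario.fintypeSite Scenario.fintypeSetting
  Scenario.fintypeOutcome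

/-- A context (joint measurement): at most one setting for each site.  The value `none` is the
symbol `•` (no measurement at this site). -/
abbrev Context (S : Scenario) : Type := ∀ i : S.Site, Option (S.Setting i)

/-- A joint outcome of some context: for each site either `•`, or the setting that was measured
there together with its outcome. -/
abbrev JointOutcome (S : Scenario) : Type :=
  ∀ i : S.Site, Option (Σ x : S.Setting i, S.Outcome i x)

/-- The set `𝓔(C)` of local sections over the context `C`. -/
def localSections {S : Scenario} (C : Context S) : Set (JointOutcome S) :=
  {s | ∀ i, (s i).map Sigma.fst = C i}

/-- A table giving, for each context `C`, the probabilities of the local sections over `C`. -/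
abbrev Model (S : Scenario) : Type := Context S → JointOutcome S → ℝ

/-- A global section: one outcome for every measurement of the scenario. -/
abbrev GlobalSection (S : Scenario) : Type := ∀ (i : S.Site) (x : S.Setting i), S.Outcome i x

/-- The restriction of a global section to a context. -/
def GlobalSection.restrict {S : Scenario} (l : GlobalSection S) (C : Context S) :
    JointOutcome S :=
  fun i => (C i).map fun x => ⟨x, l i x⟩

open Classical in
/-- A model is non-contextual if it is the family of restrictions (marginals) of one probability
distribution `q` on global sections. -/
def Model.IsNoncontextual {S : Scenario} (e : Model S) : Prop :=
  ∃ q ∈ stdSimplex ℝ (GlobalSection S),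
    ∀ C s, e C s = ∑ l : GlobalSection S, if l.restrict C = s then q l else 0

/-- A single-round cooperative game: a finite formal convex combination `∑ₖ wₖ · (Cₖ, Aₖ)` of
contexts together with accepting conditions. -/
structure Game (S : Scenario) where
  Index : Type
  [fintypeIndex : Fintype Index]
  weight : Index → ℝ
  weight_mem : weight ∈ stdSimplex ℝ Index
  context : Index → Context S
  accept : Index → Set (JointOutcome S)

attribute [instance] Game.fintypeIndex

open Classical in
/-- The success probability of a model on a single-round game. -/
def Game.successProb {S : Scenario} (Φ : Game S) (e : Model S) : ℝ :=
  ∑ k, Φ.weight k *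
    ∑ s : JointOutcome S,
      if s ∈ localSections (Φ.context k) ∧ s ∈ Φ.accept k then e (Φ.context k) s else 0

/-- `γ` is the classical bound of the game: the least upper bound of the success probabilities of
the non-contextual models. -/
def Game.IsClassicalBound {S : Scenario} (Φ : Game S) (γ : ℝ) : Prop :=
  IsLeast {c : ℝ | ∀ e : Model S, e.IsNoncontextual → Φ.successProb e ≤ c} γ

/-! ## Quantum measurements and quantum realised models -/

/-- A projective measurement with outcomes `O`. -/
def IsProjectiveMeasurement {ι O : Type} [Fintype ι] [DecidableEq ι] [Fintype O]
    (P : O → Matrix ι ι ℂ) : Prop :=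
  (∀ o, (P o)ᴴ = P o ∧ P o * P o = P o) ∧ ∑ o, P o = 1

/-- The squared norm of a vector of amplitudes. -/
def normSquared {ι : Type} [Fintype ι] (v : ι → ℂ) : ℝ := ∑ a, ‖v a‖ ^ 2

/-- The operator applied to qudit `i` for the given joint outcome: the projector of the outcome
of the measurement, or the identity if nothing is measured. -/
def localOperator {S : Scenario} {d : ℕ}
    (π : ∀ (i : S.Site) (x : S.Setting i), S.Outcome i x → Matrix (ZMod d) (ZMod d) ℂ)
    (i : S.Site) : Option (Σ x : S.Setting i, S.Outcome i x) → Matrix (ZMod d) (ZMod d) ℂ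
  | none => 1
  | some o => π i o.1 o.2

open Classical in
/-- The quantum realised model `e_{ψ,π}` of a state `ψ` of qudits labelled by the sites and
single-qudit measurements `π i x`:
`e(C)(s) = ‖(⨂_{(i,x) ∈ C} π(i,x)_{s(i,x)}) ψ‖²` for `s ∈ 𝓔(C)`. -/
def quantumModel {S : Scenario} {d : ℕ} [NeZero d] (ψ : (S.Site → ZMod d) → ℂ)
    (π : ∀ (i : S.Site) (x : S.Setting i), S.Outcome i x → Matrix (ZMod d) (ZMod d) ℂ) :
    Model S :=
  fun C s =>
    if s ∈ localSections C then
      normSquared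
        ((Matrix.of fun a b : S.Site → ZMod d => ∏ i, localOperator π i (s i) (a i) (b i)) *ᵥ ψ)
    else 0

/-! ## Two-round games -/

/-- A measurement protocol of length two: a context, and a second context that depends on the
joint outcome of the first one.  No site is measured twice. -/
structure Protocol (S : Scenario) where
  first : Context S
  second : JointOutcome S → Context S
  valid : ∀ s ∈ localSections first, ∀ i, first i = none ∨ second s i = none

/-- The runs of a two-round protocol: joint outcomes of the first and of the second round. -/
def Protocol.runs {S : Scenario} (m : Protocol S) : Set (JointOutcome S × JointOutcome S) :=
  {r | r.1 ∈ localSections m.first ∧ r.2 ∈ localSections (m.second r.1)}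

/-- A two-round behaviour: the probability of each run of each protocol. -/
abbrev Behaviour (S : Scenario) : Type := Protocol S → JointOutcome S × JointOutcome S → ℝ

/-- A two-round (interactive) game: a finite formal convex combination of two-round protocols
together with accepting conditions on their runs. -/
structure TwoRoundGame (S : Scenario) where
  Index : Type
  [fintypeIndex : Fintype Index]
  weight : Index → ℝ
  weight_mem : weight ∈ stdSimplex ℝ Index
  protocol : Index → Protocol S
  accept : Index → Set (JointOutcome S × JointOutcome S)

attribute [instance] TwoRoundGame.fintypeIndex

open Classical in
/-- The success probability of a behaviour on a two-round game. -/
def TwoRoundGame.successProb {S : Scenario} (Φ : TwoRoundGame S) (B : Behaviour S) : ℝ :=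
  ∑ k, Φ.weight k *
    ∑ r : JointOutcome S × JointOutcome S,
      if r ∈ (Φ.protocol k).runs ∧ r ∈ Φ.accept k then B (Φ.protocol k) r else 0

/-! ## Circuits -/

/-- There is a directed path of length `n` from `a` to `b` in the graph with edge relation `r`. -/
inductive PathOfLength {α : Type} (r : α → α → Prop) : ℕ → α → α → Prop
  | nil (a : α) : PathOfLength r 0 a a
  | snoc {n : ℕ} {a b c : α} : PathOfLength r n a b → r b c → PathOfLength r (n + 1) a c

/-- The type of the values of a wire: either an input wire or the output of a gate. -/
def WireValue {In Gate : Type} (A : In → Type) (Val : Gate → Type) : In ⊕ Gate → Type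
  | .inl i => A i
  | .inr g => Val g

/-- The values of all wires, given the inputs and the outputs of all gates. -/
def wireValue {In Gate : Type} {A : In → Type} {Val : Gate → Type} (x : ∀ i, A i)
    (w : ∀ g, Val g) : ∀ p : In ⊕ Gate, WireValue A Val p
  | .inl i => x i
  | .inr g => w g

/-- A classical probabilistic circuit with input wires `In` and output wires `Out`.  Each gate
reads finitely many wires and samples its value from a distribution that depends on the values
it reads and on a common random seed.  Each output wire is attached to one wire, whose value is
converted to the type of the output.  The wire graph is acyclic. -/
structure ClassicalCircuit (In Out : Type) (A : In → Type) (B : Out → Type) where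
  Gate : Type
  [fintypeGate : Fintype Gate]
  Val : Gate → Type
  [fintypeVal : ∀ g, Fintype (Val g)]
  Seed : Type
  [fintypeSeed : Fintype Seed]
  seed : Seed → ℝ
  seed_mem : seed ∈ stdSimplex ℝ Seed
  reads : Gate → Finset (In ⊕ Gate)
  acyclic : WellFounded fun g g' : Gate => Sum.inr g ∈ reads g'
  kernel : ∀ g, Seed → (∀ p : reads g, WireValue A Val p.1) → Val g → ℝ
  kernel_mem : ∀ g z c, kernel g z c ∈ stdSimplex ℝ (Val g)
  source : Out → In ⊕ Gate
  decode : ∀ o, WireValue A Val (source o) → B o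

namespace ClassicalCircuit

attribute [instance] fintypeGate fintypeVal fintypeSeed

variable {In Out : Type} {A : In → Type} {B : Out → Type}

/-- The edges of the circuit: from each wire to the gates that read it. -/
def Edge (F : ClassicalCircuit In Out A B) (p p' : In ⊕ F.Gate) : Prop :=
  ∃ g, p' = Sum.inr g ∧ p ∈ F.reads g

/-- The output wire `o` is reachable from the input wire `i`. -/
def Reaches (F : ClassicalCircuit In Out A B) (i : In) (o : Out) : Prop :=
  ∃ n, PathOfLength F.Edge n (Sum.inl i) (F.source o)

/-- The maximal fan-in is at most `K`. -/
def FanInLE (F : ClassicalCircuit In Out A B) (K : ℕ) : Prop :=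
  ∀ g, (F.reads g).card ≤ K

/-- The depth is at most `D`: every path from an input to an output passes through at most `D`
gates. -/
def DepthLE (F : ClassicalCircuit In Out A B) (D : ℕ) : Prop :=
  ∀ i o n, PathOfLength F.Edge n (Sum.inl i) (F.source o) → n ≤ D

open Classical in
/-- The probability that the outputs are `y` when the inputs are `x`. -/
def prob (F : ClassicalCircuit In Out A B) (x : ∀ i, A i) (y : ∀ o, B o) : ℝ :=
  ∑ z, F.seed z * ∑ w : (∀ g, F.Val g),
    if ∀ o, F.decode o (wireValue x w (F.source o)) = y o then
      ∏ g, F.kernel g z (fun p => wireValue x w p.1) (w g)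
    else 0

end ClassicalCircuit

/-- A quantum circuit on qudits of dimension `d`, all of them initially in the computational
basis state `|0⟩`, with classical input wires `In` and classical output wires `Out`.  The gates
are arranged in `depth` layers.  A gate acts on a finite set of qudits and reads finitely many
classical wires (inputs, and outcomes of gates in earlier layers), which control it.  Gates in
the same layer act on disjoint sets of qudits.  For each value of the control, a gate is either
a unitary (with a single, trivial outcome) or a non-destructive projective measurement. -/
structure QuantumCircuit (d : ℕ) [NeZero d] (In Out : Type) (A : In → Type)
    (B : Out → Type) where
  Qudit : Type
  [decEqQudit : DecidableEq Qudit]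
  [fintypeQudit : Fintype Qudit]
  Gate : Type
  [fintypeGate : Fintype Gate]
  Val : Gate → Type
  [fintypeVal : ∀ g, Fintype (Val g)]
  depth : ℕ
  layer : Gate → Fin depth
  qudits : Gate → Finset Qudit
  disjoint : ∀ g g', layer g = layer g' → g ≠ g' → Disjoint (qudits g) (qudits g')
  reads : Gate → Finset (In ⊕ Gate)
  earlier : ∀ g g', Sum.inr g ∈ reads g' → layer g < layer g'
  op : ∀ g, (∀ p : reads g, WireValue A Val p.1) → Val g →
    Matrix (qudits g → ZMod d) (qudits g → ZMod d) ℂ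
  isGate : ∀ g,
    (Fintype.card (Val g) = 1 ∧ ∀ c o, (op g c o)ᴴ * op g c o = 1 ∧ op g c o * (op g c o)ᴴ = 1) ∨
      ∀ c, IsProjectiveMeasurement (op g c)
  source : Out → In ⊕ Gate
  decode : ∀ o, WireValue A Val (source o) → B o

namespace QuantumCircuit

attribute [instance] decEqQudit fintypeQudit fintypeGate fintypeVal

variable {d : ℕ} [NeZero d] {In Out : Type} {A : In → Type} {B : Out → Type}

/-- The edges of the circuit: from each classical wire to the gates that read it, and from each
gate to the gates in later layers that act on a common qudit. -/
def Edge (F : QuantumCircuit d In Out A B) (p p' : In ⊕ F.Gate) : Prop :=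
  ∃ g', p' = Sum.inr g' ∧
    (p ∈ F.reads g' ∨
      ∃ g, p = Sum.inr g ∧ F.layer g < F.layer g' ∧ ¬ Disjoint (F.qudits g) (F.qudits g'))

/-- The output wire `o` is reachable from the input wire `i`. -/
def Reaches (F : QuantumCircuit d In Out A B) (i : In) (o : Out) : Prop :=
  ∃ n, PathOfLength F.Edge n (Sum.inl i) (F.source o)

/-- The maximal fan-in, counting quantum and classical wires, is at most `K`. -/
def FanInLE (F : QuantumCircuit d In Out A B) (K : ℕ) : Prop :=
  ∀ g, (F.qudits g).card + (F.reads g).card ≤ K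

/-- The depth (number of layers, including those that prepare the state) is at most `D`. -/
def DepthLE (F : QuantumCircuit d In Out A B) (D : ℕ) : Prop :=
  F.depth ≤ D

open Classical in
/-- The operator of layer `t`, for inputs `x` and gate outcomes `w`: the tensor product of the
operators of its gates and of the identity on the qudits on which no gate of the layer acts. -/
def layerOperator (F : QuantumCircuit d In Out A B) (x : ∀ i, A i) (w : ∀ g, F.Val g) (t : ℕ) :
    Matrix (F.Qudit → ZMod d) (F.Qudit → ZMod d) ℂ :=
  Matrix.of fun a b =>
    if ∀ q, (∀ g, (F.layer g : ℕ) = t → q ∉ F.qudits g) → a q = b q then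
      ∏ g with (F.layer g : ℕ) = t,
        F.op g (fun p => wireValue x w p.1) (w g) (fun q => a q.1) (fun q => b q.1)
    else 0

open Classical in
/-- The unnormalised state after the first `t` layers, for inputs `x` and gate outcomes `w`. -/
def state (F : QuantumCircuit d In Out A B) (x : ∀ i, A i) (w : ∀ g, F.Val g) :
    ℕ → (F.Qudit → ZMod d) → ℂ
  | 0 => Pi.single (fun _ => 0) 1
  | t + 1 => F.layerOperator x w t *ᵥ F.state x w t

open Classical in
/-- The probability that the outputs are `y` when the inputs are `x` (Born rule, summed over the
outcomes of the gates that give the outputs `y`). -/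
def prob (F : QuantumCircuit d In Out A B) (x : ∀ i, A i) (y : ∀ o, B o) : ℝ :=
  ∑ w : (∀ g, F.Val g),
    if ∀ o, F.decode o (wireValue x w (F.source o)) = y o then
      normSquared (F.state x w F.depth)
    else 0

end QuantumCircuit

/-! ## Two-round circuit strategies

There is an input wire and an output wire for each site and each of the two rounds `0, 1`. -/

/-- The type of the input wire of a site in either round. -/
abbrev StrategyInput (S : Scenario) (p : S.Site × Fin 2) : Type := Option (S.Setting p.1)

/-- The type of the output wire of a site in either round. -/
abbrev StrategyOutput (S : Scenario) (p : S.Site × Fin 2) : Type :=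
  Option (Σ x : S.Setting p.1, S.Outcome p.1 x)

/-- Values for both rounds, from a value for each round. -/
def bothRounds {I : Type} {A : I → Type} (a b : ∀ i, A i) (p : I × Fin 2) : A p.1 :=
  if p.2 = 0 then a p.1 else b p.1

/-- The behaviour given by the input-output probabilities of a circuit: the probability of a run
is the probability of its outcomes when the inputs are the settings measured in this run. -/
def behaviourOf {S : Scenario}
    (P : (∀ p, StrategyInput S p) → (∀ p, StrategyOutput S p) → ℝ) : Behaviour S :=
  fun m r => P (bothRounds m.first (m.second r.1)) (bothRounds r.1 r.2)

/-- A two-round classical circuit strategy: the outputs of the first round are not reachable from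
the inputs of the second round; an output is `•` if the corresponding input is `•`, and is an
outcome of the setting `x` if the corresponding input is `x`. -/
structure ClassicalStrategy (S : Scenario) where
  circuit : ClassicalCircuit (S.Site × Fin 2) (S.Site × Fin 2) (StrategyInput S)
    (StrategyOutput S)
  causal : ∀ i i', ¬ circuit.Reaches (i, 1) (i', 0)
  typed : ∀ x y, circuit.prob x y ≠ 0 → ∀ p, (y p).map Sigma.fst = x p

/-- The behaviour of a classical circuit strategy. -/
def ClassicalStrategy.behaviour {S : Scenario} (C : ClassicalStrategy S) : Behaviour S :=
  behaviourOf C.circuit.prob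

/-- A two-round quantum circuit strategy, with qudits of dimension `d` (same conditions as in the
classical case). -/
structure QuantumStrategy (d : ℕ) [NeZero d] (S : Scenario) where
  circuit : QuantumCircuit d (S.Site × Fin 2) (S.Site × Fin 2) (StrategyInput S)
    (StrategyOutput S)
  causal : ∀ i i', ¬ circuit.Reaches (i, 1) (i', 0)
  typed : ∀ x y, circuit.prob x y ≠ 0 → ∀ p, (y p).map Sigma.fst = x p

/-- The behaviour of a quantum circuit strategy. -/
def QuantumStrategy.behaviour {d : ℕ} [NeZero d] {S : Scenario} (Q : QuantumStrategy d S) :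
    Behaviour S :=
  behaviourOf Q.circuit.prob

/-- A family of classical circuit strategies is shallow: bounded depth and maximal fan-in. -/
def ShallowClassical {S : ℕ → Scenario} (C : ∀ n, ClassicalStrategy (S n)) : Prop :=
  ∃ K D : ℕ, ∀ n, (C n).circuit.FanInLE K ∧ (C n).circuit.DepthLE D

/-- A family of quantum circuit strategies is shallow: bounded depth and maximal fan-in. -/
def ShallowQuantum {d : ℕ} [NeZero d] {S : ℕ → Scenario} (Q : ∀ n, QuantumStrategy d (S n)) :
    Prop :=
  ∃ K D : ℕ, ∀ n, (Q n).circuit.FanInLE K ∧ (Q n).circuit.DepthLE D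

/-! ## Rooted graphs and the distributed scenario -/

/-- A finite connected undirected graph with a distinguished root. -/
structure RootedGraph where
  V : Type
  [fintypeV : Fintype V]
  graph : SimpleGraph V
  connected : graph.Connected
  root : V

attribute [instance] RootedGraph.fintypeV

/-- The size (number of nodes) of a rooted graph. -/
def RootedGraph.size (G : RootedGraph) : ℕ := Fintype.card G.V

open Classical in
/-- The degree of a rooted graph: the size of the largest neighbourhood. -/
def RootedGraph.degree (G : RootedGraph) : ℕ := G.graph.maxDegree

/-- The measurement settings of the distributed scenario at the site `(i, v)`.  If `v` is the
root: a setting `x ∈ Xᵢ`, or a neighbour `w` of `v`.  If `v` is not the root: a triple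
`(x, w, p)` of a setting `x ∈ Xᵢ`, a neighbour `w` of `v` and `p ∈ ℤ_d²`, or a pair of distinct
neighbours of `v`. -/
abbrev DistributedSetting (S : Scenario) (G : RootedGraph) (d : ℕ) (i : S.Site) (v : G.V) :
    Type :=
  ({_x : S.Setting i // v = G.root} ⊕ {w : G.V // v = G.root ∧ G.graph.Adj v w}) ⊕
    ({q : S.Setting i × G.V × (ZMod d × ZMod d) // v ≠ G.root ∧ G.graph.Adj v q.2.1} ⊕
      {q : G.V × G.V //
        v ≠ G.root ∧ G.graph.Adj v q.1 ∧ G.graph.Adj v q.2 ∧ q.1 ≠ q.2})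

/-- The outcomes in the distributed scenario: those of `x` for a setting that contains a setting
`x` of the given scenario, and `ℤ_d²` otherwise. -/
def DistributedOutcome (S : Scenario) (G : RootedGraph) (d : ℕ) (i : S.Site) (v : G.V) :
    DistributedSetting S G d i v → Type
  | .inl (.inl x) => S.Outcome i x.1
  | .inl (.inr _) => ZMod d × ZMod d
  | .inr (.inl q) => S.Outcome i q.1.1
  | .inr (.inr _) => ZMod d × ZMod d

instance (S : Scenario) (G : RootedGraph) (d : ℕ) [NeZero d] (i : S.Site) (v : G.V)
    (x : DistributedSetting S G d i v) : Fintype (DistributedOutcome S G d i v x) :=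
  match x with
  | .inl (.inl x) => inferInstanceAs (Fintype (S.Outcome i x.1))
  | .inl (.inr _) => inferInstanceAs (Fintype (ZMod d × ZMod d))
  | .inr (.inl q) => inferInstanceAs (Fintype (S.Outcome i q.1.1))
  | .inr (.inr _) => inferInstanceAs (Fintype (ZMod d × ZMod d))

open Classical in
/-- The distributed scenario `T(S, G, d)`, with measurement sites `I × V`. -/
def distributedScenario (S : Scenario) (G : RootedGraph) (d : ℕ) [NeZero d] : Scenario where
  Site := S.Site × G.V
  Setting p := DistributedSetting S G d p.1 p.2
  Outcome p x := DistributedOutcome S G d p.1 p.2 x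

end

set_option linter.unusedSectionVars false

/-! ## Determinization of classical circuits -/

/-! The game hides the given non-local game behind teleportation. Fix a spanning tree of the graph.
The referee draws a target node for every site, independently and uniformly. The first round asks,
for each site, for Bell measurements at all proper ancestors of its target. The second round asks
the original questions at the targets, together with the sum of the Bell outcomes along each path,
unless the target is the root, where this sum is empty.

Quantum side: prepare `ψ` at the root and a maximally entangled pair on every tree edge of every
site. The Bell measurements act on disjoint qudits, so arbitrarily long paths are handled in one
layer. They move qudit `i` to its target up to a generalized Pauli operator whose exponents are the
announced sums, and conjugating the final measurement by this operator undoes it. In the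
computational basis, a final basis state has at most one initial basis state contributing to it
(`SpanningTree.sum_linkEntry_mul`). Hence each run has a uniform factor for the Bell outcomes times
the Born probability for `ψ` (`SpanningTree.normSquared_targetEntry`,
`teleportationCircuit_prob_run`), and the success probability is the original one for every choice
of targets (`successProb_teleportationStrategy`).

Classical side: a probabilistic circuit is a mixture of deterministic ones
(`ClassicalCircuit.exists_deterministic`), in which each output depends only on its backward light
cone, of size bounded in terms of fan-in and depth (`ClassicalCircuit.card_reaches_le`). For fixed
targets, causality fixes the first-round answers and hence the path sums. If no second-round
question at one target can influence the answer at another, the answers come from a global section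
(`exists_globalSection`), so success is at most `γ`. By a union bound, the targets for which this
fails have probability at most a constant divided by the number of nodes
(`card_filter_exists_related_mul_le`). Both cases are combined in `classical_successProb_le`.

Finally `γ < 1`, because the quantum model, whose success probability exceeds `γ`, consists of
probability distributions. -/

theorem Fintype.sum_pi_prod {ι : Type*} [Fintype ι] [DecidableEq ι] {κ : ι → Type*}
    [∀ i, Fintype (κ i)] {R : Type*} [CommSemiring R] (f : ∀ i, κ i → R) :
    ∑ p : ∀ i, κ i, ∏ i, f i (p i) = ∏ i, ∑ j, f i j := by
  rw [Finset.prod_univ_sum, Fintype.piFinset_univ]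

namespace ClassicalCircuit

variable {In Out : Type} {A : In → Type} {B : Out → Type}

/-- The possible values of the wires that a gate reads. -/
abbrev GateInput (F : ClassicalCircuit In Out A B) (g : F.Gate) : Type :=
  ∀ p : F.reads g, WireValue A F.Val p.1

/-- A deterministic response of all gates. -/
abbrev Response (F : ClassicalCircuit In Out A B) : Type := ∀ g, F.GateInput g → F.Val g

/-- The values of the gates when all gates respond deterministically. -/
noncomputable def eval (F : ClassicalCircuit In Out A B) (φ : F.Response) (x : ∀ i, A i) :
    ∀ g, F.Val g :=
  F.acyclic.fix fun g ih => φ g fun p =>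
    match p with
    | ⟨.inl i, _⟩ => x i
    | ⟨.inr g', h⟩ => ih g' h

theorem eval_eq (F : ClassicalCircuit In Out A B) (φ : F.Response) (x : ∀ i, A i) (g : F.Gate) :
    F.eval φ x g = φ g fun p => wireValue x (F.eval φ x) p.1 := by
  rw [eval, WellFounded.fix_eq]
  congr 1
  funext p
  match p with
  | ⟨.inl i, _⟩ => rfl
  | ⟨.inr g', h⟩ => rfl

/-- The wire graph is acyclic, so the local equations of the gates have exactly one solution. This
is what allows the sum over all gate values in `prob` to be compared with deterministic evaluation.
-/
theorem eq_eval_iff (F : ClassicalCircuit In Out A B) (φ : F.Response) (x : ∀ i, A i)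
    (w : ∀ g, F.Val g) :
    F.eval φ x = w ↔ ∀ g, φ g (fun p => wireValue x w p.1) = w g := by
  constructor
  · rintro rfl g
    exact (F.eval_eq φ x g).symm
  · intro h
    funext g
    induction g using F.acyclic.induction with
    | _ g ih =>
      rw [eval_eq, ← h g]
      congr 1
      funext p
      match p with
      | ⟨.inl i, _⟩ => rfl
      | ⟨.inr g', h'⟩ => exact ih g' h'

/-- Well-founded induction along the edges: a path to a wire read by a gate extends to a path to the
gate itself, so the inputs in the light cones of the wires read lie in the light cone of the gate.
-/
theorem wireValue_eval_congr (F : ClassicalCircuit In Out A B) (φ : F.Response)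
    {x x' : ∀ i, A i} (p : In ⊕ F.Gate)
    (h : ∀ i, (∃ n, PathOfLength F.Edge n (Sum.inl i) p) → x i = x' i) :
    wireValue x (F.eval φ x) p = wireValue x' (F.eval φ x') p := by
  have hg : ∀ g, (∀ i, (∃ n, PathOfLength F.Edge n (Sum.inl i) (Sum.inr g)) → x i = x' i) →
      F.eval φ x g = F.eval φ x' g := by
    intro g
    induction g using F.acyclic.induction with
    | _ g ih =>
      intro hx
      rw [eval_eq, eval_eq]
      congr 1
      funext p
      match p with
      | ⟨.inl i, hi⟩ => exact hx i ⟨1, .snoc (.nil _) ⟨g, rfl, hi⟩⟩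
      | ⟨.inr g', h'⟩ =>
        exact ih g' h' fun i ⟨n, hn⟩ => hx i ⟨n + 1, .snoc hn ⟨g, rfl, h'⟩⟩
  match p with
  | .inl i => exact h i ⟨0, .nil _⟩
  | .inr g => exact hg g h

instance [∀ i, Finite (A i)] (F : ClassicalCircuit In Out A B) (p : In ⊕ F.Gate) :
    Finite (WireValue A F.Val p) := by
  cases p
  · exact inferInstanceAs (Finite (A _))
  · exact inferInstanceAs (Finite (F.Val _))

/-- A classical circuit is a mixture of deterministic circuits, in which each output depends only
on the inputs from which it is reachable. -/
theorem exists_deterministic [∀ i, Finite (A i)] (F : ClassicalCircuit In Out A B) :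
    ∃ (Λ : Type) (_ : Fintype Λ) (q : Λ → ℝ) (out : Λ → (∀ i, A i) → ∀ o, B o),
      q ∈ stdSimplex ℝ Λ ∧
      (∀ x y, F.prob x y = ∑ l, open Classical in if out l x = y then q l else 0) ∧
      ∀ l x x' o, (∀ i, F.Reaches i o → x i = x' i) → out l x o = out l x' o := by
  classical
  have : ∀ g, Fintype (F.GateInput g) := fun g => Fintype.ofFinite _
  -- Given the seed, every gate draws in advance, independently, a response to each of its possible
  -- inputs. This is the probability of drawing the response table `φ`.
  let rw' : F.Seed → F.Response → ℝ := fun z φ => ∏ g, ∏ c, F.kernel g z c (φ g c)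
  have hsum : ∀ z, ∑ φ, rw' z φ = 1 := by
    intro z
    have h1 : ∀ g, ∑ r : F.GateInput g → F.Val g, ∏ c, F.kernel g z c (r c) = 1 := by
      intro g
      rw [Fintype.sum_pi_prod (fun c v => F.kernel g z c v)]
      exact Finset.prod_eq_one fun c _ => (F.kernel_mem g z c).2
    simp only [rw']
    rw [Fintype.sum_pi_prod (fun g (r : F.GateInput g → F.Val g) => ∏ c, F.kernel g z c (r c))]
    exact Finset.prod_eq_one fun g _ => h1 g
  -- In an evaluation with gate values `w` each gate consults a single entry of its table. The
  -- entries never consulted sum to one, which leaves one kernel factor for each gate.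
  have hkey : ∀ z x w, (∑ φ, if F.eval φ x = w then rw' z φ else 0) =
      ∏ g, F.kernel g z (fun p : F.reads g => wireValue x w p.1) (w g) := by
    intro z x w
    -- The indicator is absorbed into the product by annihilating the factor at a consulted entry
    -- that disagrees with `w`. The sum over tables then factorizes.
    have h1 : ∀ φ, (if F.eval φ x = w then rw' z φ else 0) =
        ∏ g, ∏ c, if c = (fun p : F.reads g => wireValue x w p.1) ∧ φ g c ≠ w g then 0
          else F.kernel g z c (φ g c) := by
      intro φ
      split_ifs with h
      · rw [eq_eval_iff] at h
        refine Finset.prod_congr rfl fun g _ => Finset.prod_congr rfl fun c _ => ?_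
        rw [if_neg]
        rintro ⟨rfl, h'⟩
        exact h' (h g)
      · rw [eq_eval_iff] at h
        push Not at h
        obtain ⟨g, hg⟩ := h
        symm
        refine Finset.prod_eq_zero (Finset.mem_univ g) ?_
        refine Finset.prod_eq_zero (Finset.mem_univ (fun p : F.reads g => wireValue x w p.1)) ?_
        rw [if_pos ⟨rfl, hg⟩]
    simp_rw [h1]
    rw [Fintype.sum_pi_prod (fun g (r : F.GateInput g → F.Val g) =>
      ∏ c, if c = (fun p : F.reads g => wireValue x w p.1) ∧ r c ≠ w g then 0 else F.kernel g z c (r c))]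
    refine Finset.prod_congr rfl fun g _ => ?_
    rw [Fintype.sum_pi_prod (fun c v =>
      if c = (fun p : F.reads g => wireValue x w p.1) ∧ v ≠ w g then 0 else F.kernel g z c v)]
    rw [Finset.prod_eq_single (fun p : F.reads g => wireValue x w p.1)]
    · rw [Finset.sum_eq_single (w g)]
      · simp
      · intro v _ hv
        rw [if_pos ⟨rfl, hv⟩]
      · simp
    · intro c _ hc
      simp only [hc, false_and, if_false]
      exact (F.kernel_mem g z c).2
    · simp
  refine ⟨F.Seed × F.Response, inferInstance, fun l => F.seed l.1 * rw' l.1 l.2,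
    fun l x o => F.decode o (wireValue x (F.eval l.2 x) (F.source o)), ⟨?_, ?_⟩, ?_, ?_⟩
  · intro l
    exact mul_nonneg (F.seed_mem.1 _) (Finset.prod_nonneg fun g _ =>
      Finset.prod_nonneg fun c _ => (F.kernel_mem g l.1 c).1 _)
  · rw [Fintype.sum_prod_type]
    simp_rw [← Finset.mul_sum, hsum, mul_one]
    exact F.seed_mem.2
  · intro x y
    rw [prob, Fintype.sum_prod_type]
    refine Finset.sum_congr rfl fun z _ => ?_
    have h1 : ∀ w : (∀ g, F.Val g),
        (if ∀ o, F.decode o (wireValue x w (F.source o)) = y o then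
          ∏ g, F.kernel g z (fun p : F.reads g => wireValue x w p.1) (w g) else 0) =
        ∑ φ, if F.eval φ x = w then
          (if (fun o => F.decode o (wireValue x (F.eval φ x) (F.source o))) = y then rw' z φ
            else 0) else 0 := by
      intro w
      rw [← hkey, ← Finset.sum_const_zero, ← Finset.sum_ite_irrel]
      refine Finset.sum_congr rfl fun φ _ => ?_
      by_cases h : F.eval φ x = w
      · simp [← h, funext_iff]
      · simp [h]
    rw [Finset.sum_congr rfl fun w _ => h1 w, Finset.sum_comm, Finset.mul_sum]
    refine Finset.sum_congr rfl fun φ _ => ?_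
    rw [Finset.sum_ite_eq, if_pos (Finset.mem_univ _), mul_ite, mul_zero]
  · intro l x x' o h
    simp only
    rw [F.wireValue_eval_congr l.2 (F.source o) h]

/-- The number of wires from which a given wire can be reached by a path of given length. -/
theorem exists_finset_path (F : ClassicalCircuit In Out A B) {K : ℕ} (hK : F.FanInLE K) (n : ℕ)
    (c : In ⊕ F.Gate) :
    ∃ s : Finset (In ⊕ F.Gate), s.card ≤ K ^ n ∧ ∀ a, PathOfLength F.Edge n a c → a ∈ s := by
  classical
  induction n generalizing c with
  | zero =>
    refine ⟨{c}, by simp, fun a h => ?_⟩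
    cases h
    simp
  | succ n ih =>
    choose s hs hs' using ih
    match c with
    | .inl i =>
      refine ⟨∅, by simp, fun a h => ?_⟩
      obtain _ | ⟨_, g, hg, -⟩ := h
      simp at hg
    | .inr g =>
      refine ⟨(F.reads g).biUnion s, ?_, fun a h => ?_⟩
      · refine (Finset.card_biUnion_le_card_mul _ _ _ fun b _ => hs b).trans ?_
        rw [pow_succ, mul_comm]
        exact Nat.mul_le_mul_left _ (hK g)
      · obtain _ | ⟨h, g', hg, hb⟩ := h
        cases hg
        exact Finset.mem_biUnion.2 ⟨_, hb, hs' _ _ h⟩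

/-- Paths into an output wire have length at most `D`, and at most `K ^ n` wires start a path of
length `n` into it. The light cone is covered by these sets. -/
theorem card_reaches_le (F : ClassicalCircuit In Out A B) {K D : ℕ} (hK : F.FanInLE K)
    (hD : F.DepthLE D) (o : Out) (s : Finset In) (hs : ∀ i ∈ s, F.Reaches i o) :
    s.card ≤ ∑ n ∈ Finset.range (D + 1), K ^ n := by
  classical
  choose t ht ht' using fun n => F.exists_finset_path hK n (F.source o)
  have h : s.map ⟨Sum.inl, Sum.inl_injective⟩ ⊆ (Finset.range (D + 1)).biUnion t := by
    intro a ha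
    obtain ⟨i, hi, rfl⟩ := Finset.mem_map.1 ha
    obtain ⟨n, hn⟩ := hs i hi
    exact Finset.mem_biUnion.2 ⟨n, Finset.mem_range.2 (Nat.lt_succ_of_le (hD i o n hn)), ht' n _ hn⟩
  calc s.card = (s.map ⟨Sum.inl, Sum.inl_injective⟩ : Finset (In ⊕ F.Gate)).card := by simp
    _ ≤ _ := Finset.card_le_card h
    _ ≤ ∑ n ∈ Finset.range (D + 1), (t n).card := Finset.card_biUnion_le
    _ ≤ _ := Finset.sum_le_sum fun n _ => ht n

end ClassicalCircuit

/-! ## Projective measurements -/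

theorem normSquared_eq_dotProduct {ι : Type} [Fintype ι] (v : ι → ℂ) :
    (normSquared v : ℂ) = star v ⬝ᵥ v := by
  simp [normSquared, dotProduct, Complex.conj_mul']

theorem normSquared_nonneg {ι : Type} [Fintype ι] (v : ι → ℂ) : 0 ≤ normSquared v :=
  Finset.sum_nonneg fun _ _ => by positivity

namespace IsProjectiveMeasurement

variable {ι κ O : Type} [Fintype ι] [DecidableEq ι] [Fintype κ] [DecidableEq κ] [Fintype O]

/-- For a self-adjoint idempotent `P` one has `‖P v‖² = ⟨v, P v⟩`, which is linear in `P`, and the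
projections add up to the identity. -/
theorem sum_normSquared {P : O → Matrix ι ι ℂ} (hP : IsProjectiveMeasurement P) (v : ι → ℂ) :
    ∑ o, normSquared (P o *ᵥ v) = normSquared v := by
  have h : ∀ o, (normSquared (P o *ᵥ v) : ℂ) = star v ⬝ᵥ (P o *ᵥ v) := by
    intro o
    rw [normSquared_eq_dotProduct, star_mulVec, ← dotProduct_mulVec, mulVec_mulVec, (hP.1 o).1,
      (hP.1 o).2]
  apply Complex.ofReal_injective
  rw [Complex.ofReal_sum, Finset.sum_congr rfl fun o _ => h o, ← dotProduct_sum,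
    ← sum_mulVec, hP.2, one_mulVec, normSquared_eq_dotProduct]

theorem single [DecidableEq O] (o₀ : O) :
    IsProjectiveMeasurement fun o => if o = o₀ then (1 : Matrix ι ι ℂ) else 0 := by
  refine ⟨fun o => ?_, by simp⟩
  by_cases h : o = o₀ <;> simp [h]

theorem submatrix {P : O → Matrix ι ι ℂ} (hP : IsProjectiveMeasurement P) (e : κ ≃ ι) :
    IsProjectiveMeasurement fun o => (P o).submatrix e e := by
  refine ⟨fun o => ⟨?_, ?_⟩, ?_⟩
  · rw [conjTranspose_submatrix, (hP.1 o).1]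
  · rw [submatrix_mul_equiv, (hP.1 o).2]
  · ext a b
    have := congrFun (congrFun hP.2 (e a)) (e b)
    simp only [Matrix.sum_apply, submatrix_apply] at this ⊢
    rw [this]
    simp [Matrix.one_apply]

theorem conj {P : O → Matrix ι ι ℂ} (hP : IsProjectiveMeasurement P) {U : Matrix ι ι ℂ}
    (h : Uᴴ * U = 1) : IsProjectiveMeasurement fun o => U * P o * Uᴴ := by
  have h' : U * Uᴴ = 1 := mul_eq_one_comm.1 h
  refine ⟨fun o => ⟨?_, ?_⟩, ?_⟩
  · rw [conjTranspose_mul, conjTranspose_mul, conjTranspose_conjTranspose, (hP.1 o).1,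
      ← Matrix.mul_assoc]
  · calc U * P o * Uᴴ * (U * P o * Uᴴ) = U * P o * (Uᴴ * U) * P o * Uᴴ := by
          simp only [Matrix.mul_assoc]
      _ = U * (P o * P o) * Uᴴ := by rw [h, Matrix.mul_one]; simp only [Matrix.mul_assoc]
      _ = _ := by rw [(hP.1 o).2]
  · rw [← Finset.sum_mul, ← Finset.mul_sum, hP.2, Matrix.mul_one, h']

end IsProjectiveMeasurement

/-- The operator of an optional outcome of one of several measurements: the identity if nothing
is measured. -/
def outcomeOperator {X ι : Type} [DecidableEq ι] {O : X → Type} (M : ∀ x, O x → Matrix ι ι ℂ) :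
    Option (Σ x, O x) → Matrix ι ι ℂ
  | none => 1
  | some z => M z.1 z.2

open Classical in
/-- The measurement which, controlled by an optional setting, carries out the measurement of this
setting, and whose outcomes contain the setting. -/
noncomputable def controlledMeasurement {X ι : Type} [DecidableEq ι] {O : X → Type}
    (M : ∀ x, O x → Matrix ι ι ℂ) (c : Option X) (o : Option (Σ x, O x)) : Matrix ι ι ℂ :=
  if o.map Sigma.fst = c then outcomeOperator M o else 0

theorem controlledMeasurement_of_ne {X ι : Type} [DecidableEq ι] {O : X → Type}
    {M : ∀ x, O x → Matrix ι ι ℂ} {c : Option X} {o : Option (Σ x, O x)}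
    (h : o.map Sigma.fst ≠ c) : controlledMeasurement M c o = 0 := by
  rw [controlledMeasurement, if_neg h]

theorem controlledMeasurement_of_eq {X ι : Type} [DecidableEq ι] {O : X → Type}
    {M : ∀ x, O x → Matrix ι ι ℂ} {c : Option X} {o : Option (Σ x, O x)}
    (h : o.map Sigma.fst = c) : controlledMeasurement M c o = outcomeOperator M o := by
  rw [controlledMeasurement, if_pos h]

/-- Outcomes labelled by a setting other than the control carry the zero projection, so the sum
reduces to the measurement of the control. The same zeros later give the typing condition of the
circuit. -/
theorem isProjectiveMeasurement_controlledMeasurement {X ι : Type} [Fintype ι] [DecidableEq ι]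
    [Fintype X] {O : X → Type} [∀ x, Fintype (O x)] {M : ∀ x, O x → Matrix ι ι ℂ}
    (hM : ∀ x, IsProjectiveMeasurement (M x)) (c : Option X) :
    IsProjectiveMeasurement (controlledMeasurement M c) := by
  classical
  refine ⟨fun o => ?_, ?_⟩
  · rw [controlledMeasurement]
    split_ifs
    · rcases o with _ | ⟨x, y⟩
      · simp [outcomeOperator]
      · exact (hM x).1 y
    · simp
  · rw [Fintype.sum_option, Fintype.sum_sigma]
    rcases c with _ | x
    · simp [controlledMeasurement, outcomeOperator]
    · rw [Finset.sum_eq_single x]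
      · simp only [controlledMeasurement, outcomeOperator, Option.map_none, Option.map_some,
          if_true, reduceCtorEq, if_false, zero_add]
        exact (hM x).2
      · intro x' _ hx'
        simp [controlledMeasurement, hx']
      · simp

/-! ## Tensor products -/

/-- The tensor product of a family of matrices. -/
def tensorMatrix {I κ : Type} [Fintype I] (R : I → Matrix κ κ ℂ) : Matrix (I → κ) (I → κ) ℂ :=
  Matrix.of fun a b => ∏ i, R i (a i) (b i)

section tensor

variable {I κ : Type} [Fintype I] [DecidableEq I] [Fintype κ] [DecidableEq κ]

theorem tensorMatrix_mul (R R' : I → Matrix κ κ ℂ) :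
    tensorMatrix R * tensorMatrix R' = tensorMatrix fun i => R i * R' i := by
  ext a b
  simp only [tensorMatrix, Matrix.mul_apply, Matrix.of_apply, ← Finset.prod_mul_distrib]
  rw [Fintype.sum_pi_prod (fun i c => R i (a i) c * R' i c (b i))]

theorem tensorMatrix_conjTranspose (R : I → Matrix κ κ ℂ) :
    (tensorMatrix R)ᴴ = tensorMatrix fun i => (R i)ᴴ := by
  ext a b
  simp [tensorMatrix, Matrix.conjTranspose_apply]

theorem tensorMatrix_one : tensorMatrix (fun _ : I => (1 : Matrix κ κ ℂ)) = 1 := by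
  ext a b
  simp [tensorMatrix, Matrix.one_apply, Finset.prod_ite_zero, funext_iff]

theorem isProjectiveMeasurement_tensorMatrix {O : I → Type} [∀ i, Fintype (O i)]
    {P : ∀ i, O i → Matrix κ κ ℂ} (hP : ∀ i, IsProjectiveMeasurement (P i)) :
    IsProjectiveMeasurement fun s : ∀ i, O i => tensorMatrix fun i => P i (s i) := by
  refine ⟨fun s => ⟨?_, ?_⟩, ?_⟩
  · rw [tensorMatrix_conjTranspose]
    congr 1; funext i; exact ((hP i).1 _).1
  · rw [tensorMatrix_mul]
    congr 1; funext i; exact ((hP i).1 _).2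
  · rw [← tensorMatrix_one]
    ext a b
    simp only [Matrix.sum_apply, tensorMatrix, Matrix.of_apply]
    rw [Fintype.sum_pi_prod (fun i o => P i o (a i) (b i))]
    refine Finset.prod_congr rfl fun i _ => ?_
    rw [← (hP i).2, Matrix.sum_apply]

end tensor

/-! ## Unitary preparation of a state -/

/-- A unit vector extends to an orthonormal basis, whose members are the columns of a unitary. This
supplies the gates that prepare a state from the computational zero state. -/
theorem exists_unitary_col {ι : Type} [Fintype ι] [DecidableEq ι] (φ : ι → ℂ)
    (hφ : normSquared φ = 1) (i₀ : ι) :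
    ∃ U : Matrix ι ι ℂ, (Uᴴ * U = 1 ∧ U * Uᴴ = 1) ∧ ∀ a, U a i₀ = φ a := by
  have hv : Orthonormal ℂ (({i₀} : Set ι).domRestrict fun _ => (WithLp.toLp 2 φ :
      EuclideanSpace ℂ ι)) := by
    constructor
    · intro i
      rw [Set.domRestrict_apply, EuclideanSpace.norm_eq, Real.sqrt_eq_one]
      exact hφ
    · intro i j hij
      exact absurd (Subsingleton.elim i j) hij
  obtain ⟨b, hb⟩ := hv.exists_orthonormalBasis_extension_of_card_eq (by simp)
  have h : (Matrix.of fun a j => b j a)ᴴ * (Matrix.of fun a j => b j a) = 1 := by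
    ext j k
    have := orthonormal_iff_ite.1 b.orthonormal j k
    simp only [PiLp.inner_apply, RCLike.inner_apply] at this
    rw [Matrix.one_apply, ← this, Matrix.mul_apply]
    exact Finset.sum_congr rfl fun a _ => mul_comm _ _
  refine ⟨Matrix.of fun a j => b j a, ⟨h, mul_eq_one_comm.1 h⟩, fun a => ?_⟩
  rw [Matrix.of_apply, hb i₀ rfl]

/-! ## Bell measurements -/

section Bell

variable {d : ℕ} [NeZero d]

/-- The standard character of `ℤ/d`. -/
noncomputable abbrev phase (d : ℕ) [NeZero d] : AddChar (ZMod d) ℂ := ZMod.stdAddChar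

theorem norm_phase (t : ZMod d) : ‖phase d t‖ = 1 := AddChar.norm_apply _ _

theorem star_phase (t : ZMod d) : star (phase d t) = phase d (-t) :=
  (AddChar.map_neg_eq_conj _ _).symm

theorem sum_phase_mul (t : ZMod d) : ∑ n, phase d (n * t) = if t = 0 then (d : ℂ) else 0 := by
  rw [AddChar.sum_mulShift t (ZMod.isPrimitive_stdAddChar d)]
  simp

variable {A : Type} [Fintype A] [DecidableEq A] [AddCommGroup A] (e : ZMod d →+ A)

/-- The permutation matrix of a translation. -/
def translation (t : ZMod d) : Matrix A A ℂ := Matrix.of fun a b => if a = b + e t then 1 else 0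

theorem translation_mul (s t : ZMod d) :
    translation e s * translation e t = translation e (s + t) := by
  ext a b
  simp only [translation, Matrix.mul_apply, Matrix.of_apply, mul_ite, mul_one, mul_zero,
    Finset.sum_ite_eq', Finset.mem_univ, if_true, map_add]
  congr 1
  rw [add_assoc, add_comm (e t)]

theorem translation_zero : translation e 0 = 1 := by
  ext a b
  simp [translation, Matrix.one_apply]

theorem translation_conjTranspose (t : ZMod d) :
    (translation e t)ᴴ = translation e (-t) := by
  ext a b
  simp only [translation, Matrix.conjTranspose_apply, Matrix.of_apply, map_neg]
  have : (b = a + e t) ↔ (a = b + -e t) := by rw [← sub_eq_add_neg, eq_sub_iff_add_eq, eq_comm]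
  simp only [this]
  split_ifs <;> simp

/-- The spectral projections of a translation. -/
noncomputable def translationProjection (n : ZMod d) : Matrix A A ℂ :=
  (d : ℂ)⁻¹ • ∑ t, phase d (n * t) • translation e t

/-- The translations represent the group `ℤ_d`, and these matrices are the Fourier averages onto its
isotypic components. Orthogonality of characters shows that they sum to the identity. -/
theorem isProjectiveMeasurement_translationProjection :
    IsProjectiveMeasurement (translationProjection e) := by
  have hd : (d : ℂ) ≠ 0 := Nat.cast_ne_zero.2 (NeZero.ne d)
  refine ⟨fun n => ⟨?_, ?_⟩, ?_⟩
  · rw [translationProjection, conjTranspose_smul, conjTranspose_sum]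
    congr 1
    · simp
    · rw [← Equiv.sum_comp (Equiv.neg _)]
      refine Finset.sum_congr rfl fun t _ => ?_
      rw [conjTranspose_smul, translation_conjTranspose, star_phase]
      simp
  · have h : ∀ s, translation e s * translationProjection e n =
        phase d (-(n * s)) • translationProjection e n := by
      intro s
      simp only [translationProjection, mul_smul_comm, Finset.mul_sum, translation_mul]
      rw [smul_comm]
      congr 1
      rw [← Equiv.sum_comp (Equiv.addLeft s) (fun t => phase d (n * t) • translation e t),
        Finset.smul_sum]
      refine Finset.sum_congr rfl fun t _ => ?_
      rw [Equiv.coe_addLeft, smul_smul, ← AddChar.map_add_eq_mul]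
      congr 2
      ring
    nth_rewrite 1 [translationProjection]
    simp only [smul_mul_assoc, Finset.sum_mul, h, smul_smul, ← AddChar.map_add_eq_mul,
      add_neg_cancel, AddChar.map_zero_eq_one, one_smul, Finset.sum_const, Finset.card_univ,
      ZMod.card]
    rw [← Nat.cast_smul_eq_nsmul ℂ, smul_smul, inv_mul_cancel₀ hd, one_smul]
  · simp only [translationProjection]
    rw [← Finset.smul_sum, Finset.sum_comm]
    simp_rw [← Finset.sum_smul, sum_phase_mul]
    simp [translation_zero, hd]

/-- The joint projections of a translation and of a function that is invariant under it. -/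
noncomputable def bellProjection (χ : A → ZMod d) (p : ZMod d × ZMod d) : Matrix A A ℂ :=
  Matrix.diagonal (fun a => if χ a = p.1 then 1 else 0) * translationProjection e p.2

/-- Invariance of `χ` under the translation makes the level-set projections commute with the
spectral ones, and products of commuting projections are projections. -/
theorem isProjectiveMeasurement_bellProjection {χ : A → ZMod d}
    (hχ : ∀ a t, χ (a + e t) = χ a) : IsProjectiveMeasurement (bellProjection e χ) := by
  have hcomm : ∀ m n, Matrix.diagonal (fun a => if χ a = m then (1 : ℂ) else 0) *
      translationProjection e n = translationProjection e n *
        Matrix.diagonal (fun a => if χ a = m then (1 : ℂ) else 0) := by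
    intro m n
    ext a b
    simp only [Matrix.diagonal_mul, Matrix.mul_diagonal, translationProjection, Matrix.smul_apply,
      Matrix.sum_apply, translation, Matrix.of_apply, smul_eq_mul]
    by_cases h : χ a = χ b
    · rw [h, mul_comm]
    · rw [Finset.sum_eq_zero, mul_zero, mul_zero, zero_mul]
      intro t _
      rw [if_neg, mul_zero]
      rintro rfl
      exact h (hχ b t)
  have hP := isProjectiveMeasurement_translationProjection e
  refine ⟨fun p => ⟨?_, ?_⟩, ?_⟩
  · rw [bellProjection, conjTranspose_mul, (hP.1 _).1, hcomm, Matrix.diagonal_conjTranspose]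
    congr 2
    funext a
    simp only [Pi.star_apply]
    split_ifs <;> simp
  · rw [bellProjection, Matrix.mul_assoc, ← Matrix.mul_assoc (translationProjection e p.2),
      ← hcomm, Matrix.mul_assoc, (hP.1 _).2, ← Matrix.mul_assoc, Matrix.diagonal_mul_diagonal]
    congr 2
    funext a
    split_ifs <;> simp
  · simp only [bellProjection]
    rw [Fintype.sum_prod_type]
    have h : ∀ m, ∑ n, Matrix.diagonal (fun a => if χ a = m then (1 : ℂ) else 0) *
        translationProjection e n = Matrix.diagonal fun a => if χ a = m then (1 : ℂ) else 0 := by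
      intro m
      rw [← Finset.mul_sum, hP.2, Matrix.mul_one]
    rw [Finset.sum_congr rfl fun m _ => h m]
    ext a b
    simp only [Matrix.sum_apply, Matrix.diagonal_apply, Matrix.one_apply]
    split_ifs <;> simp

theorem bellProjection_apply_eq_zero {χ : A → ZMod d} {p : ZMod d × ZMod d} {a b : A}
    (h : χ a = p.1 → ∀ t, a ≠ b + e t) : bellProjection e χ p a b = 0 := by
  rw [bellProjection, Matrix.diagonal_mul]
  split_ifs with h'
  · simp [translationProjection, translation, Matrix.sum_apply, h h']
  · simp

/-- Injectivity of `e` leaves a single term of the Fourier sum. -/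
theorem bellProjection_apply {χ : A → ZMod d} {p : ZMod d × ZMod d} {a b : A} {t : ZMod d}
    (he : Function.Injective e) (hχ : χ a = p.1) (h : a = b + e t) :
    bellProjection e χ p a b = (d : ℂ)⁻¹ * phase d (p.2 * t) := by
  rw [bellProjection, Matrix.diagonal_mul, if_pos hχ, one_mul]
  simp only [translationProjection, translation, Matrix.sum_apply, Matrix.smul_apply,
    Matrix.of_apply, smul_eq_mul, h, add_right_inj, he.eq_iff]
  simp

end Bell

/-! ## Spanning trees of rooted graphs -/

noncomputable instance (G : RootedGraph) : DecidableEq G.V := Classical.decEq _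

/-- A spanning tree of a rooted graph, given by the parents of the nodes. -/
structure SpanningTree (G : RootedGraph) where
  parent : G.V → G.V
  depth : G.V → ℕ
  depth_root : depth G.root = 0
  adj : ∀ v, v ≠ G.root → G.graph.Adj v (parent v)
  depth_parent : ∀ v, v ≠ G.root → depth (parent v) + 1 = depth v

/-- The parent of a node is the next node on a shortest path to the root, so the distance to the
root serves as depth. -/
theorem exists_spanningTree (G : RootedGraph) : Nonempty (SpanningTree G) := by
  have h : ∀ v, ∃ u, v ≠ G.root →
      G.graph.Adj v u ∧ G.graph.dist u G.root + 1 = G.graph.dist v G.root := by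
    intro v
    by_cases hv : v = G.root
    · exact ⟨v, fun h => absurd hv h⟩
    obtain ⟨p, hp⟩ := G.connected.exists_walk_length_eq_dist v G.root
    cases p with
    | nil => exact absurd rfl hv
    | @cons _ u _ h q =>
      refine ⟨u, fun _ => ⟨h, ?_⟩⟩
      rw [SimpleGraph.Walk.length_cons] at hp
      have h1 := SimpleGraph.dist_le q
      have h2 := G.connected.dist_triangle (u := v) (v := u) (w := G.root)
      rw [SimpleGraph.dist_eq_one_iff_adj.2 h] at h2
      omega
  choose f hf using h
  exact ⟨⟨f, fun v => G.graph.dist v G.root, SimpleGraph.dist_self, fun v hv => (hf v hv).1,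
    fun v hv => (hf v hv).2⟩⟩

namespace SpanningTree

variable {G : RootedGraph} (T : SpanningTree G)

theorem depth_iterate (v : G.V) (k : ℕ) (hk : k ≤ T.depth v) :
    T.depth (T.parent^[k] v) = T.depth v - k := by
  induction k with
  | zero => simp
  | succ k ih =>
    have h := ih (by omega)
    rw [Function.iterate_succ_apply']
    have : T.parent^[k] v ≠ G.root := by
      intro h'
      rw [h', depth_root] at h
      omega
    have := T.depth_parent _ this
    omega

theorem depth_eq_zero {v : G.V} : T.depth v = 0 ↔ v = G.root := by
  constructor
  · intro h
    by_contra hv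
    have := T.depth_parent v hv
    omega
  · rintro rfl
    exact T.depth_root

/-- The node `u` is a proper ancestor of `v`. -/
def Below (u v : G.V) : Prop := T.depth u < T.depth v ∧ T.parent^[T.depth v - T.depth u] v = u

/-- The child of the node `u` that is equal to `v` or an ancestor of `v`. -/
def next (u v : G.V) : G.V := T.parent^[T.depth v - T.depth u - 1] v

variable {T}

theorem Below.depth_next {u v : G.V} (h : T.Below u v) : T.depth (T.next u v) = T.depth u + 1 := by
  have := h.1
  rw [next, T.depth_iterate _ _ (by omega)]
  omega

theorem Below.next_ne_root {u v : G.V} (h : T.Below u v) : T.next u v ≠ G.root := by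
  rw [Ne, ← T.depth_eq_zero, h.depth_next]
  omega

theorem Below.parent_next {u v : G.V} (h : T.Below u v) : T.parent (T.next u v) = u := by
  have h1 := h.1
  rw [next, ← Function.iterate_succ_apply' T.parent, Nat.succ_eq_add_one,
    Nat.sub_add_cancel (by omega)]
  exact h.2

theorem Below.ne {u v : G.V} (h : T.Below u v) : u ≠ v := by
  rintro rfl
  exact lt_irrefl _ h.1

theorem below_root {v : G.V} (hv : v ≠ G.root) : T.Below G.root v := by
  rw [Ne, ← T.depth_eq_zero] at hv
  refine ⟨by rw [T.depth_root]; omega, ?_⟩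
  rw [← T.depth_eq_zero, T.depth_iterate _ _ (by omega), T.depth_root]
  omega

theorem Below.next_eq_or {u v : G.V} (h : T.Below u v) :
    T.next u v = v ∨ T.Below (T.next u v) v := by
  have h1 := h.1
  by_cases h2 : T.depth v - T.depth u - 1 = 0
  · left
    rw [next, h2, Function.iterate_zero_apply]
  · right
    refine ⟨by rw [h.depth_next]; omega, ?_⟩
    rw [h.depth_next, next, Nat.sub_sub]

theorem below_parent {c v : G.V} (hc : c ≠ G.root) (h : c = v ∨ T.Below c v) :
    T.Below (T.parent c) v ∧ T.next (T.parent c) v = c := by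
  have h1 := T.depth_parent c hc
  have h2 : T.depth c ≤ T.depth v ∧ T.parent^[T.depth v - T.depth c] v = c := by
    rcases h with rfl | h
    · simp
    · exact ⟨h.1.le, h.2⟩
  refine ⟨⟨by omega, ?_⟩, ?_⟩
  · rw [show T.depth v - T.depth (T.parent c) = (T.depth v - T.depth c) + 1 by omega,
      Function.iterate_succ_apply', h2.2]
  · rw [next, show T.depth v - T.depth (T.parent c) - 1 = T.depth v - T.depth c by omega, h2.2]

/-- A path to the root meets each depth once. -/
theorem Below.eq_of_depth_eq {u u' v : G.V} (h : T.Below u v) (h' : T.Below u' v)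
    (hd : T.depth u = T.depth u') : u = u' := by
  rw [← h.2, ← h'.2, hd]

end SpanningTree

/-! ## The distributed game -/

section Distributed

variable {S : Scenario} {G : RootedGraph} {d : ℕ} {i : S.Site}

/-- The outcome of a setting of the distributed scenario that contains a setting of the given
scenario, together with this setting. -/
def siteAnswer {u : G.V} : (Σ x : DistributedSetting S G d i u, DistributedOutcome S G d i u x) →
    Option (Σ x : S.Setting i, S.Outcome i x)
  | ⟨.inl (.inl x), y⟩ => some ⟨x.1, y⟩
  | ⟨.inl (.inr _), _⟩ => none
  | ⟨.inr (.inl q), y⟩ => some ⟨q.1.1, y⟩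
  | ⟨.inr (.inr _), _⟩ => none

/-- The outcome in `ℤ_d²` of a Bell measurement, and zero for the other settings. -/
def bellOutcome {u : G.V} :
    (Σ x : DistributedSetting S G d i u, DistributedOutcome S G d i u x) → ZMod d × ZMod d
  | ⟨.inl (.inl _), _⟩ => 0
  | ⟨.inl (.inr _), p⟩ => p
  | ⟨.inr (.inl _), _⟩ => 0
  | ⟨.inr (.inr _), p⟩ => p

namespace SpanningTree

variable (T : SpanningTree G)

theorem adj_of_parent_eq {u c : G.V} (hc : c ≠ G.root) (h : T.parent c = u) : G.graph.Adj u c :=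
  h ▸ (T.adj c hc).symm

/-- The parent of `u` has smaller depth than `u`, and a child has larger depth. A Bell setting away
from the root must name two distinct neighbours. -/
theorem parent_ne_of_parent_eq {u c : G.V} (hc : c ≠ G.root) (h : T.parent c = u)
    (hu : u ≠ G.root) : T.parent u ≠ c := by
  rintro rfl
  have h1 := T.depth_parent _ hu
  have h2 := T.depth_parent _ hc
  rw [h] at h2
  omega

open Classical in
/-- The setting at a node that asks for a Bell measurement of the links to its parent and to the
child `c`. -/
noncomputable def pathSetting (S : Scenario) (d : ℕ) (i : S.Site) {u c : G.V} (hc : c ≠ G.root)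
    (h : T.parent c = u) : DistributedSetting S G d i u :=
  if hu : u = G.root then .inl (.inr ⟨c, hu, T.adj_of_parent_eq hc h⟩)
  else .inr (.inr ⟨(T.parent u, c), hu, T.adj _ hu, T.adj_of_parent_eq hc h,
    T.parent_ne_of_parent_eq hc h hu⟩)

open Classical in
/-- The setting at the target node that asks for a measurement of the given scenario. -/
noncomputable def targetSetting {i : S.Site} (u : G.V) (x : S.Setting i) (p : ZMod d × ZMod d) :
    DistributedSetting S G d i u :=
  if h : u = G.root then .inl (.inl ⟨x, h⟩)
  else .inr (.inl ⟨(x, T.parent u, p), h, T.adj _ h⟩)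

open Classical in
/-- The outcome of a measurement of the given scenario as an outcome at the target node. -/
noncomputable def targetOutcome {i : S.Site} (u : G.V) (p : ZMod d × ZMod d)
    (z : Σ x : S.Setting i, S.Outcome i x) :
    Σ x : DistributedSetting S G d i u, DistributedOutcome S G d i u x :=
  if h : u = G.root then ⟨.inl (.inl ⟨z.1, h⟩), z.2⟩
  else ⟨.inr (.inl ⟨(z.1, T.parent u, p), h, T.adj _ h⟩), z.2⟩

theorem targetOutcome_fst (u : G.V) (p : ZMod d × ZMod d) (z : Σ x : S.Setting i, S.Outcome i x) :
    (T.targetOutcome u p z).1 = T.targetSetting u z.1 p := by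
  unfold targetOutcome targetSetting
  split_ifs <;> rfl

theorem siteAnswer_targetOutcome (u : G.V) (p : ZMod d × ZMod d)
    (z : Σ x : S.Setting i, S.Outcome i x) : siteAnswer (T.targetOutcome u p z) = some z := by
  unfold targetOutcome
  split_ifs <;> rfl

theorem exists_eq_targetOutcome (u : G.V) (p : ZMod d × ZMod d) (x : S.Setting i)
    (z : Σ x : DistributedSetting S G d i u, DistributedOutcome S G d i u x)
    (hz : z.1 = T.targetSetting u x p) : ∃ y, z = T.targetOutcome u p ⟨x, y⟩ := by
  obtain ⟨z, y⟩ := z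
  simp only at hz
  subst hz
  revert y
  unfold targetOutcome targetSetting
  by_cases h : u = G.root
  · rw [dif_pos h]
    intro y
    exact ⟨y, by rw [dif_pos h]⟩
  · rw [dif_neg h]
    intro y
    exact ⟨y, by rw [dif_neg h]⟩

/-- This number of outcomes normalizes the uniform distribution of the Bell outcomes in
`sum_firstContext`. -/
theorem card_pathSetting [NeZero d] {u c : G.V} (hc : c ≠ G.root) (h : T.parent c = u) :
    Fintype.card (DistributedOutcome S G d i u (T.pathSetting S d i hc h)) = d * d := by
  have h' : Fintype.card (ZMod d × ZMod d) = d * d := by simp [ZMod.card]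
  unfold pathSetting
  split_ifs <;> exact h'

open Classical in
/-- The first context of the distributed game: Bell measurements on the paths to the targets. -/
noncomputable def firstContext [NeZero d] (v : S.Site → G.V) :
    Context (distributedScenario S G d) :=
  fun p : S.Site × G.V =>
    if h : T.Below p.2 (v p.1) then
      some (T.pathSetting S d p.1 h.next_ne_root h.parent_next)
    else none

open Classical in
/-- The sum of the outcomes of the Bell measurements on the path of a site. -/
noncomputable def correction [NeZero d] (v : S.Site → G.V)
    (s : JointOutcome (distributedScenario S G d)) (i : S.Site) : ZMod d × ZMod d :=
  ∑ u with T.Below u (v i), (s (i, u)).elim 0 bellOutcome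

open Classical in
/-- The second context of the distributed game: the settings of the given context, at the target
nodes. -/
noncomputable def secondContext [NeZero d] (v : S.Site → G.V) (C : Context S)
    (s : JointOutcome (distributedScenario S G d)) : Context (distributedScenario S G d) :=
  fun p : S.Site × G.V =>
    if p.2 = v p.1 then (C p.1).map fun x => T.targetSetting p.2 x (T.correction v s p.1)
    else none

/-- The protocol of the distributed game, given the targets and a context. -/
noncomputable def protocol [NeZero d] (v : S.Site → G.V) (C : Context S) :
    Protocol (distributedScenario S G d) where
  first := T.firstContext v
  second := T.secondContext v C
  valid := by
    rintro s - p
    -- Only proper ancestors are measured in the first round, so a target is still free in the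
    -- second.
    by_cases h : p.2 = v p.1
    · left
      exact dif_neg fun h' => h'.ne h
    · right
      exact if_neg h

end SpanningTree

/-- The joint outcome of the given scenario that is found at the targets. -/
def targetAnswer [NeZero d] (v : S.Site → G.V) (s : JointOutcome (distributedScenario S G d)) :
    JointOutcome S :=
  fun i => (s (i, v i)).bind siteAnswer

/-- The distributed game: the targets are chosen uniformly at random. -/
noncomputable def distributedGame [NeZero d] (T : SpanningTree G) (Φ : Game S) :
    TwoRoundGame (distributedScenario S G d) where
  Index := Φ.Index × (S.Site → G.V)
  weight k := Φ.weight k.1 * (Fintype.card (S.Site → G.V) : ℝ)⁻¹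
  weight_mem := by
    have : Nonempty (S.Site → G.V) := ⟨fun _ => G.root⟩
    refine ⟨fun k => mul_nonneg (Φ.weight_mem.1 _) (by positivity), ?_⟩
    rw [Fintype.sum_prod_type]
    simp only [Finset.sum_const, Finset.card_univ, nsmul_eq_mul]
    rw [← Finset.mul_sum, ← Finset.sum_mul, Φ.weight_mem.2, one_mul]
    field_simp
  protocol k := T.protocol k.2 (Φ.context k.1)
  accept k := {r | targetAnswer k.2 r.2 ∈ Φ.accept k.1}

theorem distributedGame_successProb [NeZero d] (T : SpanningTree G) (Φ : Game S)
    (B : Behaviour (distributedScenario S G d)) :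
    (distributedGame T Φ).successProb B =
      (Fintype.card (S.Site → G.V) : ℝ)⁻¹ * ∑ v : S.Site → G.V, ∑ k, Φ.weight k *
        ∑ r : JointOutcome (distributedScenario S G d) × JointOutcome (distributedScenario S G d),
          open Classical in
          if r ∈ (T.protocol v (Φ.context k)).runs ∧ targetAnswer v r.2 ∈ Φ.accept k then
            B (T.protocol v (Φ.context k)) r else 0 := by
  classical
  rw [TwoRoundGame.successProb]
  erw [Fintype.sum_prod_type_right]
  rw [Finset.mul_sum]
  refine Finset.sum_congr rfl fun v _ => ?_
  rw [Finset.mul_sum]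
  refine Finset.sum_congr rfl fun k _ => ?_
  simp only [distributedGame, Set.mem_ofPred_eq]
  rw [mul_comm (Φ.weight k), mul_assoc]
  congr!

end Distributed

/-! ## The classical bound of the distributed game -/

theorem isNoncontextual_globalSection {S : Scenario} (l : GlobalSection S) :
    Model.IsNoncontextual (S := S) fun C s => open Classical in
      if l.restrict C = s then 1 else 0 := by
  classical
  refine ⟨Pi.single l 1, ⟨fun l' => ?_, by simp⟩, fun C s => ?_⟩
  · by_cases h : l' = l
    · subst h; simp
    · simp [h]
  · rw [Finset.sum_eq_single l]
    · simp
    · intro l' _ h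
      simp [h]
    · simp

theorem restrict_mem_localSections {S : Scenario} (l : GlobalSection S) (C : Context S) :
    l.restrict C ∈ localSections C := by
  intro i
  unfold GlobalSection.restrict
  cases C i <;> rfl

namespace Game.IsClassicalBound

variable {S : Scenario} {Φ : Game S} {γ : ℝ}

/-- The deterministic model of a single global section is non-contextual, so the classical bound
applies to it. -/
theorem sum_weight_le (hγ : Φ.IsClassicalBound γ) (l : GlobalSection S) :
    ∑ k, Φ.weight k * (open Classical in if l.restrict (Φ.context k) ∈ Φ.accept k then 1 else 0)
      ≤ γ := by
  classical
  refine le_trans (le_of_eq ?_) (hγ.1 _ (isNoncontextual_globalSection l))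
  refine Finset.sum_congr rfl fun k _ => ?_
  congr 1
  rw [Finset.sum_eq_single (l.restrict (Φ.context k))]
  · simp [restrict_mem_localSections]
  · intro s _ hs
    simp [Ne.symm hs]
  · simp

/-- Without global sections there would be no non-contextual models, every real number would be an
upper bound, and no least one would exist. A global section also supplies default answers to the
questions that the game never asks. -/
theorem nonempty_globalSection (hγ : Φ.IsClassicalBound γ) : Nonempty (GlobalSection S) := by
  by_contra h
  rw [not_nonempty_iff] at h
  have h1 : γ - 1 ∈ {c : ℝ | ∀ e : Model S, e.IsNoncontextual → Φ.successProb e ≤ c} := by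
    rintro e ⟨q, hq, -⟩
    have := hq.2
    simp at this
  linarith [hγ.2 h1]

theorem nonneg (hγ : Φ.IsClassicalBound γ) : 0 ≤ γ := by
  obtain ⟨l⟩ := hγ.nonempty_globalSection
  refine le_trans (Finset.sum_nonneg fun k _ => mul_nonneg (Φ.weight_mem.1 k) ?_)
    (hγ.sum_weight_le l)
  split_ifs <;> norm_num

end Game.IsClassicalBound

/-- The number of choices of one element for each index, in which two given indices are related
by a relation of bounded degree. -/
theorem card_filter_related_mul_le {I V : Type} [Fintype I] [DecidableEq I] [Fintype V]
    (R : V → V → Prop) {i j : I} (hij : i ≠ j) {L : ℕ}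
    (hR : ∀ a (s : Finset V), (∀ b ∈ s, R a b) → s.card ≤ L) :
    (open Classical in (Finset.univ.filter fun v : I → V => R (v i) (v j)).card) *
      Fintype.card V ≤ L * Fintype.card (I → V) := by
  classical
  -- Forgetting the coordinate `j` keeps `v i`. Within a fibre only `v j` varies, and it is related
  -- to the fixed `v i`, so the fibre has at most `L` elements.
  let f : (I → V) → ({j' // j' ≠ j} → V) := fun v j' => v j'
  have h1 := Finset.card_le_mul_card_image (f := f)
    (Finset.univ.filter fun v : I → V => R (v i) (v j)) L (by
      intro f₀ _
      have hinj : Set.InjOn (fun v : I → V => v j)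
          ((Finset.univ.filter fun v : I → V => R (v i) (v j)).filter fun v => f v = f₀ :
            Finset (I → V)) := by
        intro v hv w hw hvw
        simp only [Finset.coe_filter, Set.mem_ofPred_eq] at hv hw
        funext k
        by_cases hk : k = j
        · rw [hk]; exact hvw
        · exact congrFun (hv.2.trans hw.2.symm) ⟨k, hk⟩
      rw [← Finset.card_image_of_injOn hinj]
      refine hR (f₀ ⟨i, hij⟩) _ fun b hb => ?_
      obtain ⟨v, hv, rfl⟩ := Finset.mem_image.1 hb
      simp only [Finset.mem_filter] at hv
      rw [← hv.2]
      exact hv.1.2)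
  have h2 := Fintype.card_congr (Equiv.funSplitAt j V)
  rw [Fintype.card_prod] at h2
  rw [h2]
  calc _ ≤ L * Fintype.card ({j' // j' ≠ j} → V) * Fintype.card V :=
        Nat.mul_le_mul_right _ (h1.trans (Nat.mul_le_mul_left _ (Finset.card_le_univ _)))
    _ = _ := by ring

/-- A union bound over the pairs of distinct indices, of which there are at most `|I|²`. -/
theorem card_filter_exists_related_mul_le {I V : Type} [Fintype I] [DecidableEq I] [Fintype V]
    (R : I → V → I → V → Prop) {L : ℕ}
    (hR : ∀ i a j (s : Finset V), (∀ b ∈ s, R i a j b) → s.card ≤ L) :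
    (open Classical in
      (Finset.univ.filter fun v : I → V => ∃ i j, i ≠ j ∧ R i (v i) j (v j)).card) *
      Fintype.card V ≤ Fintype.card I ^ 2 * L * Fintype.card (I → V) := by
  classical
  have h1 : (Finset.univ.filter fun v : I → V => ∃ i j, i ≠ j ∧ R i (v i) j (v j)) ⊆
      (Finset.univ.filter fun p : I × I => p.1 ≠ p.2).biUnion fun p =>
        Finset.univ.filter fun v : I → V => R p.1 (v p.1) p.2 (v p.2) := by
    intro v hv
    obtain ⟨-, i, j, hij, h⟩ := Finset.mem_filter.1 hv
    simp only [Finset.mem_biUnion, Finset.mem_filter, Finset.mem_univ, true_and]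
    exact ⟨(i, j), hij, h⟩
  calc _ ≤ (∑ p ∈ Finset.univ.filter fun p : I × I => p.1 ≠ p.2,
        (Finset.univ.filter fun v : I → V => R p.1 (v p.1) p.2 (v p.2)).card) * Fintype.card V :=
        Nat.mul_le_mul_right _ ((Finset.card_le_card h1).trans Finset.card_biUnion_le)
    _ ≤ ∑ p ∈ Finset.univ.filter fun p : I × I => p.1 ≠ p.2, L * Fintype.card (I → V) := by
        rw [Finset.sum_mul]
        refine Finset.sum_le_sum fun p hp => ?_
        exact card_filter_related_mul_le (R p.1 · p.2 ·) (Finset.mem_filter.1 hp).2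
          fun a => hR p.1 a p.2
    _ ≤ _ := by
        rw [Finset.sum_const, smul_eq_mul, mul_assoc, pow_two, ← Fintype.card_prod]
        exact Nat.mul_le_mul_right _ (Finset.card_le_univ _)

/-! ### Deterministic strategies, and averaging over the targets. -/

section Classical

variable {S : Scenario} {G : RootedGraph} {d : ℕ} [NeZero d]

/-- A deterministic two-round strategy determines its run. -/
theorem run_eq_iff {T : Scenario}
    {out : (∀ p, StrategyInput T p) → ∀ p, StrategyOutput T p}
    (hfirst : ∀ x x' i, (∀ j, x (j, 0) = x' (j, 0)) → out x (i, 0) = out x' (i, 0))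
    (a : Context T) (b : JointOutcome T → Context T) (r : JointOutcome T × JointOutcome T) :
    out (bothRounds a (b r.1)) = bothRounds r.1 r.2 ↔
      r = (fun i => out (bothRounds a fun _ => none) (i, 0),
        fun i => out (bothRounds a (b fun i => out (bothRounds a fun _ => none) (i, 0))) (i, 1)) := by
  -- Causality: the first-round answers may be computed with all second-round inputs left blank.
  have h0 : ∀ c : Context T, ∀ i, out (bothRounds a c) (i, 0) =
      out (bothRounds a fun _ => none) (i, 0) := fun c i => hfirst _ _ _ fun j => rfl
  constructor
  · intro h
    have h1 : r.1 = fun i => out (bothRounds a fun _ => none) (i, 0) := by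
      funext i
      rw [← h0 (b r.1), h]
      rfl
    refine Prod.ext h1 ?_
    funext i
    simp only
    rw [← h1, h]
    rfl
  · rintro rfl
    funext ⟨i, t⟩
    fin_cases t
    · exact h0 _ i
    · rfl

/-- A deterministic strategy in which the answer at each target does not depend on the settings
at the other targets answers according to a global section. -/
theorem exists_globalSection (T : SpanningTree G)
    {out : (∀ p, StrategyInput (distributedScenario S G d) p) →
      ∀ p, StrategyOutput (distributedScenario S G d) p}
    (htyped : ∀ x p, (out x p).map Sigma.fst = x p) (v : S.Site → G.V)
    (hindep : ∀ i x x', (∀ p, (∀ j, j ≠ i → p ≠ ((j, v j), 1)) → x p = x' p) →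
      out x ((i, v i), 1) = out x' ((i, v i), 1))
    (s : JointOutcome (distributedScenario S G d)) :
    ∃ l : GlobalSection S, ∀ C : Context S,
      targetAnswer v (fun p =>
        out (bothRounds (T.firstContext v) (T.secondContext v C s)) (p, 1)) = l.restrict C := by
  classical
  -- For a fixed first-round outcome `s` the corrections are constants, so the setting at the target
  -- of `i` depends on the context only through `C i`. By `hindep`, so does the answer.
  have key : ∀ i (x : S.Setting i), ∃ y : S.Outcome i x, ∀ C : Context S, C i = some x →
      (out (bothRounds (T.firstContext v) (T.secondContext v C s)) ((i, v i), 1)).bind siteAnswer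
        = some ⟨x, y⟩ := by
    intro i x
    have h1 : ∀ C : Context S, C i = some x →
        T.secondContext v C s (i, v i) = some (T.targetSetting (v i) x (T.correction v s i)) := by
      intro C hC
      simp only [SpanningTree.secondContext, if_true, hC]
      rfl
    -- A reference context measuring `x` at `i` and nothing elsewhere; the answer of the strategy to
    -- it defines the value of the global section at `x`.
    let C₀ : Context S := fun j => if h : j = i then some (h ▸ x) else none
    have hC₀ : C₀ i = some x := by simp [C₀]
    have h2 := htyped (bothRounds (T.firstContext v) (T.secondContext v C₀ s)) ((i, v i), 1)
    have h3 : bothRounds (T.firstContext v) (T.secondContext v C₀ s) ((i, v i), 1) =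
        some (T.targetSetting (v i) x (T.correction v s i)) := h1 C₀ hC₀
    obtain ⟨z, hz, hz'⟩ := Option.map_eq_some_iff.1 (h2.trans h3)
    obtain ⟨y, hy⟩ := T.exists_eq_targetOutcome _ _ _ z hz'
    refine ⟨y, fun C hC => ?_⟩
    have h4 : out (bothRounds (T.firstContext v) (T.secondContext v C s)) ((i, v i), 1) =
        some z := by
      rw [← hz]
      -- In the second round only targets are measured, so the inputs for `C` and `C₀` can differ
      -- only at the targets of other sites.
      apply hindep
      rintro ⟨⟨j, u⟩, t⟩ hp
      fin_cases t
      · rfl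
      · change T.secondContext v C s (j, u) = T.secondContext v C₀ s (j, u)
        by_cases hu : u = v j
        · subst hu
          by_cases hj : j = i
          · subst hj
            rw [h1 C hC, h1 C₀ hC₀]
          · exact absurd rfl (hp j hj)
        · simp only [SpanningTree.secondContext, if_neg hu]
    rw [h4, hy]
    exact T.siteAnswer_targetOutcome _ _ _
  choose l hl using key
  refine ⟨l, fun C => ?_⟩
  funext i
  unfold targetAnswer GlobalSection.restrict
  cases hC : C i with
  | some x => exact hl i x C hC
  | none =>
    have h2 := htyped (bothRounds (T.firstContext v) (T.secondContext v C s)) ((i, v i), 1)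
    have h3 : bothRounds (T.firstContext v) (T.secondContext v C s) ((i, v i), 1) = none := by
      change T.secondContext v C s (i, v i) = none
      simp only [SpanningTree.secondContext, if_true, hC]
      rfl
    exact congrArg (Option.bind · siteAnswer) (Option.map_eq_none_iff.1 (h2.trans h3))

/-- For each choice of targets the success probability is at most `γ`, or at most `γ + 1` when two
targets interact. The correction term bounds the fraction of interacting choices. -/
theorem classical_successProb_le (T : SpanningTree G) {Φ : Game S} {γ : ℝ}
    (hγ : Φ.IsClassicalBound γ) (C : ClassicalStrategy (distributedScenario S G d)) {K D : ℕ}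
    (hK : C.circuit.FanInLE K) (hD : C.circuit.DepthLE D) :
    (distributedGame T Φ).successProb C.behaviour ≤
      γ + (Fintype.card S.Site ^ 2 * ∑ n ∈ Finset.range (D + 1), K ^ n : ℕ) * (G.size : ℝ)⁻¹ := by
  classical
  obtain ⟨Λ, _, q, out, hq, hprob, hout⟩ := C.circuit.exists_deterministic
  set bad : (S.Site → G.V) → Prop := fun v =>
    ∃ i j, i ≠ j ∧ C.circuit.Reaches ((j, v j), 1) ((i, v i), 1) with hbad
  have hcount := card_filter_exists_related_mul_le
    (fun i (a : G.V) j b => C.circuit.Reaches ((j, b), 1) ((i, a), 1))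
    (L := ∑ n ∈ Finset.range (D + 1), K ^ n) (by
      intro i a j s hs
      have := C.circuit.card_reaches_le hK hD ((i, a), 1)
        (s.map ⟨fun b => (((j, b), 1) : (S.Site × G.V) × Fin 2), fun b b' h =>
          (Prod.mk.inj (Prod.mk.inj h).1).2⟩)
        (by
          intro p hp
          obtain ⟨b, hb, rfl⟩ := Finset.mem_map.1 hp
          exact hs b hb)
      simpa using this)
  -- Positive weight is needed here: the typing condition constrains only outputs of nonzero
  -- probability, and the outputs of `out l` have probability at least `q l`.
  have hmain : ∀ v (l : Λ), 0 < q l → ∑ k, Φ.weight k *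
      ∑ r : JointOutcome (distributedScenario S G d) × JointOutcome (distributedScenario S G d),
        (if r ∈ (T.protocol v (Φ.context k)).runs ∧ targetAnswer v r.2 ∈ Φ.accept k then
          if out l (bothRounds (T.firstContext v) (T.secondContext v (Φ.context k) r.1)) =
            bothRounds r.1 r.2 then (1 : ℝ) else 0 else 0) ≤ γ + if bad v then 1 else 0 := by
    intro v l hl
    have htyped : ∀ x p, (out l x p).map Sigma.fst = x p := by
      intro x p
      refine C.typed x (out l x) (ne_of_gt ?_) p
      rw [hprob]
      refine lt_of_lt_of_le hl ?_
      refine le_trans (le_of_eq ?_) (Finset.single_le_sum (fun l' _ => ?_) (Finset.mem_univ l))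
      · simp
      · split_ifs
        · exact hq.1 l'
        · exact le_rfl
    have hfirst : ∀ x x' i, (∀ j, x (j, 0) = x' (j, 0)) → out l x (i, 0) = out l x' (i, 0) := by
      intro x x' i h
      refine hout l x x' _ ?_
      rintro ⟨j, t⟩ hj
      fin_cases t
      · exact h j
      · exact absurd hj (C.causal j i)
    -- At most one run is compatible with a deterministic strategy, so the sum over runs collapses
    -- to one indicator.
    have hsum : ∀ k, (∑ r : JointOutcome (distributedScenario S G d) ×
          JointOutcome (distributedScenario S G d),
        (if r ∈ (T.protocol v (Φ.context k)).runs ∧ targetAnswer v r.2 ∈ Φ.accept k then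
          if out l (bothRounds (T.firstContext v) (T.secondContext v (Φ.context k) r.1)) =
            bothRounds r.1 r.2 then (1 : ℝ) else 0 else 0)) ≤
        if targetAnswer v (fun p => out l (bothRounds (T.firstContext v)
          (T.secondContext v (Φ.context k)
            (fun p => out l (bothRounds (T.firstContext v) fun _ => none) (p, 0)))) (p, 1))
              ∈ Φ.accept k then 1 else 0 := by
      intro k
      simp_rw [run_eq_iff hfirst]
      rw [Finset.sum_eq_single (fun p => out l (bothRounds (T.firstContext v) fun _ => none) (p, 0),
        fun p => out l (bothRounds (T.firstContext v) (T.secondContext v (Φ.context k)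
          fun p => out l (bothRounds (T.firstContext v) fun _ => none) (p, 0))) (p, 1))]
      · simp only [if_true]
        split_ifs with h1 h2 h2
        · exact le_rfl
        · exact absurd h1.2 h2
        · exact zero_le_one
        · exact le_rfl
      · intro r _ hr
        rw [if_neg hr, ite_self]
      · simp
    refine (Finset.sum_le_sum fun k _ =>
      mul_le_mul_of_nonneg_left (hsum k) (Φ.weight_mem.1 k)).trans ?_
    -- For interacting targets the trivial bound `1 ≤ γ + 1` suffices, since `γ` is nonnegative.
    -- Otherwise the answers form a global section, and the classical bound applies.
    by_cases hv : bad v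
    · rw [if_pos hv]
      calc _ ≤ ∑ k, Φ.weight k * 1 := Finset.sum_le_sum fun k _ =>
            mul_le_mul_of_nonneg_left (by split_ifs <;> norm_num) (Φ.weight_mem.1 k)
        _ = 1 := by simp_rw [mul_one]; exact Φ.weight_mem.2
        _ ≤ _ := by linarith [hγ.nonneg]
    · rw [if_neg hv, add_zero]
      have hindep : ∀ i x x', (∀ p, (∀ j, j ≠ i → p ≠ ((j, v j), 1)) → x p = x' p) →
          out l x ((i, v i), 1) = out l x' ((i, v i), 1) := by
        intro i x x' h
        refine hout l x x' _ fun p hp => h p ?_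
        rintro j hj rfl
        exact hv ⟨i, j, hj.symm, hp⟩
      obtain ⟨g, hg⟩ := exists_globalSection T htyped v hindep
        (fun p => out l (bothRounds (T.firstContext v) fun _ => none) (p, 0))
      simp_rw [hg]
      exact hγ.sum_weight_le g
  rw [distributedGame_successProb]
  have hN : (0 : ℝ) < Fintype.card (S.Site → G.V) := by
    have : Nonempty (S.Site → G.V) := ⟨fun _ => G.root⟩
    exact_mod_cast Fintype.card_pos
  have hV : (0 : ℝ) < G.size := by
    have : Nonempty G.V := ⟨G.root⟩
    exact_mod_cast Fintype.card_pos
  have hv : ∀ v, ∑ k, Φ.weight k *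
      (∑ r : JointOutcome (distributedScenario S G d) × JointOutcome (distributedScenario S G d),
        if r ∈ (T.protocol v (Φ.context k)).runs ∧ targetAnswer v r.2 ∈ Φ.accept k then
          C.behaviour (T.protocol v (Φ.context k)) r else 0) ≤ γ + if bad v then 1 else 0 := by
    intro v
    have h1 : ∀ k, Φ.weight k *
      (∑ r : JointOutcome (distributedScenario S G d) × JointOutcome (distributedScenario S G d),
        if r ∈ (T.protocol v (Φ.context k)).runs ∧ targetAnswer v r.2 ∈ Φ.accept k then
          C.behaviour (T.protocol v (Φ.context k)) r else 0) =
        ∑ l, q l * (Φ.weight k *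
      ∑ r : JointOutcome (distributedScenario S G d) × JointOutcome (distributedScenario S G d),
        (if r ∈ (T.protocol v (Φ.context k)).runs ∧ targetAnswer v r.2 ∈ Φ.accept k then
          if out l (bothRounds (T.firstContext v) (T.secondContext v (Φ.context k) r.1)) =
            bothRounds r.1 r.2 then (1 : ℝ) else 0 else 0)) := by
      intro k
      simp_rw [mul_left_comm (q _), Finset.mul_sum]
      rw [Finset.sum_comm]
      refine Finset.sum_congr rfl fun r _ => ?_
      rw [← Finset.mul_sum]
      congr 1
      split_ifs
      · rw [ClassicalStrategy.behaviour, behaviourOf, hprob]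
        simp only [mul_ite, mul_one, mul_zero]
        refine Finset.sum_congr rfl fun l _ => ?_
        congr 1
      · simp
    rw [Finset.sum_congr rfl fun k _ => h1 k, Finset.sum_comm]
    simp_rw [← Finset.mul_sum]
    calc _ ≤ ∑ l, q l * (γ + if bad v then 1 else 0) := by
          refine Finset.sum_le_sum fun l _ => ?_
          rcases (hq.1 l).eq_or_lt with h | h
          · rw [← h, zero_mul, zero_mul]
          · exact mul_le_mul_of_nonneg_left (hmain v l h) h.le
      _ = _ := by rw [← Finset.sum_mul, hq.2, one_mul]
  have hcount' : ((Finset.univ.filter bad).card : ℝ) * G.size ≤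
      (Fintype.card S.Site ^ 2 * ∑ n ∈ Finset.range (D + 1), K ^ n : ℕ) *
        Fintype.card (S.Site → G.V) := by
    exact_mod_cast hcount
  calc _ ≤ (Fintype.card (S.Site → G.V) : ℝ)⁻¹ *
        ∑ v : S.Site → G.V, (γ + if bad v then 1 else 0) := by
        refine mul_le_mul_of_nonneg_left (Finset.sum_le_sum fun v _ => ?_) (by positivity)
        convert hv v
    _ = γ + (Fintype.card (S.Site → G.V) : ℝ)⁻¹ * (Finset.univ.filter bad).card := by
        rw [Finset.sum_add_distrib, Finset.sum_const, Finset.card_univ, nsmul_eq_mul,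
          Finset.sum_boole]
        field_simp
    _ ≤ _ := by
        rw [add_le_add_iff_left, ← div_eq_mul_inv, le_div_iff₀ hV, mul_assoc,
          inv_mul_le_iff₀ hN, mul_comm (Fintype.card (S.Site → G.V) : ℝ)]
        exact hcount'

end Classical

/-! ## Teleportation along the paths of a tree -/

section Teleportation

variable {G : RootedGraph} {I : Type} [Fintype I] [DecidableEq I] {d : ℕ} [NeZero d]

namespace SpanningTree

variable (T : SpanningTree G) (v : I → G.V) (m n : I × G.V → ZMod d)

open Classical in
/-- The sum of the shifts on the path from the node `u` to the target. -/
noncomputable def shiftFrom (i : I) (u : G.V) : ZMod d :=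
  ∑ u' with T.Below u' (v i) ∧ T.depth u ≤ T.depth u', m (i, u')

open Classical in
/-- The basis states that the qudits at the nodes had before the Bell measurements. -/
noncomputable def preimage (D : I × G.V → ZMod d) (p : I × G.V) : ZMod d :=
  if T.Below p.2 (v p.1) then D (p.1, v p.1) - T.shiftFrom v m p.1 p.2 else D p

open Classical in
/-- The basis states of the links to the parents after the Bell measurements. -/
noncomputable def linkValue (D : I × G.V → ZMod d) (p : I × G.V) : ZMod d :=
  if p.2 = G.root then 0
  else if p.2 = v p.1 ∨ T.Below p.2 (v p.1) then
    D (p.1, T.parent p.2) + m (p.1, T.parent p.2)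
  else D p

open Classical in
/-- The matrix entries of the Bell measurement at a node. -/
noncomputable def linkEntry (p : I × G.V) (a b : (I × G.V) ⊕ (I × G.V) → ZMod d) : ℂ :=
  if T.Below p.2 (v p.1) then
    if a (.inr (p.1, T.next p.2 (v p.1))) - a (.inl p) = m p ∧
        b (.inr (p.1, T.next p.2 (v p.1))) - b (.inl p) = m p ∧
        ∀ c, c ≠ G.root → T.parent c = p.2 → c ≠ T.next p.2 (v p.1) →
          a (.inr (p.1, c)) = b (.inr (p.1, c)) then
      (d : ℂ)⁻¹ * phase d (n p * (a (.inl p) - b (.inl p)))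
    else 0
  else if a (.inl p) = b (.inl p) ∧ ∀ c, c ≠ G.root → T.parent c = p.2 →
      a (.inr (p.1, c)) = b (.inr (p.1, c)) then 1 else 0

end SpanningTree

/-- The amplitudes of the given state at the root and of maximally entangled pairs at the other
nodes. -/
noncomputable def initialAmplitude (G : RootedGraph) (ψ : (I → ZMod d) → ℂ)
    (b : (I × G.V) ⊕ (I × G.V) → ZMod d) : ℂ :=
  open Classical in
  if ∀ i, b (.inr (i, G.root)) = 0 then
    ψ (fun i => b (.inl (i, G.root))) * ∏ p : {p : I × G.V // p.2 ≠ G.root},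
      if b (.inl p) = b (.inr p) then ((Real.sqrt d : ℝ) : ℂ)⁻¹ else 0
  else 0

variable {T : SpanningTree G} {v : I → G.V} {m n : I × G.V → ZMod d}

namespace SpanningTree

/-- Since the path has one node at each depth, passing to the next node drops exactly the term of
`u`. -/
theorem shiftFrom_eq {i : I} {u : G.V} (h : T.Below u (v i)) :
    T.shiftFrom v m i u = T.shiftFrom v m i (T.next u (v i)) + m (i, u) := by
  classical
  have h1 : (Finset.univ.filter fun u' => T.Below u' (v i) ∧ T.depth u ≤ T.depth u') =
      insert u (Finset.univ.filter fun u' =>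
        T.Below u' (v i) ∧ T.depth (T.next u (v i)) ≤ T.depth u') := by
    ext u'
    simp only [Finset.mem_filter, Finset.mem_univ, true_and, Finset.mem_insert, h.depth_next]
    constructor
    · rintro ⟨h1, h2⟩
      rcases h2.eq_or_lt with h3 | h3
      · exact Or.inl (h1.eq_of_depth_eq h h3.symm)
      · exact Or.inr ⟨h1, h3⟩
    · rintro (rfl | ⟨h1, h2⟩)
      · exact ⟨h, le_rfl⟩
      · exact ⟨h1, by omega⟩
  unfold shiftFrom
  rw [h1, Finset.sum_insert, add_comm]
  simp [h.depth_next]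

theorem shiftFrom_target (i : I) : T.shiftFrom v m i (v i) = 0 := by
  classical
  refine Finset.sum_eq_zero fun u hu => ?_
  have h := (Finset.mem_filter.1 hu).2
  exact absurd h.1.1 (by omega)

theorem preimage_of_path {D : I × G.V → ZMod d} {p : I × G.V}
    (h : p.2 = v p.1 ∨ T.Below p.2 (v p.1)) :
    T.preimage v m D p = D (p.1, v p.1) - T.shiftFrom v m p.1 p.2 := by
  unfold preimage
  split_ifs with h'
  · rfl
  · have h2 := h.resolve_right h'
    rw [h2, shiftFrom_target, sub_zero, ← h2]

/-- The initial pairs have equal halves, so the initial link value at `p` is the initial value at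
the next node. Its difference from the value at `p` is then the one found by the Bell measurement.
-/
theorem preimage_next {D : I × G.V → ZMod d} {p : I × G.V} (h : T.Below p.2 (v p.1)) :
    T.preimage v m D (p.1, T.next p.2 (v p.1)) - T.preimage v m D p = m p := by
  rw [preimage_of_path (p := (p.1, T.next p.2 (v p.1))) h.next_eq_or, preimage_of_path (Or.inr h),
    shiftFrom_eq h]
  ring

theorem preimage_of_not_below {D : I × G.V → ZMod d} {p : I × G.V} (h : ¬ T.Below p.2 (v p.1)) :
    T.preimage v m D p = D p := if_neg h

theorem not_path_of_ne_next {i : I} {u c : G.V} (hc : c ≠ G.root) (hp : T.parent c = u)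
    (h : c ≠ T.next u (v i)) : ¬ (c = v i ∨ T.Below c (v i)) := by
  intro h'
  have := (below_parent hc h').2
  rw [hp] at this
  exact h this.symm

theorem not_path_of_not_below {i : I} {u c : G.V} (hc : c ≠ G.root) (hp : T.parent c = u)
    (h : ¬ T.Below u (v i)) : ¬ (c = v i ∨ T.Below c (v i)) := by
  intro h'
  have := (below_parent hc h').1
  rw [hp] at this
  exact h this

theorem linkValue_next {D : I × G.V → ZMod d} {p : I × G.V} (h : T.Below p.2 (v p.1)) :
    T.linkValue v m D (p.1, T.next p.2 (v p.1)) = D p + m p := by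
  unfold linkValue
  rw [if_neg h.next_ne_root, if_pos h.next_eq_or]
  simp only [h.parent_next]

theorem linkValue_of_not_path {D : I × G.V → ZMod d} {i : I} {c : G.V} (hc : c ≠ G.root)
    (h : ¬ (c = v i ∨ T.Below c (v i))) : T.linkValue v m D (i, c) = D (i, c) := by
  unfold linkValue
  rw [if_neg hc, if_neg h]

/-- The qudit `.inl (i, u)` sits at the node `u`, and `.inr (i, u)` is the other half of its pair,
held at the parent of `u`. At the target nothing is measured, so the initial and final values agree
there. Each Bell outcome fixes the difference between a node and the link to its next node, and
equality of the halves passes this on to the next node. Thus the initial state is recovered by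
climbing from the target to the root, while the final link values are read off from the final node
values. -/
theorem eq_preimage_of_linkEntry_ne_zero {a b : (I × G.V) ⊕ (I × G.V) → ZMod d}
    (h : ∀ p, T.linkEntry v m n p a b ≠ 0) (hroot : ∀ i, b (.inr (i, G.root)) = 0)
    (hb : ∀ p : I × G.V, p.2 ≠ G.root → b (.inl p) = b (.inr p)) :
    b = Sum.elim (T.preimage v m (a ∘ Sum.inl))
        (fun p => open Classical in
          if p.2 = G.root then 0 else T.preimage v m (a ∘ Sum.inl) p) ∧
      ∀ p : I × G.V, p.2 ≠ G.root → a (.inr p) = T.linkValue v m (a ∘ Sum.inl) p := by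
  have h1 : ∀ p : I × G.V, T.Below p.2 (v p.1) →
      a (.inr (p.1, T.next p.2 (v p.1))) - a (.inl p) = m p ∧
        b (.inr (p.1, T.next p.2 (v p.1))) - b (.inl p) = m p ∧
        ∀ c, c ≠ G.root → T.parent c = p.2 → c ≠ T.next p.2 (v p.1) →
          a (.inr (p.1, c)) = b (.inr (p.1, c)) := by
    intro p hp
    have := h p
    rw [linkEntry, if_pos hp] at this
    by_contra h'
    exact this (if_neg h')
  have h2 : ∀ p : I × G.V, ¬ T.Below p.2 (v p.1) →
      a (.inl p) = b (.inl p) ∧ ∀ c, c ≠ G.root → T.parent c = p.2 →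
      a (.inr (p.1, c)) = b (.inr (p.1, c)) := by
    intro p hp
    have := h p
    rw [linkEntry, if_neg hp] at this
    by_contra h'
    exact this (if_neg h')
  -- Induction on the height above the target. The truncated subtraction makes all nodes at least as
  -- deep as the target fall into the base case; other nodes off the path are treated in the
  -- inductive step.
  have h3 : ∀ k i u, T.depth (v i) - T.depth u = k →
      b (.inl (i, u)) = T.preimage v m (a ∘ Sum.inl) (i, u) := by
    intro k
    induction k with
    | zero =>
      intro i u hk
      have hn : ¬ T.Below u (v i) := fun hu => by have := hu.1; omega
      rw [preimage_of_not_below (p := (i, u)) hn]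
      exact (h2 (i, u) hn).1.symm
    | succ k ih =>
      intro i u hk
      by_cases hu : T.Below u (v i)
      · have h4 := ih i (T.next u (v i)) (by rw [hu.depth_next]; omega)
        have h5 := preimage_next (m := m) (D := a ∘ Sum.inl) (p := (i, u)) hu
        have h6 := (h1 (i, u) hu).2.1
        have h7 := hb (i, T.next u (v i)) hu.next_ne_root
        simp only at h4 h5 h6 h7
        rw [← h7, h4, ← h5] at h6
        exact sub_right_injective h6
      · rw [preimage_of_not_below (p := (i, u)) hu]
        exact (h2 (i, u) hu).1.symm
  have h4 : ∀ p, b (.inl p) = T.preimage v m (a ∘ Sum.inl) p := fun p => h3 _ p.1 p.2 rfl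
  refine ⟨?_, ?_⟩
  · funext q
    rcases q with p | p
    · exact h4 p
    · simp only [Sum.elim_inr]
      split_ifs with hp
      · rw [← hroot p.1, ← hp]
      · rw [← hb p hp, h4]
  · rintro ⟨i, c⟩ hc
    simp only at hc
    have off : ¬ (c = v i ∨ T.Below c (v i)) → a (.inr (i, c)) = b (.inr (i, c)) →
        a (.inr (i, c)) = T.linkValue v m (a ∘ Sum.inl) (i, c) := by
      intro hn hab
      rw [linkValue_of_not_path hc hn, hab, ← hb (i, c) hc, h4,
        preimage_of_not_below (p := (i, c)) fun h => hn (Or.inr h)]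
    by_cases hu : T.Below (T.parent c) (v i)
    · by_cases hn : c = T.next (T.parent c) (v i)
      · have h5 := (h1 (i, T.parent c) hu).1
        have h6 := linkValue_next (m := m) (D := a ∘ Sum.inl) (p := (i, T.parent c)) hu
        simp only [← hn] at h5 h6
        rw [h6, ← h5]
        simp
      · exact off (not_path_of_ne_next hc rfl hn) ((h1 (i, T.parent c) hu).2.2 c hc rfl hn)
    · exact off (not_path_of_not_below hc rfl hu) ((h2 (i, T.parent c) hu).2 c hc rfl)

/-- At the unique compatible initial state all constraints of the Bell measurements hold, so only
their phases and normalizations remain. Nodes off the path act as the identity. -/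
theorem linkEntry_preimage {a : (I × G.V) ⊕ (I × G.V) → ZMod d}
    (h : ∀ p, a (.inr p) = T.linkValue v m (a ∘ Sum.inl) p) (p : I × G.V) :
    T.linkEntry v m n p a (Sum.elim (T.preimage v m (a ∘ Sum.inl))
        (fun p => open Classical in
          if p.2 = G.root then 0 else T.preimage v m (a ∘ Sum.inl) p)) =
      open Classical in if T.Below p.2 (v p.1) then
        (d : ℂ)⁻¹ * phase d (n p * (a (.inl p) - T.preimage v m (a ∘ Sum.inl) p)) else 1 := by
  have off : ∀ i c, c ≠ G.root → ¬ (c = v i ∨ T.Below c (v i)) →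
      a (.inr (i, c)) = T.preimage v m (a ∘ Sum.inl) (i, c) := by
    intro i c hc hn
    rw [h, linkValue_of_not_path hc hn,
      preimage_of_not_below (p := (i, c)) fun h => hn (Or.inr h)]
  unfold linkEntry
  split_ifs with hp h1 h1
  · simp
  · refine absurd ⟨?_, ?_, ?_⟩ h1
    · rw [h, linkValue_next hp]
      simp
    · simp only [Sum.elim_inr, Sum.elim_inl, hp.next_ne_root, if_false]
      exact preimage_next hp
    · intro c hc hc' hn
      simp only [Sum.elim_inr, hc, if_false]
      exact off _ _ hc (not_path_of_ne_next hc hc' hn)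
  · rfl
  · refine absurd ⟨?_, ?_⟩ h1
    · rw [Sum.elim_inl, preimage_of_not_below hp]
      rfl
    · intro c hc hc'
      simp only [Sum.elim_inr, hc, if_false]
      exact off _ _ hc (not_path_of_not_below hc hc' hp)

open Classical in
theorem sum_linkEntry_mul (ψ : (I → ZMod d) → ℂ) (a : (I × G.V) ⊕ (I × G.V) → ZMod d) :
    ∑ b, (open Classical in if ∀ i, a (.inr (i, G.root)) = b (.inr (i, G.root)) then
        ∏ p, T.linkEntry v m n p a b else 0) * initialAmplitude G ψ b =
      open Classical in if ∀ p, a (.inr p) = T.linkValue v m (a ∘ Sum.inl) p then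
        (∏ p : I × G.V, if T.Below p.2 (v p.1) then
          (d : ℂ)⁻¹ * phase d (n p * (a (.inl p) - T.preimage v m (a ∘ Sum.inl) p)) else 1) *
        (ψ (fun i => T.preimage v m (a ∘ Sum.inl) (i, G.root)) *
          ((Real.sqrt d : ℝ) : ℂ)⁻¹ ^ Fintype.card {p : I × G.V // p.2 ≠ G.root})
      else 0 := by
  classical
  -- By rigidity at most one initial basis state contributes. It contributes nothing when the links
  -- of `a` do not have the forced values.
  rw [Finset.sum_eq_single (Sum.elim (T.preimage v m (a ∘ Sum.inl))
        (fun p => if p.2 = G.root then 0 else T.preimage v m (a ∘ Sum.inl) p))]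
  · by_cases h : ∀ p, a (.inr p) = T.linkValue v m (a ∘ Sum.inl) p
    · rw [if_pos h, if_pos]
      · congr 1
        · refine Finset.prod_congr rfl fun p _ => ?_
          convert linkEntry_preimage h p
        · rw [initialAmplitude, if_pos]
          · congr 1
            rw [← Finset.card_univ, ← Finset.prod_const]
            refine Finset.prod_congr (by ext; simp) fun p _ => ?_
            rw [if_pos]
            simp [p.2]
          · simp
      · intro i
        rw [h]
        simp [linkValue]
    · rw [if_neg h]
      by_contra hne
      obtain ⟨h1, -⟩ := mul_ne_zero_iff.1 hne
      rw [ne_eq, ite_eq_right_iff, Classical.not_imp] at h1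
      refine h fun p => ?_
      by_cases hp : p.2 = G.root
      · have := h1.1 p.1
        rw [← hp] at this
        simp only [Sum.elim_inr, hp, if_true] at this
        rw [linkValue, if_pos hp]
        rw [← this, ← hp]
      · refine (eq_preimage_of_linkEntry_ne_zero
          (fun p => (Finset.prod_ne_zero_iff.1 h1.2) p (Finset.mem_univ p)) ?_ ?_).2 p hp
        · simp
        · intro p hp
          simp [hp]
  · intro b _ hb
    by_contra hne
    obtain ⟨h1, h2⟩ := mul_ne_zero_iff.1 hne
    rw [ne_eq, ite_eq_right_iff, Classical.not_imp] at h1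
    rw [initialAmplitude, ne_eq, ite_eq_right_iff, Classical.not_imp] at h2
    refine hb ?_
    convert (eq_preimage_of_linkEntry_ne_zero
          (fun p => (Finset.prod_ne_zero_iff.1 h1.2) p (Finset.mem_univ p)) h2.1 ?_).1
    intro p hp
    have h3 := Finset.prod_ne_zero_iff.1 (mul_ne_zero_iff.1 h2.2).2 ⟨p, hp⟩ (by simp)
    by_contra h4
    exact h3 (if_neg h4)
  · simp

end SpanningTree

end Teleportation

/-! ## Measurement of the teleported state -/

/-- The conjugation of a matrix by a generalized Pauli operator. -/
noncomputable def pauliConj {d : ℕ} [NeZero d] (q : ZMod d × ZMod d)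
    (R : Matrix (ZMod d) (ZMod d) ℂ) : Matrix (ZMod d) (ZMod d) ℂ :=
  Matrix.diagonal (fun y => phase d (-(q.2 * y))) *
    R.submatrix (Equiv.subRight q.1) (Equiv.subRight q.1) *
    (Matrix.diagonal fun y => phase d (-(q.2 * y)))ᴴ

/-! ### Generalized Pauli corrections. -/

section Pauli

variable {d : ℕ} [NeZero d]

theorem phase_sum {α : Type} (s : Finset α) (f : α → ZMod d) :
    phase d (∑ i ∈ s, f i) = ∏ i ∈ s, phase d (f i) := by
  classical
  induction s using Finset.induction_on with
  | empty => simp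
  | insert i s hi ih => rw [Finset.sum_insert hi, Finset.prod_insert hi, AddChar.map_add_eq_mul, ih]

/-- A teleported amplitude carries the phase on the left and a shifted argument. Moving the phase
through the conjugated measurement leaves the original matrix at shifted indices, with a phase that
no longer depends on the summation index `y'`. -/
theorem pauliConj_apply_mul (q : ZMod d × ZMod d) (R : Matrix (ZMod d) (ZMod d) ℂ)
    (y y' : ZMod d) : pauliConj q R y y' * phase d (-(q.2 * y')) =
      phase d (-(q.2 * y)) * R (y - q.1) (y' - q.1) := by
  rw [pauliConj, Matrix.diagonal_conjTranspose, Matrix.mul_diagonal, Matrix.diagonal_mul,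
    Pi.star_apply, star_phase, mul_assoc, ← AddChar.map_add_eq_mul]
  simp

theorem diagonal_phase_unitary (n : ZMod d) :
    (Matrix.diagonal fun y => phase d (-(n * y)))ᴴ * Matrix.diagonal (fun y => phase d (-(n * y)))
      = 1 := by
  rw [Matrix.diagonal_conjTranspose, Matrix.diagonal_mul_diagonal, ← Matrix.diagonal_one]
  congr 1
  funext y
  rw [Pi.star_apply, star_phase, ← AddChar.map_add_eq_mul, neg_neg, add_neg_cancel,
    AddChar.map_zero_eq_one]

theorem IsProjectiveMeasurement.pauliConj {O : Type} [Fintype O]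
    {P : O → Matrix (ZMod d) (ZMod d) ℂ} (hP : IsProjectiveMeasurement P) (q : ZMod d × ZMod d) :
    IsProjectiveMeasurement fun o => pauliConj q (P o) :=
  (hP.submatrix (Equiv.subRight q.1)).conj (diagonal_phase_unitary q.2)

theorem pauliConj_one (q : ZMod d × ZMod d) : _root_.pauliConj q 1 = 1 := by
  rw [_root_.pauliConj, Matrix.submatrix_one_equiv, Matrix.mul_one, mul_eq_one_comm,
    diagonal_phase_unitary]

theorem pauliConj_zero (R : Matrix (ZMod d) (ZMod d) ℂ) : _root_.pauliConj 0 R = R := by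
  ext y y'
  simp [_root_.pauliConj]

end Pauli

/-! ### The second-round measurement acting on the teleported amplitudes. -/

section Teleportation

variable {G : RootedGraph} {I : Type} [Fintype I] [DecidableEq I] {d : ℕ} [NeZero d]

open Classical in
/-- The matrix entries of the measurement at a node in the second round. -/
noncomputable def targetEntry (v : I → G.V) (q : I → ZMod d × ZMod d)
    (R : I → Matrix (ZMod d) (ZMod d) ℂ) (p : I × G.V)
    (a b : (I × G.V) ⊕ (I × G.V) → ZMod d) : ℂ :=
  if p.2 = v p.1 then pauliConj (q p.1) (R p.1) (a (.inl p)) (b (.inl p))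
  else if a (.inl p) = b (.inl p) then 1 else 0

open Classical in
/-- Replace the basis states at the targets. -/
noncomputable def replaceTargets (v : I → G.V) (a : (I × G.V) ⊕ (I × G.V) → ZMod d)
    (y : I → ZMod d) : (I × G.V) ⊕ (I × G.V) → ZMod d :=
  Sum.elim (fun p => if p.2 = v p.1 then y p.1 else a (.inl p)) (a ∘ Sum.inr)

theorem sum_targetEntry_mul [DecidableEq G.V] (v : I → G.V) (q : I → ZMod d × ZMod d)
    (R : I → Matrix (ZMod d) (ZMod d) ℂ) (σ : ((I × G.V) ⊕ (I × G.V) → ZMod d) → ℂ)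
    (a : (I × G.V) ⊕ (I × G.V) → ZMod d) :
    ∑ b, (open Classical in if ∀ p, a (.inr p) = b (.inr p) then
        ∏ p, targetEntry v q R p a b else 0) * σ b =
      ∑ y : I → ZMod d, (∏ i, pauliConj (q i) (R i) (a (.inl (i, v i))) (y i)) *
        σ (replaceTargets v a y) := by
  classical
  symm
  -- Away from the targets the measurement is the identity, so only states that differ from `a` at
  -- the targets alone contribute. They are parametrized by the target values `y`.
  refine Fintype.sum_of_injective (replaceTargets v a) ?_ _ _ ?_ ?_
  · intro y y' h
    funext i
    have := congrFun h (.inl (i, v i))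
    simpa [replaceTargets] using this
  · intro b hb
    by_contra hne
    obtain ⟨h1, -⟩ := mul_ne_zero_iff.1 hne
    rw [ne_eq, ite_eq_right_iff, Classical.not_imp] at h1
    refine hb ⟨fun i => b (.inl (i, v i)), ?_⟩
    funext p
    rcases p with p | p
    · simp only [replaceTargets, Sum.elim_inl]
      split_ifs with hp
      · rw [← hp]
      · have h2 := Finset.prod_ne_zero_iff.1 h1.2 p (Finset.mem_univ _)
        rw [targetEntry, if_neg hp] at h2
        by_contra h3
        exact h2 (if_neg h3)
    · exact h1.1 p
  · intro y
    have h : ∀ p, a (.inr p) = replaceTargets v a y (.inr p) := fun p => rfl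
    rw [if_pos h]
    congr 1
    rw [Fintype.prod_prod_type]
    refine Finset.prod_congr rfl fun i _ => ?_
    rw [Finset.prod_eq_single (v i)]
    · simp [targetEntry, replaceTargets]
    · intro u _ hu
      simp [targetEntry, replaceTargets, hu]
    · simp

theorem sum_restrict_targets [DecidableEq G.V] (v : I → G.V) (g : (I → ZMod d) → ℝ) :
    ∑ D : I × G.V → ZMod d, g (fun i => D (i, v i)) =
      (d : ℝ) ^ Fintype.card {p : I × G.V // p.2 ≠ v p.1} * ∑ y, g y := by
  let e : (I × G.V → ZMod d) ≃ (I → ZMod d) × ({p : I × G.V // p.2 ≠ v p.1} → ZMod d) :=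
    { toFun := fun D => (fun i => D (i, v i), fun p => D p)
      invFun := fun yz p => if h : p.2 = v p.1 then yz.1 p.1 else yz.2 ⟨p, h⟩
      left_inv := fun D => by
        funext p
        simp only
        split_ifs with h
        · rw [← h]
        · rfl
      right_inv := fun yz => by
        refine Prod.ext ?_ ?_
        · funext i
          simp
        · funext p
          simp [p.2] }
  rw [← Equiv.sum_comp e.symm, Fintype.sum_prod_type]
  have h : ∀ y z, (fun i => e.symm (y, z) (i, v i)) = y := by
    intro y z
    exact congrArg Prod.fst (e.apply_symm_apply (y, z))
  simp only [h, Finset.sum_const, Finset.card_univ, nsmul_eq_mul, Fintype.card_fun, ZMod.card]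
  rw [← Finset.mul_sum]
  push_cast
  rfl

/-- The count does not depend on `v`, so as many node qudits are off the targets as there are
entangled pairs. The two powers of `d` in the final norm cancel for this reason. -/
theorem card_ne_target [DecidableEq G.V] (v : I → G.V) :
    Fintype.card {p : I × G.V // p.2 ≠ v p.1} = Fintype.card (I × G.V) - Fintype.card I := by
  let e : {p : I × G.V // p.2 = v p.1} ≃ I :=
    { toFun := fun p => p.1.1
      invFun := fun i => ⟨(i, v i), rfl⟩
      left_inv := fun p => Subtype.ext (Prod.ext rfl p.2.symm)
      right_inv := fun i => rfl }
  rw [← Fintype.card_congr e, ← Fintype.card_subtype_compl]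

namespace SpanningTree

variable (T : SpanningTree G) (v : I → G.V) (m n : I × G.V → ZMod d)

open Classical in
/-- The sum of a function over the path to the target. -/
noncomputable def pathSum (i : I) : ZMod d := ∑ u with T.Below u (v i), m (i, u)

/-- The amplitudes after the Bell measurements of the first round. -/
noncomputable def teleportedAmplitude (ψ : (I → ZMod d) → ℂ)
    (a : (I × G.V) ⊕ (I × G.V) → ZMod d) : ℂ :=
  open Classical in if ∀ p, a (.inr p) = T.linkValue v m (a ∘ Sum.inl) p then
    (∏ p : I × G.V, if T.Below p.2 (v p.1) then
      (d : ℂ)⁻¹ * phase d (n p * (a (.inl p) - T.preimage v m (a ∘ Sum.inl) p)) else 1) *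
    (ψ (fun i => T.preimage v m (a ∘ Sum.inl) (i, G.root)) *
      ((Real.sqrt d : ℝ) : ℂ)⁻¹ ^ Fintype.card {p : I × G.V // p.2 ≠ G.root})
  else 0

variable {T v m n}

theorem shiftFrom_root (i : I) : T.shiftFrom v m i G.root = T.pathSum v m i := by
  exact Finset.sum_congr (by ext; simp [T.depth_root]) fun _ _ => rfl

theorem preimage_root (D : I × G.V → ZMod d) (i : I) :
    T.preimage v m D (i, G.root) = D (i, v i) - T.pathSum v m i := by
  rw [← shiftFrom_root]
  refine preimage_of_path ?_
  by_cases h : v i = G.root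
  · exact Or.inl h.symm
  · exact Or.inr (below_root h)

/-- Links on a path are determined by proper ancestors of the target, and the other links by nodes
off the path, so the value at a target never enters. -/
theorem linkValue_replaceTargets (a : (I × G.V) ⊕ (I × G.V) → ZMod d) (y : I → ZMod d)
    (p : I × G.V) :
    T.linkValue v m (replaceTargets v a y ∘ Sum.inl) p = T.linkValue v m (a ∘ Sum.inl) p := by
  unfold linkValue
  split_ifs with h1 h2
  · rfl
  · have h3 := (below_parent h1 h2).1.ne
    simp [replaceTargets, h3]
  · push Not at h2
    simp [replaceTargets, h2.1]

/-- As a function of the target values `y`, the amplitude is a constant times `ψ` shifted by the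
path sums of `m` and multiplied by phases given by the path sums of `n`: the target qudits carry `ψ`
up to a Pauli operator. -/
theorem teleportedAmplitude_replaceTargets (ψ : (I → ZMod d) → ℂ)
    (a : (I × G.V) ⊕ (I × G.V) → ZMod d) (y : I → ZMod d) :
    T.teleportedAmplitude v m n ψ (replaceTargets v a y) =
      open Classical in if ∀ p, a (.inr p) = T.linkValue v m (a ∘ Sum.inl) p then
        (∏ p : I × G.V, if T.Below p.2 (v p.1) then
          (d : ℂ)⁻¹ * phase d (n p * (a (.inl p) + T.shiftFrom v m p.1 p.2)) else 1) *
        ((Real.sqrt d : ℝ) : ℂ)⁻¹ ^ Fintype.card {p : I × G.V // p.2 ≠ G.root} *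
        ((∏ i, phase d (-(T.pathSum v n i * y i))) * ψ (fun i => y i - T.pathSum v m i))
      else 0 := by
  classical
  unfold teleportedAmplitude
  simp only [linkValue_replaceTargets, preimage_root]
  refine if_congr (by rfl) ?_ rfl
  have h1 : ∀ i, (replaceTargets v a y ∘ Sum.inl) (i, v i) = y i := by
    intro i
    simp [replaceTargets]
  -- The initial value at a node of the path is `y i` minus a shift, so each Bell phase splits into
  -- a part independent of `y` and the phase of `-(n p * y i)`. The latter collect into the path
  -- sum.
  have h2 : (∏ p : I × G.V, if T.Below p.2 (v p.1) then
      (d : ℂ)⁻¹ * phase d (n p * (replaceTargets v a y (.inl p) -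
        T.preimage v m (replaceTargets v a y ∘ Sum.inl) p)) else 1) =
      (∏ p : I × G.V, if T.Below p.2 (v p.1) then
          (d : ℂ)⁻¹ * phase d (n p * (a (.inl p) + T.shiftFrom v m p.1 p.2)) else 1) *
        ∏ i, phase d (-(T.pathSum v n i * y i)) := by
    have h3 : ∀ i, phase d (-(T.pathSum v n i * y i)) =
        ∏ u, if T.Below u (v i) then phase d (-(n (i, u) * y i)) else 1 := by
      intro i
      rw [pathSum, Finset.sum_mul, ← Finset.sum_neg_distrib, phase_sum,
        Finset.prod_filter]
    simp_rw [h3]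
    rw [← Fintype.prod_prod_type' (f := fun i u =>
      if T.Below u (v i) then phase d (-(n (i, u) * y i)) else 1), ← Finset.prod_mul_distrib]
    refine Finset.prod_congr rfl fun p _ => ?_
    split_ifs with hp
    · rw [mul_assoc, ← AddChar.map_add_eq_mul, preimage_of_path (Or.inr hp), h1]
      simp only [replaceTargets, Sum.elim_inl, if_neg hp.ne]
      congr 2
      ring
    · rw [one_mul]
  rw [h2]
  simp only [h1]
  ring

open Classical in
theorem normSquared_targetEntry (ψ : (I → ZMod d) → ℂ)
    (R : I → Matrix (ZMod d) (ZMod d) ℂ) :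
    normSquared (fun a => ∑ b, (open Classical in if ∀ p, a (.inr p) = b (.inr p) then
        ∏ p, targetEntry v (fun i => (T.pathSum v m i, T.pathSum v n i)) R p a b else 0) *
          T.teleportedAmplitude v m n ψ b) =
      (∏ p : I × G.V, open Classical in if T.Below p.2 (v p.1) then ((d : ℝ) * d)⁻¹ else 1) *
        normSquared (tensorMatrix R *ᵥ ψ) := by
  classical
  have hd : (0 : ℝ) < d := Nat.cast_pos.2 (Nat.pos_of_ne_zero (NeZero.ne d))
  have h1 : ∀ a : (I × G.V) ⊕ (I × G.V) → ZMod d,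
      ‖∑ b, (if ∀ p, a (.inr p) = b (.inr p) then
        ∏ p, targetEntry v (fun i => (T.pathSum v m i, T.pathSum v n i)) R p a b else 0) *
          T.teleportedAmplitude v m n ψ b‖ ^ 2 =
      if ∀ p, a (.inr p) = T.linkValue v m (a ∘ Sum.inl) p then
        (∏ p : I × G.V, if T.Below p.2 (v p.1) then ((d : ℝ) * d)⁻¹ else 1) *
          (d : ℝ)⁻¹ ^ Fintype.card {p : I × G.V // p.2 ≠ G.root} *
          ‖(tensorMatrix R *ᵥ ψ) (fun i => a (.inl (i, v i)) - T.pathSum v m i)‖ ^ 2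
      else 0 := by
    intro a
    have h2 := sum_targetEntry_mul v (fun i => (T.pathSum v m i, T.pathSum v n i)) R
      (T.teleportedAmplitude v m n ψ) a
    simp only [teleportedAmplitude_replaceTargets] at h2
    rw [show (∑ b, (if ∀ p, a (.inr p) = b (.inr p) then
        ∏ p, targetEntry v (fun i => (T.pathSum v m i, T.pathSum v n i)) R p a b else 0) *
          T.teleportedAmplitude v m n ψ b) = _ by convert h2]
    by_cases hl : ∀ p, a (.inr p) = T.linkValue v m (a ∘ Sum.inl) p
    · simp only [if_pos hl]
      -- The factor common to all `y`: each Bell measurement contributes a phase and a factor `1 /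
      -- d`, so only its modulus matters.
      set Γ : ℂ := ∏ p : I × G.V, if T.Below p.2 (v p.1) then
          (d : ℂ)⁻¹ * phase d (n p * (a (.inl p) + T.shiftFrom v m p.1 p.2)) else 1 with hΓ
      have h3 : ∀ y : I → ZMod d,
          (∏ i, pauliConj (T.pathSum v m i, T.pathSum v n i) (R i) (a (.inl (i, v i))) (y i)) *
          (Γ * ((Real.sqrt d : ℝ) : ℂ)⁻¹ ^ Fintype.card {p : I × G.V // p.2 ≠ G.root} *
          ((∏ i, phase d (-(T.pathSum v n i * y i))) * ψ (fun i => y i - T.pathSum v m i))) =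
          (Γ * ((Real.sqrt d : ℝ) : ℂ)⁻¹ ^ Fintype.card {p : I × G.V // p.2 ≠ G.root} *
            ∏ i, phase d (-(T.pathSum v n i * a (.inl (i, v i))))) *
          ((∏ i, R i (a (.inl (i, v i)) - T.pathSum v m i) (y i - T.pathSum v m i)) *
            ψ (fun i => y i - T.pathSum v m i)) := by
        intro y
        have h4 : (∏ i, pauliConj (T.pathSum v m i, T.pathSum v n i) (R i)
              (a (.inl (i, v i))) (y i)) * (∏ i, phase d (-(T.pathSum v n i * y i))) =
            (∏ i, phase d (-(T.pathSum v n i * a (.inl (i, v i))))) *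
            ∏ i, R i (a (.inl (i, v i)) - T.pathSum v m i) (y i - T.pathSum v m i) := by
          rw [← Finset.prod_mul_distrib, ← Finset.prod_mul_distrib]
          exact Finset.prod_congr rfl fun i _ =>
            pauliConj_apply_mul (T.pathSum v m i, T.pathSum v n i) (R i) _ _
        linear_combination (Γ * ((Real.sqrt d : ℝ) : ℂ)⁻¹ ^
          Fintype.card {p : I × G.V // p.2 ≠ G.root} *
            ψ (fun i => y i - T.pathSum v m i)) * h4
      rw [Finset.sum_congr rfl fun y _ => h3 y, ← Finset.mul_sum]
      have h5 : ∑ y : I → ZMod d,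
          (∏ i, R i (a (.inl (i, v i)) - T.pathSum v m i) (y i - T.pathSum v m i)) *
            ψ (fun i => y i - T.pathSum v m i) =
          (tensorMatrix R *ᵥ ψ) (fun i => a (.inl (i, v i)) - T.pathSum v m i) := by
        exact Equiv.sum_comp (Equiv.subRight (T.pathSum v m)) fun y =>
          (∏ i, R i (a (.inl (i, v i)) - T.pathSum v m i) (y i)) * ψ y
      rw [h5, norm_mul, norm_mul, norm_mul, norm_pow, mul_pow, mul_pow, mul_pow]
      have h6 : ‖∏ i, phase d (-(T.pathSum v n i * a (.inl (i, v i))))‖ = 1 := by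
        rw [norm_prod]
        exact Finset.prod_eq_one fun i _ => norm_phase _
      have h7 : ‖Γ‖ ^ 2 = ∏ p : I × G.V, if T.Below p.2 (v p.1) then ((d : ℝ) * d)⁻¹ else 1 := by
        rw [hΓ, norm_prod, ← Finset.prod_pow]
        refine Finset.prod_congr rfl fun p _ => ?_
        split_ifs
        · rw [norm_mul, norm_phase, norm_inv, Complex.norm_natCast, mul_one, pow_two, mul_inv]
        · simp
      have h8 : (‖((Real.sqrt d : ℝ) : ℂ)⁻¹‖ ^
          Fintype.card {p : I × G.V // p.2 ≠ G.root}) ^ 2 =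
          (d : ℝ)⁻¹ ^ Fintype.card {p : I × G.V // p.2 ≠ G.root} := by
        rw [← pow_mul, mul_comm, pow_mul, norm_inv, Complex.norm_real, Real.norm_eq_abs, inv_pow,
          sq_abs, Real.sq_sqrt hd.le]
      rw [h6, h7, h8, one_pow, mul_one]
    · simp only [if_neg hl, mul_zero, Finset.sum_const_zero, norm_zero]
      norm_num
  -- The link values are forced by the node values, so the sum over basis states reduces to one over
  -- node values. The summand depends only on those at the targets.
  rw [normSquared, Finset.sum_congr rfl fun a _ => h1 a,
    ← Equiv.sum_comp (Equiv.sumArrowEquivProdArrow _ _ _).symm, Fintype.sum_prod_type]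
  have h9 : ∀ D U : I × G.V → ZMod d,
      (Equiv.sumArrowEquivProdArrow _ _ _).symm (D, U) = Sum.elim D U := fun D U => rfl
  simp only [h9, Sum.elim_inr, Sum.elim_comp_inl, Sum.elim_inl, ← funext_iff]
  simp only [Finset.sum_ite_eq', Finset.mem_univ, if_true]
  rw [← Finset.mul_sum, sum_restrict_targets v
    (fun y => ‖(tensorMatrix R *ᵥ ψ) (fun i => y i - T.pathSum v m i)‖ ^ 2)]
  have h10 : ∑ y : I → ZMod d, ‖(tensorMatrix R *ᵥ ψ) (fun i => y i - T.pathSum v m i)‖ ^ 2 =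
      normSquared (tensorMatrix R *ᵥ ψ) := by
    exact Equiv.sum_comp (Equiv.subRight (T.pathSum v m)) fun y => ‖(tensorMatrix R *ᵥ ψ) y‖ ^ 2
  -- The normalization of the pairs cancels against the number of free values at the other nodes.
  have h11 : (d : ℝ)⁻¹ ^ Fintype.card {p : I × G.V // p.2 ≠ G.root} *
      (d : ℝ) ^ Fintype.card {p : I × G.V // p.2 ≠ v p.1} = 1 := by
    rw [card_ne_target v, card_ne_target (fun _ => G.root), ← mul_pow, inv_mul_cancel₀ hd.ne',
      one_pow]
  rw [h10, mul_assoc, ← mul_assoc ((d : ℝ)⁻¹ ^ _), h11, one_mul]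

end SpanningTree

end Teleportation

/-! ## The teleportation circuit -/

/-- The Bell measurement of two of several qudits. -/
noncomputable def bellMeasurement {α : Type} [Fintype α] [DecidableEq α] {d : ℕ} [NeZero d]
    (q₁ q₂ : α) : ZMod d × ZMod d → Matrix (α → ZMod d) (α → ZMod d) ℂ :=
  bellProjection (AddMonoidHom.single (fun _ => ZMod d) q₁ + AddMonoidHom.single (fun _ => ZMod d) q₂)
    fun a => a q₂ - a q₁

section Bell

variable {α : Type} [Fintype α] [DecidableEq α] {d : ℕ} [NeZero d] {q₁ q₂ : α}

theorem isProjectiveMeasurement_bellMeasurement (h : q₁ ≠ q₂) :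
    IsProjectiveMeasurement (bellMeasurement (d := d) q₁ q₂) := by
  refine isProjectiveMeasurement_bellProjection _ fun a t => ?_
  simp [h, h.symm]

open Classical in
theorem bellMeasurement_apply (h : q₁ ≠ q₂) (p : ZMod d × ZMod d) (a b : α → ZMod d) :
    bellMeasurement q₁ q₂ p a b =
      if a q₂ - a q₁ = p.1 ∧ b q₂ - b q₁ = p.1 ∧ ∀ q, q ≠ q₁ → q ≠ q₂ → a q = b q then
        (d : ℂ)⁻¹ * phase d (p.2 * (a q₁ - b q₁)) else 0 := by
  split_ifs with h'
  · obtain ⟨h1, h2, h3⟩ := h'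
    refine bellProjection_apply _ ?_ h1 ?_
    · intro t t' htt
      have := congrFun htt q₁
      simpa [h] using this
    · funext q
      by_cases hq₁ : q = q₁
      · subst hq₁
        simp [h]
      · by_cases hq₂ : q = q₂
        · subst hq₂
          simp [h.symm]
          linear_combination h1 - h2
        · simp [hq₁, hq₂, h3]
  · refine bellProjection_apply_eq_zero _ fun h1 t hab => h' ⟨h1, ?_, ?_⟩
    · rw [← h1, hab]
      simp [h, h.symm]
    · intro q hq₁ hq₂
      rw [hab]
      simp [hq₁, hq₂]

end Bell

section Circuit

/-- The gates that prepare the state: one for the given state, and one for each node other than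
the root. -/
abbrev PreparationGate (S : Scenario) (G : RootedGraph) : Type :=
  Option {p : S.Site × G.V // p.2 ≠ G.root}

/-- The gates of the teleportation circuit: preparation gates, and a measurement gate for each
site in each round. -/
abbrev TeleportationGate (S : Scenario) (G : RootedGraph) : Type :=
  PreparationGate S G ⊕ (S.Site × G.V) × Fin 2

/-- The qudits of the teleportation circuit: at each node, one qudit for each site, and one for
the link to this node at its parent. -/
abbrev NetworkQudit (S : Scenario) (G : RootedGraph) : Type := (S.Site × G.V) ⊕ (S.Site × G.V)

variable {S : Scenario} {G : RootedGraph} (T : SpanningTree G) {d : ℕ} [NeZero d]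

open Classical in
/-- The qudits that are measured at a node in the first round. -/
noncomputable def linkQudits (p : S.Site × G.V) : Finset (NetworkQudit S G) :=
  insert (.inl p) ((Finset.univ.filter fun c => c ≠ G.root ∧ T.parent c = p.2).image
    fun c => .inr (p.1, c))

theorem inl_mem_linkQudits (p : S.Site × G.V) : .inl p ∈ linkQudits T p :=
  Finset.mem_insert_self _ _

theorem inl_mem_linkQudits_iff {p p' : S.Site × G.V} : .inl p' ∈ linkQudits T p ↔ p' = p := by
  simp [linkQudits]

theorem inr_mem_linkQudits_iff {p p' : S.Site × G.V} :
    .inr p' ∈ linkQudits T p ↔ p'.2 ≠ G.root ∧ p = (p'.1, T.parent p'.2) := by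
  simp only [linkQudits, Finset.mem_insert, reduceCtorEq, Finset.mem_image, Finset.mem_filter,
    Finset.mem_univ, true_and, false_or, Sum.inr.injEq]
  constructor
  · rintro ⟨c, ⟨hc, hp⟩, rfl⟩
    exact ⟨hc, Prod.ext rfl hp.symm⟩
  · rintro ⟨h, rfl⟩
    exact ⟨p'.2, ⟨h, rfl⟩, rfl⟩

open Classical in
/-- The qudits on which a gate acts. -/
noncomputable def gateQudits : TeleportationGate S G → Finset (NetworkQudit S G)
  | .inl none => Finset.univ.image fun i => .inl (i, G.root)
  | .inl (some p) => {.inl p.1, .inr p.1}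
  | .inr (p, 0) => linkQudits T p
  | .inr (p, 1) => {.inl p}

/-- The layer of a gate. -/
def gateLayer : TeleportationGate S G → Fin 3
  | .inl _ => 0
  | .inr (_, t) => t.succ

/-- Every link qudit is held at one node, the parent of its label, so all Bell measurements fit into
one layer however long the paths are. -/
theorem gateQudits_disjoint (g g' : TeleportationGate S G) (hl : gateLayer g = gateLayer g')
    (hg : g ≠ g') : Disjoint (gateQudits T g) (gateQudits T g') := by
  rw [Finset.disjoint_left]
  intro q hq hq'
  apply hg
  match g, g' with
  | .inl none, .inl none => rfl
  | .inl none, .inl (some p) =>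
    simp only [gateQudits, Finset.mem_image, Finset.mem_univ, true_and, Finset.mem_insert,
      Finset.mem_singleton] at hq hq'
    obtain ⟨i, rfl⟩ := hq
    simp only [Sum.inl.injEq, reduceCtorEq, or_false] at hq'
    exact absurd (by rw [← hq']) p.2
  | .inl (some p), .inl none =>
    simp only [gateQudits, Finset.mem_image, Finset.mem_univ, true_and, Finset.mem_insert,
      Finset.mem_singleton] at hq hq'
    obtain ⟨i, rfl⟩ := hq'
    simp only [Sum.inl.injEq, reduceCtorEq, or_false] at hq
    exact absurd (by rw [← hq]) p.2
  | .inl (some p), .inl (some p') =>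
    simp only [gateQudits, Finset.mem_insert, Finset.mem_singleton] at hq hq'
    rcases hq with rfl | rfl <;> simp only [Sum.inl.injEq, Sum.inr.injEq, reduceCtorEq, or_false,
      false_or] at hq' <;> rw [Subtype.ext hq']
  | .inl _, .inr (_, t) => exact absurd hl (Fin.succ_ne_zero t).symm
  | .inr (_, t), .inl _ => exact absurd hl (Fin.succ_ne_zero t)
  | .inr (p, 0), .inr (p', 0) =>
    simp only [gateQudits] at hq hq'
    rcases q with q | q
    · rw [inl_mem_linkQudits_iff] at hq hq'
      rw [← hq, hq']
    · rw [inr_mem_linkQudits_iff] at hq hq'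
      rw [hq.2, hq'.2]
  | .inr (p, 0), .inr (p', 1) => simp [gateLayer] at hl
  | .inr (p, 1), .inr (p', 0) => simp [gateLayer] at hl
  | .inr (p, 1), .inr (p', 1) =>
    simp only [gateQudits, Finset.mem_singleton] at hq hq'
    rw [hq, Sum.inl.injEq] at hq'
    rw [hq']

/-- The measurement that always yields a given outcome. -/
noncomputable def trivialMeasurement {ι O : Type} [DecidableEq ι] (o₀ o : O) : Matrix ι ι ℂ :=
  open Classical in if o = o₀ then 1 else 0

theorem isProjectiveMeasurement_trivialMeasurement {ι O : Type} [Fintype ι] [DecidableEq ι]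
    [Fintype O] (o₀ : O) :
    IsProjectiveMeasurement (trivialMeasurement o₀ : O → Matrix ι ι ℂ) := by
  classical
  convert IsProjectiveMeasurement.single (ι := ι) o₀ using 2
  unfold trivialMeasurement
  congr

open Classical in
/-- The Bell measurement of the qudit at a node and of the link to a child. -/
noncomputable def linkBellMeasurement (p : S.Site × G.V) (c : G.V) :
    ZMod d × ZMod d → Matrix (linkQudits T p → ZMod d) (linkQudits T p → ZMod d) ℂ :=
  if h : c ≠ G.root ∧ T.parent c = p.2 then
    bellMeasurement ⟨.inl p, inl_mem_linkQudits T p⟩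
      ⟨.inr (p.1, c), (inr_mem_linkQudits_iff T).2 ⟨h.1, Prod.ext rfl h.2.symm⟩⟩
  else trivialMeasurement 0

variable (l₀ : GlobalSection S)
  (π : ∀ (i : S.Site) (x : S.Setting i), S.Outcome i x → Matrix (ZMod d) (ZMod d) ℂ)

/-- The measurements at a node in the first round. -/
noncomputable def linkMeasurement (p : S.Site × G.V) :
    ∀ x : DistributedSetting S G d p.1 p.2, DistributedOutcome S G d p.1 p.2 x →
      Matrix (linkQudits T p → ZMod d) (linkQudits T p → ZMod d) ℂ
  | .inl (.inl x) => trivialMeasurement (O := S.Outcome p.1 x.1) (l₀ p.1 x.1)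
  | .inl (.inr w) => linkBellMeasurement T p w.1
  | .inr (.inl q) => trivialMeasurement (O := S.Outcome p.1 q.1.1) (l₀ p.1 q.1.1)
  | .inr (.inr q) => linkBellMeasurement T p q.1.2

/-- The basis states of a single qudit. -/
def singletonEquiv {Q : Type} (q : Q) (α : Type) : (({q} : Finset Q) → α) ≃ α where
  toFun a := a ⟨q, Finset.mem_singleton_self q⟩
  invFun x _ := x
  left_inv a := by
    funext ⟨q', h⟩
    obtain rfl := Finset.mem_singleton.1 h
    rfl
  right_inv _ := rfl

/-- The basis states of the qudit that is measured at a node in the second round. -/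
def targetEquiv (p : S.Site × G.V) : (gateQudits T (.inr (p, 1)) → ZMod d) ≃ ZMod d :=
  singletonEquiv (Sum.inl p) (ZMod d)

/-- The measurements at a node in the second round. -/
noncomputable def targetMeasurement (p : S.Site × G.V) :
    ∀ x : DistributedSetting S G d p.1 p.2, DistributedOutcome S G d p.1 p.2 x →
      Matrix (gateQudits T (.inr (p, 1)) → ZMod d) (gateQudits T (.inr (p, 1)) → ZMod d) ℂ
  | .inl (.inl x), o => (π p.1 x.1 o).submatrix (targetEquiv T p) (targetEquiv T p)
  | .inl (.inr _), o => trivialMeasurement (0 : ZMod d × ZMod d) o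
  | .inr (.inl q), o =>
    (pauliConj q.1.2.2 (π p.1 q.1.1 o)).submatrix (targetEquiv T p) (targetEquiv T p)
  | .inr (.inr _), o => trivialMeasurement (0 : ZMod d × ZMod d) o

theorem isProjectiveMeasurement_linkBellMeasurement (p : S.Site × G.V) (c : G.V) :
    IsProjectiveMeasurement (linkBellMeasurement T (d := d) p c) := by
  unfold linkBellMeasurement
  split_ifs
  · exact isProjectiveMeasurement_bellMeasurement (by simp)
  · exact isProjectiveMeasurement_trivialMeasurement _

theorem isProjectiveMeasurement_linkMeasurement (p : S.Site × G.V)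
    (x : DistributedSetting S G d p.1 p.2) :
    IsProjectiveMeasurement (linkMeasurement T l₀ p x) := by
  rcases x with (x | w) | (q | q)
  · exact isProjectiveMeasurement_trivialMeasurement (O := S.Outcome p.1 x.1) _
  · exact isProjectiveMeasurement_linkBellMeasurement T p w.1
  · exact isProjectiveMeasurement_trivialMeasurement (O := S.Outcome p.1 q.1.1) _
  · exact isProjectiveMeasurement_linkBellMeasurement T p q.1.2

theorem isProjectiveMeasurement_targetMeasurement (hπ : ∀ i x, IsProjectiveMeasurement (π i x))
    (p : S.Site × G.V) (x : DistributedSetting S G d p.1 p.2) :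
    IsProjectiveMeasurement (targetMeasurement T π p x) := by
  rcases x with (x | w) | (q | q)
  · exact (hπ p.1 x.1).submatrix (targetEquiv T p)
  · exact isProjectiveMeasurement_trivialMeasurement (O := ZMod d × ZMod d) 0
  · exact ((hπ p.1 q.1.1).pauliConj q.1.2.2).submatrix (targetEquiv T p)
  · exact isProjectiveMeasurement_trivialMeasurement (O := ZMod d × ZMod d) 0

/-- A unitary matrix whose column at zero is the given vector, if this is a unit vector. -/
noncomputable def preparation {ι : Type} [Fintype ι] [DecidableEq ι] (φ : ι → ℂ) (i₀ : ι) :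
    Matrix ι ι ℂ :=
  open Classical in if h : normSquared φ = 1 then (exists_unitary_col φ h i₀).choose else 1

theorem preparation_unitary {ι : Type} [Fintype ι] [DecidableEq ι] (φ : ι → ℂ) (i₀ : ι) :
    (preparation φ i₀)ᴴ * preparation φ i₀ = 1 ∧ preparation φ i₀ * (preparation φ i₀)ᴴ = 1 := by
  unfold preparation
  split_ifs with h
  · exact (exists_unitary_col φ h i₀).choose_spec.1
  · simp

theorem preparation_apply {ι : Type} [Fintype ι] [DecidableEq ι] {φ : ι → ℂ}
    (h : normSquared φ = 1) (i₀ a : ι) : preparation φ i₀ a i₀ = φ a := by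
  unfold preparation
  rw [dif_pos h]
  exact (exists_unitary_col φ h i₀).choose_spec.2 a

variable (ψ : (S.Site → ZMod d) → ℂ)

open Classical in
/-- The states that are prepared by the preparation gates. -/
noncomputable def preparedState :
    ∀ k : PreparationGate S G, (gateQudits T (.inl k) → ZMod d) → ℂ
  | none, a => ψ fun i => a ⟨.inl (i, G.root), Finset.mem_image_of_mem _ (Finset.mem_univ i)⟩
  | some p, a =>
    if a ⟨.inl p.1, Finset.mem_insert_self _ _⟩ =
      a ⟨.inr p.1, Finset.mem_insert_of_mem (Finset.mem_singleton_self _)⟩ then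
      ((Real.sqrt d : ℝ) : ℂ)⁻¹ else 0

/-- The possible values of the gates. -/
abbrev GateValue (S : Scenario) (G : RootedGraph) (d : ℕ) [NeZero d] :
    TeleportationGate S G → Type
  | .inl _ => Unit
  | .inr o => StrategyOutput (distributedScenario S G d) o

/-- The classical wires that a gate reads. -/
def gateReads : TeleportationGate S G →
    Finset (((distributedScenario S G d).Site × Fin 2) ⊕ TeleportationGate S G)
  | .inl _ => ∅
  | .inr o => {.inl o}

/-- The operators of a gate. -/
noncomputable def gateOp : ∀ g : TeleportationGate S G,
    (∀ p : gateReads (d := d) g,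
      WireValue (StrategyInput (distributedScenario S G d)) (GateValue S G d) p.1) →
    GateValue S G d g → Matrix (gateQudits T g → ZMod d) (gateQudits T g → ZMod d) ℂ
  | .inl k, _, _ => preparation (preparedState T ψ k) 0
  | .inr (p, 0), c, o => controlledMeasurement (linkMeasurement T l₀ p)
      (c ⟨.inl (p, 0), Finset.mem_singleton_self _⟩) o
  | .inr (p, 1), c, o => controlledMeasurement (targetMeasurement T π p)
      (c ⟨.inl (p, 1), Finset.mem_singleton_self _⟩) o

noncomputable instance (i : S.Site) (u : G.V) : Fintype (DistributedSetting S G d i u) :=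
  (distributedScenario S G d).fintypeSetting (i, u)

noncomputable instance : ∀ g, Fintype (GateValue S G d g)
  | .inl _ => inferInstanceAs (Fintype Unit)
  | .inr o => inferInstanceAs (Fintype (StrategyOutput (distributedScenario S G d) o))

/-- The circuit that teleports the state along the paths that are measured in the first round and
measures it in the second round. -/
noncomputable def teleportationCircuit (hπ : ∀ i x, IsProjectiveMeasurement (π i x)) :
    QuantumCircuit d ((distributedScenario S G d).Site × Fin 2)
      ((distributedScenario S G d).Site × Fin 2) (StrategyInput (distributedScenario S G d))
      (StrategyOutput (distributedScenario S G d)) where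
  Qudit := NetworkQudit S G
  Gate := TeleportationGate S G
  Val := GateValue S G d
  depth := 3
  layer := gateLayer
  qudits := gateQudits T
  disjoint := gateQudits_disjoint T
  reads := gateReads
  earlier
    | _, .inl _, h => absurd h (Finset.notMem_empty _)
    | _, .inr _, h => by simp [gateReads] at h
  op := gateOp T l₀ π ψ
  isGate
    | .inl k => .inl ⟨rfl, fun _ _ => preparation_unitary _ _⟩
    | .inr (p, 0) => .inr fun c => isProjectiveMeasurement_controlledMeasurement
        (isProjectiveMeasurement_linkMeasurement T l₀ p) _
    | .inr (p, 1) => .inr fun c => isProjectiveMeasurement_controlledMeasurement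
        (isProjectiveMeasurement_targetMeasurement T π hπ p) _
  source o := .inr (.inr o)
  decode _ y := y

end Circuit

/-! ### The layers of the circuit, its resources, and causality. -/

open Classical in
theorem QuantumCircuit.layerOperator_apply {d : ℕ} [NeZero d] {In Out : Type} {A : In → Type}
    {B : Out → Type} (F : QuantumCircuit d In Out A B) (x : ∀ i, A i) (w : ∀ g, F.Val g) (t : ℕ)
    (a b : F.Qudit → ZMod d) :
    F.layerOperator x w t a b =
      if ∀ q, (∀ g, (F.layer g : ℕ) = t → q ∉ F.qudits g) → a q = b q then
        ∏ g with (F.layer g : ℕ) = t,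
          F.op g (fun p => wireValue x w p.1) (w g) (fun q => a q.1) (fun q => b q.1)
      else 0 := rfl

section Circuit

variable {S : Scenario} {G : RootedGraph} {T : SpanningTree G} {d : ℕ} [NeZero d]
  {l₀ : GlobalSection S}
  {π : ∀ (i : S.Site) (x : S.Setting i), S.Outcome i x → Matrix (ZMod d) (ZMod d) ℂ}
  {ψ : (S.Site → ZMod d) → ℂ} {hπ : ∀ i x, IsProjectiveMeasurement (π i x)}

/-- The preparation of `ψ` acts on one qudit for each site. A first-round gate acts on its node and
on the links to the children, at most `Δ + 1` qudits, and reads one classical wire. -/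
theorem teleportationCircuit_fanInLE {Δ : ℕ} (hΔ : G.degree ≤ Δ) :
    (teleportationCircuit T l₀ π ψ hπ).FanInLE (Fintype.card S.Site + Δ + 2) := by
  classical
  intro g
  change (gateQudits T g).card + (gateReads g).card ≤ _
  have hcard : ∀ p : S.Site × G.V, (linkQudits T p).card ≤ Δ + 1 := by
    intro p
    refine (Finset.card_insert_le _ _).trans (Nat.succ_le_succ ?_)
    refine Finset.card_image_le.trans (le_trans ?_ hΔ)
    refine le_trans (Finset.card_le_card ?_) (G.graph.degree_le_maxDegree p.2)
    intro c hc
    obtain ⟨h1, h2⟩ := (Finset.mem_filter.1 hc).2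
    rw [SimpleGraph.mem_neighborFinset]
    exact T.adj_of_parent_eq h1 h2
  match g with
  | .inl none =>
    have : (gateQudits T (.inl none)).card ≤ Fintype.card S.Site := Finset.card_image_le
    simp only [gateReads, Finset.card_empty]
    omega
  | .inl (some p) =>
    have : (gateQudits T (.inl (some p))).card ≤ 2 := Finset.card_le_two
    simp only [gateReads, Finset.card_empty]
    omega
  | .inr (p, 0) =>
    have := hcard p
    simp only [gateQudits, gateReads, Finset.card_singleton]
    omega
  | .inr (p, 1) =>
    simp only [gateQudits, gateReads, Finset.card_singleton]
    omega

theorem teleportationCircuit_causal (i i' : (distributedScenario S G d).Site) :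
    ¬ (teleportationCircuit T l₀ π ψ hπ).Reaches (i, 1) (i', 0) := by
  rintro ⟨n, hn⟩
  -- A second-round input is read only by its own gate, and this gate lies in the last layer, so no
  -- path leads further.
  have key : ∀ n c, PathOfLength (teleportationCircuit T l₀ π ψ hπ).Edge n (Sum.inl (i, 1)) c →
      c = Sum.inl (i, 1) ∨ c = Sum.inr (Sum.inr (i, 1)) := by
    intro n
    induction n with
    | zero =>
      intro c hc
      cases hc
      exact Or.inl rfl
    | succ n ih =>
      intro c hc
      obtain _ | ⟨hb, hbc⟩ := hc
      obtain ⟨g', rfl, hg'⟩ := hbc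
      rcases ih _ hb with rfl | rfl
      · right
        rcases hg' with hg' | ⟨g, hg, -⟩
        · change Sum.inl (i, 1) ∈ gateReads g' at hg'
          match g', hg' with
          | .inl _, hg' => exact absurd hg' (Finset.notMem_empty _)
          | .inr o, hg' =>
            exact congrArg (fun o => Sum.inr (Sum.inr o)) (Sum.inl.inj (Finset.mem_singleton.1 hg')).symm
        · simp at hg
      · exfalso
        rcases hg' with hg' | ⟨g, hg, hlt, -⟩
        · change Sum.inr (Sum.inr (i, 1)) ∈ gateReads g' at hg'
          match g', hg' with
          | .inl _, hg' => exact absurd hg' (Finset.notMem_empty _)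
          | .inr o, hg' => cases Finset.mem_singleton.1 hg'
        · obtain rfl := Sum.inr.inj hg
          change gateLayer (.inr (i, 1)) < gateLayer g' at hlt
          have : gateLayer g' ≤ 2 := Fin.le_last _
          exact absurd (lt_of_lt_of_le hlt this) (by simp [gateLayer])
  rcases key n _ hn with h | h
  · cases h
  · have := (Prod.mk.inj (Sum.inr.inj (Sum.inr.inj h))).2
    exact absurd this (by decide)

/-- The values of all gates, given the outputs. -/
def gateValues (y : ∀ o, StrategyOutput (distributedScenario S G d) o) :
    ∀ g, GateValue S G d g
  | .inl _ => ()
  | .inr o => y o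

/-- Every measurement outcome is itself an output and the preparation gates have trivial values, so
the outputs determine all gate values. -/
theorem teleportationCircuit_prob (x : ∀ o, StrategyInput (distributedScenario S G d) o)
    (y : ∀ o, StrategyOutput (distributedScenario S G d) o) :
    (teleportationCircuit T l₀ π ψ hπ).prob x y =
      normSquared ((teleportationCircuit T l₀ π ψ hπ).state x (gateValues y) 3) := by
  refine (Finset.sum_eq_single (gateValues y :
    ∀ g, (teleportationCircuit T l₀ π ψ hπ).Val g) ?_ ?_).trans ?_
  · intro w _ hw
    rw [if_neg]
    intro h
    apply hw
    funext g
    match g with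
    | .inl _ => rfl
    | .inr o => exact h o
  · intro h
    exact absurd (@Finset.mem_univ _ (_) _) h
  · rw [if_pos]
    · rfl
    · intro o
      rfl

theorem prod_gateLayer_zero (f : TeleportationGate S G → ℂ)
    [DecidablePred fun g : TeleportationGate S G => (gateLayer g : ℕ) = 0] :
    ∏ g with (gateLayer g : ℕ) = 0, f g = ∏ k, f (.inl k) := by
  rw [Finset.prod_filter, Fintype.prod_sum_type]
  simp [gateLayer]

theorem prod_gateLayer_succ (f : TeleportationGate S G → ℂ) (t : Fin 2)
    [DecidablePred fun g : TeleportationGate S G => (gateLayer g : ℕ) = t + 1] :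
    ∏ g with (gateLayer g : ℕ) = t + 1, f g = ∏ p, f (.inr (p, t)) := by
  rw [Finset.prod_filter, Fintype.prod_sum_type, Fintype.prod_prod_type_right]
  simp [gateLayer, Fin.val_inj]

theorem notMem_gateQudits_layer_zero {q : NetworkQudit S G} :
    (∀ g, (gateLayer g : ℕ) = 0 → q ∉ gateQudits T g) ↔ ∃ i, q = .inr (i, G.root) := by
  constructor
  · intro h
    rcases q with ⟨i, u⟩ | ⟨i, u⟩
    · exfalso
      by_cases hu : u = G.root
      · exact h (.inl none) rfl (by simp [gateQudits, hu])
      · exact h (.inl (some ⟨(i, u), hu⟩)) rfl (by simp [gateQudits])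
    · by_cases hu : u = G.root
      · exact ⟨i, by rw [hu]⟩
      · exact absurd (by simp [gateQudits]) (h (.inl (some ⟨(i, u), hu⟩)) rfl)
  · rintro ⟨i, rfl⟩ g hg
    match g with
    | .inl none => simp [gateQudits]
    | .inl (some p) =>
      simp only [gateQudits, Finset.mem_insert, reduceCtorEq, Finset.mem_singleton, false_or,
        Sum.inr.injEq]
      intro h
      exact p.2 (by rw [← h])
    | .inr (p, t) => simp [gateLayer] at hg

theorem notMem_gateQudits_layer_one {q : NetworkQudit S G} :
    (∀ g, (gateLayer g : ℕ) = 1 → q ∉ gateQudits T g) ↔ ∃ i, q = .inr (i, G.root) := by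
  constructor
  · intro h
    rcases q with ⟨i, u⟩ | ⟨i, u⟩
    · exact absurd (inl_mem_linkQudits T (i, u)) (h (.inr ((i, u), 0)) rfl)
    · by_cases hu : u = G.root
      · exact ⟨i, by rw [hu]⟩
      · exact absurd ((inr_mem_linkQudits_iff T).2 ⟨hu, rfl⟩)
          (h (.inr ((i, T.parent u), 0)) rfl)
  · rintro ⟨i, rfl⟩ g hg
    match g with
    | .inl _ => simp [gateLayer] at hg
    | .inr (p, 0) =>
      intro h
      exact ((inr_mem_linkQudits_iff T).1 h).1 rfl
    | .inr (p, 1) => simp [gateLayer] at hg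

theorem notMem_gateQudits_layer_two {q : NetworkQudit S G} :
    (∀ g, (gateLayer g : ℕ) = 2 → q ∉ gateQudits T g) ↔ ∃ p, q = .inr p := by
  constructor
  · intro h
    rcases q with p | p
    · exact absurd (Finset.mem_singleton_self _) (h (.inr (p, 1)) rfl)
    · exact ⟨p, rfl⟩
  · rintro ⟨p, rfl⟩ g hg
    match g with
    | .inl _ => simp [gateLayer] at hg
    | .inr (p, 0) => simp [gateLayer] at hg
    | .inr (p, 1) => simp [gateQudits]

open Classical in
theorem layerOperator_zero (x : ∀ o, StrategyInput (distributedScenario S G d) o)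
    (w : ∀ g, GateValue S G d g) (a b : NetworkQudit S G → ZMod d) :
    (teleportationCircuit T l₀ π ψ hπ).layerOperator x w 0 a b =
      if ∀ i, a (.inr (i, G.root)) = b (.inr (i, G.root)) then
        ∏ k, preparation (preparedState T ψ k) 0 (fun q => a q) (fun q => b q) else 0 := by
  refine (QuantumCircuit.layerOperator_apply
    (teleportationCircuit T l₀ π ψ hπ) x w 0 a b).trans ?_
  refine if_congr (P := ∀ q, (∀ g, (gateLayer g : ℕ) = 0 → q ∉ gateQudits T g) → a q = b q) ?_ ?_ rfl
  · constructor
    · intro h i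
      exact h _ (notMem_gateQudits_layer_zero.2 ⟨i, rfl⟩)
    · intro h q hq
      obtain ⟨i, rfl⟩ := notMem_gateQudits_layer_zero.1 hq
      exact h i
  · exact prod_gateLayer_zero (fun g => gateOp T l₀ π ψ g (fun p => wireValue x w p.1) (w g)
      (fun q => a q) (fun q => b q))

open Classical in
theorem layerOperator_one (x : ∀ o, StrategyInput (distributedScenario S G d) o)
    (w : ∀ g, GateValue S G d g) (a b : NetworkQudit S G → ZMod d) :
    (teleportationCircuit T l₀ π ψ hπ).layerOperator x w 1 a b =
      if ∀ i, a (.inr (i, G.root)) = b (.inr (i, G.root)) then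
        ∏ p : S.Site × G.V, controlledMeasurement (linkMeasurement T l₀ p) (x (p, 0))
          (w (.inr (p, 0))) (fun q => a q) (fun q => b q) else 0 := by
  refine (QuantumCircuit.layerOperator_apply
    (teleportationCircuit T l₀ π ψ hπ) x w 1 a b).trans ?_
  refine if_congr (P := ∀ q, (∀ g, (gateLayer g : ℕ) = 1 → q ∉ gateQudits T g) → a q = b q) ?_ ?_ rfl
  · constructor
    · intro h i
      exact h _ (notMem_gateQudits_layer_one.2 ⟨i, rfl⟩)
    · intro h q hq
      obtain ⟨i, rfl⟩ := notMem_gateQudits_layer_one.1 hq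
      exact h i
  · exact prod_gateLayer_succ (fun g => gateOp T l₀ π ψ g (fun p => wireValue x w p.1) (w g)
      (fun q => a q) (fun q => b q)) 0

open Classical in
theorem layerOperator_two (x : ∀ o, StrategyInput (distributedScenario S G d) o)
    (w : ∀ g, GateValue S G d g) (a b : NetworkQudit S G → ZMod d) :
    (teleportationCircuit T l₀ π ψ hπ).layerOperator x w 2 a b =
      if ∀ p, a (.inr p) = b (.inr p) then
        ∏ p : S.Site × G.V, controlledMeasurement (targetMeasurement T π p) (x (p, 1))
          (w (.inr (p, 1))) (fun q => a q) (fun q => b q) else 0 := by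
  refine (QuantumCircuit.layerOperator_apply
    (teleportationCircuit T l₀ π ψ hπ) x w 2 a b).trans ?_
  refine if_congr (P := ∀ q, (∀ g, (gateLayer g : ℕ) = 2 → q ∉ gateQudits T g) → a q = b q) ?_ ?_ rfl
  · constructor
    · intro h i
      exact h _ (notMem_gateQudits_layer_two.2 ⟨i, rfl⟩)
    · intro h q hq
      obtain ⟨i, rfl⟩ := notMem_gateQudits_layer_two.1 hq
      exact h i
  · exact prod_gateLayer_succ (fun g => gateOp T l₀ π ψ g (fun p => wireValue x w p.1) (w g)
      (fun q => a q) (fun q => b q)) 1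

/-- An outcome labelled by the wrong setting has the zero projection, which annihilates the operator
of its layer and hence the final state. -/
theorem teleportationCircuit_typed (x : ∀ o, StrategyInput (distributedScenario S G d) o)
    (y : ∀ o, StrategyOutput (distributedScenario S G d) o)
    (h : (teleportationCircuit T l₀ π ψ hπ).prob x y ≠ 0)
    (o : (distributedScenario S G d).Site × Fin 2) :
    (y o).map Sigma.fst = x o := by
  by_contra hne
  apply h
  rw [teleportationCircuit_prob]
  have hzero : (teleportationCircuit T l₀ π ψ hπ).layerOperator x (gateValues y) 1 = 0 ∨
      (teleportationCircuit T l₀ π ψ hπ).layerOperator x (gateValues y) 2 = 0 := by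
    obtain ⟨p, t⟩ := o
    fin_cases t
    · left
      ext a b
      refine (layerOperator_one x _ a b).trans
        ((if_congr Iff.rfl (Finset.prod_eq_zero (Finset.mem_univ p) ?_) rfl).trans (ite_self _))
      exact congrFun (congrFun (controlledMeasurement_of_ne (M := linkMeasurement T l₀ p) hne) _) _
    · right
      ext a b
      refine (layerOperator_two x _ a b).trans
        ((if_congr Iff.rfl (Finset.prod_eq_zero (Finset.mem_univ p) ?_) rfl).trans (ite_self _))
      exact congrFun (congrFun (controlledMeasurement_of_ne (M := targetMeasurement T π p) hne) _) _
  have hstate : (teleportationCircuit T l₀ π ψ hπ).state x (gateValues y) 3 = 0 := by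
    change (teleportationCircuit T l₀ π ψ hπ).layerOperator x (gateValues y) 2 *ᵥ
      ((teleportationCircuit T l₀ π ψ hπ).layerOperator x (gateValues y) 1 *ᵥ _) = 0
    rcases hzero with h | h
    · rw [h, Matrix.zero_mulVec, Matrix.mulVec_zero]
    · rw [h, Matrix.zero_mulVec]
  rw [hstate]
  simp [normSquared]

end Circuit

/-! ### Identification of the gates with the teleportation calculus. -/

section Circuit

variable {S : Scenario} {G : RootedGraph} {T : SpanningTree G} {d : ℕ} [NeZero d]
  {l₀ : GlobalSection S}
  {π : ∀ (i : S.Site) (x : S.Setting i), S.Outcome i x → Matrix (ZMod d) (ZMod d) ℂ}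
  {ψ : (S.Site → ZMod d) → ℂ} {hπ : ∀ i x, IsProjectiveMeasurement (π i x)}

theorem normSquared_preparedState (hψ : normSquared ψ = 1) (k : PreparationGate S G) :
    normSquared (preparedState T ψ k) = 1 := by
  classical
  rcases k with _ | p
  · rw [← hψ]
    let f : S.Site → gateQudits T (.inl none) :=
      fun i => ⟨.inl (i, G.root), Finset.mem_image_of_mem _ (Finset.mem_univ i)⟩
    have hf : Function.Bijective f := by
      constructor
      · intro i i' h
        exact (Prod.mk.inj (Sum.inl.inj (congrArg Subtype.val h))).1
      · rintro ⟨q, hq⟩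
        obtain ⟨i, -, rfl⟩ := Finset.mem_image.1 hq
        exact ⟨i, rfl⟩
    refine Fintype.sum_equiv (Equiv.arrowCongr (Equiv.ofBijective f hf).symm (Equiv.refl _)) _ _ ?_
    intro a
    rfl
  · have hd : (0 : ℝ) < d := Nat.cast_pos.2 (Nat.pos_of_ne_zero (NeZero.ne d))
    let q₁ : gateQudits T (.inl (some p)) := ⟨.inl p.1, Finset.mem_insert_self _ _⟩
    let q₂ : gateQudits T (.inl (some p)) :=
      ⟨.inr p.1, Finset.mem_insert_of_mem (Finset.mem_singleton_self _)⟩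
    -- The pair is supported on the `d` diagonal basis states, each of weight `1 / d`.
    let e : {a : gateQudits T (.inl (some p)) → ZMod d // a q₁ = a q₂} ≃ ZMod d :=
      { toFun := fun a => a.1 q₁
        invFun := fun t => ⟨fun _ => t, rfl⟩
        left_inv := fun a => by
          apply Subtype.ext
          funext ⟨q, hq⟩
          rcases Finset.mem_insert.1 hq with rfl | hq'
          · rfl
          · obtain rfl := Finset.mem_singleton.1 hq'
            exact a.2
        right_inv := fun t => rfl }
    have h : ∀ a, ‖preparedState T ψ (some p) a‖ ^ 2 = if a q₁ = a q₂ then (d : ℝ)⁻¹ else 0 := by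
      intro a
      rw [preparedState]
      split_ifs
      · rw [norm_inv, Complex.norm_real, Real.norm_eq_abs, inv_pow, sq_abs, Real.sq_sqrt hd.le]
      · simp
    rw [normSquared, Finset.sum_congr rfl fun a _ => h a, ← Finset.sum_filter, Finset.sum_const,
      ← Fintype.card_subtype, Fintype.card_congr e, ZMod.card, nsmul_eq_mul, mul_inv_cancel₀ hd.ne']

/-- All qudits start at zero, so the first layer selects the zero column of each preparation
unitary. -/
theorem teleportationCircuit_state_one (hψ : normSquared ψ = 1)
    (x : ∀ o, StrategyInput (distributedScenario S G d) o) (w : ∀ g, GateValue S G d g)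
    (a : NetworkQudit S G → ZMod d) :
    (teleportationCircuit T l₀ π ψ hπ).state x w 1 a = initialAmplitude G ψ a := by
  classical
  refine (congrFun (Matrix.mulVec_single_one
    ((teleportationCircuit T l₀ π ψ hπ).layerOperator x w 0) (fun _ => 0)) a).trans ?_
  refine (layerOperator_zero x w a (fun _ => 0)).trans ?_
  refine if_congr Iff.rfl ?_ rfl
  have h : ∀ k : PreparationGate S G,
      preparation (preparedState T ψ k) 0 (fun q => a q) (fun _ => 0) =
        preparedState T ψ k (fun q => a q) := fun k =>
    preparation_apply (normSquared_preparedState hψ k) _ _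
  rw [Finset.prod_congr rfl fun k _ => h k, Fintype.prod_option]
  rfl

theorem linkMeasurement_of_fst_eq {i : S.Site} {u c : G.V} (hc : c ≠ G.root) (h : T.parent c = u)
    (z : Σ x : DistributedSetting S G d i u, DistributedOutcome S G d i u x)
    (hz : z.1 = T.pathSetting S d i hc h) :
    linkMeasurement T l₀ (i, u) z.1 z.2 = linkBellMeasurement T (i, u) c (bellOutcome z) := by
  obtain ⟨z, y⟩ := z
  simp only at hz
  subst hz
  revert y
  unfold SpanningTree.pathSetting
  by_cases hu : u = G.root
  · rw [dif_pos hu]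
    exact fun _ => rfl
  · rw [dif_neg hu]
    exact fun _ => rfl

theorem controlledMeasurement_link (v : S.Site → G.V) (p : S.Site × G.V)
    (o : Option (Σ x : DistributedSetting S G d p.1 p.2, DistributedOutcome S G d p.1 p.2 x))
    (ho : o.map Sigma.fst = T.firstContext (d := d) v p) (m n : S.Site × G.V → ZMod d)
    (hmn : (m p, n p) = o.elim 0 bellOutcome) (a b : NetworkQudit S G → ZMod d) :
    controlledMeasurement (linkMeasurement T l₀ p) (T.firstContext (d := d) v p) o
        (fun q => a q) (fun q => b q) = T.linkEntry v m n p a b := by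
  classical
  rw [controlledMeasurement_of_eq ho]
  by_cases hp : T.Below p.2 (v p.1)
  · have h1 : o.map Sigma.fst = some (T.pathSetting S d p.1 hp.next_ne_root hp.parent_next) :=
      ho.trans (dif_pos hp)
    obtain ⟨z, rfl, hz⟩ := Option.map_eq_some_iff.1 h1
    have h2 : linkMeasurement T l₀ p z.1 z.2 =
        linkBellMeasurement T p (T.next p.2 (v p.1)) (bellOutcome z) :=
      linkMeasurement_of_fst_eq hp.next_ne_root hp.parent_next z hz
    have hmn' : bellOutcome z = (m p, n p) := hmn.symm
    rw [outcomeOperator, h2, linkBellMeasurement, dif_pos ⟨hp.next_ne_root, hp.parent_next⟩,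
      bellMeasurement_apply (by simp), SpanningTree.linkEntry, if_pos hp, hmn']
    refine if_congr (and_congr Iff.rfl (and_congr Iff.rfl ?_)) rfl rfl
    constructor
    · intro h c hc hpc hne
      exact h ⟨.inr (p.1, c), (inr_mem_linkQudits_iff T).2 ⟨hc, Prod.ext rfl hpc.symm⟩⟩ (by simp)
        (by simpa using hne)
    · rintro h ⟨q, hq⟩ h1 h2
      rcases q with q | ⟨i, c⟩
      · rw [inl_mem_linkQudits_iff] at hq
        exact absurd (Subtype.ext (congrArg Sum.inl hq)) h1
      · obtain ⟨hc, rfl⟩ := (inr_mem_linkQudits_iff T).1 hq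
        exact h c hc rfl fun hcn => h2 (Subtype.ext (congrArg (fun c => Sum.inr (i, c)) hcn))
  · have h1 : o.map Sigma.fst = none := ho.trans (dif_neg hp)
    obtain rfl := Option.map_eq_none_iff.1 h1
    rw [outcomeOperator, SpanningTree.linkEntry, if_neg hp, Matrix.one_apply]
    refine if_congr ?_ rfl rfl
    constructor
    · intro h
      refine ⟨congrFun h ⟨.inl p, inl_mem_linkQudits T p⟩, fun c hc hpc => ?_⟩
      exact congrFun h ⟨.inr (p.1, c), (inr_mem_linkQudits_iff T).2 ⟨hc, Prod.ext rfl hpc.symm⟩⟩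
    · rintro ⟨h1, h2⟩
      funext ⟨q, hq⟩
      rcases q with q | ⟨i, c⟩
      · rw [inl_mem_linkQudits_iff] at hq
        subst hq
        exact h1
      · obtain ⟨hc, rfl⟩ := (inr_mem_linkQudits_iff T).1 hq
        exact h2 c hc rfl

/-- The setting at the root does not carry a correction, so there the formula needs `q = 0`. -/
theorem targetMeasurement_targetOutcome {i : S.Site} (u : G.V) (q : ZMod d × ZMod d)
    (hq : u = G.root → q = 0) (z : Σ x : S.Setting i, S.Outcome i x)
    (a b : gateQudits T (.inr ((i, u), 1)) → ZMod d) :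
    targetMeasurement T π (i, u) (T.targetOutcome u q z).1 (T.targetOutcome u q z).2 a b =
      pauliConj q (π i z.1 z.2) (targetEquiv T (i, u) a) (targetEquiv T (i, u) b) := by
  by_cases h : u = G.root
  · rw [hq h, pauliConj_zero, show T.targetOutcome u 0 z = ⟨.inl (.inl ⟨z.1, h⟩), z.2⟩ from
      dif_pos h]
    rfl
  · rw [show T.targetOutcome u q z = ⟨.inr (.inl ⟨(z.1, T.parent u, q), h, T.adj _ h⟩), z.2⟩ from
      dif_neg h]
    rfl

theorem controlledMeasurement_target (v : S.Site → G.V) (C : Context S)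
    (s₁ : JointOutcome (distributedScenario S G d)) (s : JointOutcome S) (p : S.Site × G.V)
    (o : Option (Σ x : DistributedSetting S G d p.1 p.2, DistributedOutcome S G d p.1 p.2 x))
    (ho : o.map Sigma.fst = T.secondContext v C s₁ p)
    (hs : p.2 = v p.1 → s p.1 = o.bind siteAnswer) (a b : NetworkQudit S G → ZMod d) :
    controlledMeasurement (targetMeasurement T π p) (T.secondContext v C s₁ p) o
        (fun q => a q) (fun q => b q) =
      targetEntry v (T.correction v s₁) (fun i => localOperator π i (s i)) p a b := by
  classical
  have hone : ∀ c : gateQudits T (.inr (p, 1)) → ZMod d, ∀ c',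
      (1 : Matrix _ _ ℂ) c c' = if targetEquiv T p c = targetEquiv T p c' then 1 else 0 := by
    intro c c'
    rw [Matrix.one_apply]
    exact if_congr (targetEquiv T p).injective.eq_iff.symm rfl rfl
  refine (congrFun (congrFun (controlledMeasurement_of_eq (M := targetMeasurement T π p) ho)
    (fun q => a q)) (fun q => b q)).trans ?_
  by_cases hp : p.2 = v p.1
  · obtain ⟨i, u⟩ := p
    simp only at hp
    subst hp
    rw [targetEntry, if_pos rfl, hs rfl]
    have ho' : o.map Sigma.fst =
        (C i).map fun x => T.targetSetting (v i) x (T.correction v s₁ i) := ho.trans (if_pos rfl)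
    cases hC : C i with
    | none =>
      rw [hC] at ho'
      obtain rfl := Option.map_eq_none_iff.1 ho'
      rw [outcomeOperator, hone]
      simp only [Option.bind_none, localOperator, pauliConj_one, Matrix.one_apply]
      rfl
    | some x =>
      rw [hC] at ho'
      obtain ⟨z, rfl, hz⟩ := Option.map_eq_some_iff.1 ho'
      obtain ⟨y, rfl⟩ := T.exists_eq_targetOutcome _ _ _ z hz
      simp only [Option.bind_some, T.siteAnswer_targetOutcome, localOperator, outcomeOperator]
      refine targetMeasurement_targetOutcome (v i) (T.correction v s₁ i) ?_ ⟨x, y⟩ _ _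
      -- The path to the root has no proper ancestors, so its correction is an empty sum.
      intro hroot
      refine Finset.sum_eq_zero fun u hu => ?_
      have := (Finset.mem_filter.1 hu).2.1
      rw [hroot, T.depth_root] at this
      exact absurd this (Nat.not_lt_zero _)
  · obtain rfl := Option.map_eq_none_iff.1 (ho.trans (if_neg hp))
    rw [targetEntry, if_neg hp, outcomeOperator, hone]
    rfl

/-- The probability of a run of the distributed game: all outcomes of the Bell measurements are
equally likely, and the answers at the targets are distributed as for the given state. -/
theorem teleportationCircuit_prob_run (hψ : normSquared ψ = 1) (v : S.Site → G.V) (C : Context S)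
    (r : JointOutcome (distributedScenario S G d) × JointOutcome (distributedScenario S G d))
    (hr : r ∈ (T.protocol v C).runs) :
    (teleportationCircuit T l₀ π ψ hπ).prob
        (bothRounds (T.firstContext v) (T.secondContext v C r.1)) (bothRounds r.1 r.2) =
      (∏ p : S.Site × G.V,
        open Classical in if T.Below p.2 (v p.1) then ((d : ℝ) * d)⁻¹ else 1) *
        normSquared (tensorMatrix (fun i => localOperator π i (targetAnswer v r.2 i)) *ᵥ ψ) := by
  classical
  rw [teleportationCircuit_prob]
  set x : ∀ o, StrategyInput (distributedScenario S G d) o :=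
    bothRounds (T.firstContext v) (T.secondContext v C r.1)
  set w : ∀ g, GateValue S G d g := gateValues (bothRounds r.1 r.2)
  let m : S.Site × G.V → ZMod d := fun p => ((r.1 p).elim 0 bellOutcome).1
  let n : S.Site × G.V → ZMod d := fun p => ((r.1 p).elim 0 bellOutcome).2
  -- The correction announced by the referee consists of the exponents of the Pauli operator
  -- accumulated along the path.
  have hcorr : T.correction v r.1 = fun i => (T.pathSum v m i, T.pathSum v n i) := by
    funext i
    exact Prod.ext Prod.fst_sum Prod.snd_sum
  have h2 : ∀ a : NetworkQudit S G → ZMod d,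
      (teleportationCircuit T l₀ π ψ hπ).state x w 2 a = T.teleportedAmplitude v m n ψ a := by
    intro a
    refine Eq.trans ?_ (SpanningTree.sum_linkEntry_mul (T := T) (v := v) (m := m) (n := n) ψ a)
    refine Finset.sum_congr (by congr!) fun b _ => ?_
    refine congrArg₂ _ ((layerOperator_one x w a b).trans (if_congr Iff.rfl ?_ rfl))
      (teleportationCircuit_state_one hψ x w b)
    refine Finset.prod_congr rfl fun p _ => ?_
    exact controlledMeasurement_link v p (r.1 p) (hr.1 p) m n rfl a b
  rw [← SpanningTree.normSquared_targetEntry (T := T) (v := v) (m := m) (n := n)]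
  refine Finset.sum_congr (by congr!) fun a _ => ?_
  refine congrArg (fun z : ℂ => ‖z‖ ^ 2) ?_
  refine Finset.sum_congr (by congr!) fun b _ => ?_
  refine congrArg₂ _ ((layerOperator_two x w a b).trans (if_congr Iff.rfl ?_ rfl)) (h2 b)
  refine Finset.prod_congr rfl fun p _ => ?_
  rw [← hcorr]
  exact controlledMeasurement_target v C r.1 (targetAnswer v r.2) p (r.2 p) (hr.2 p)
    (fun hp => by rw [targetAnswer, ← hp]; rfl) a b

end Circuit

/-! ## The quantum value of the distributed game -/

open Classical in
-- These are the weights of the uniform distribution on the local sections, which is a product over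
-- the sites. No measured setting may have an empty outcome set.
theorem sum_localSections_inv_card {S : Scenario} (C : Context S)
    (hC : ∀ i x, C i = some x → Fintype.card (S.Outcome i x) ≠ 0) :
    ∑ s : JointOutcome S, (if s ∈ localSections C then
      ∏ i, (C i).elim (1 : ℝ) (fun x => (Fintype.card (S.Outcome i x) : ℝ)⁻¹) else 0) = 1 := by
  have h1 : ∀ s : JointOutcome S, (if s ∈ localSections C then
      ∏ i, (C i).elim (1 : ℝ) (fun x => (Fintype.card (S.Outcome i x) : ℝ)⁻¹) else 0) =
      ∏ i, if (s i).map Sigma.fst = C i then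
        (C i).elim (1 : ℝ) (fun x => (Fintype.card (S.Outcome i x) : ℝ)⁻¹) else 0 := by
    intro s
    by_cases hs : s ∈ localSections C
    · rw [if_pos hs]
      exact Finset.prod_congr rfl fun i _ => (if_pos (hs i)).symm
    · rw [if_neg hs]
      obtain ⟨i, hi⟩ := not_forall.1 hs
      exact (Finset.prod_eq_zero (Finset.mem_univ i) (if_neg hi)).symm
  rw [Finset.sum_congr rfl fun s _ => h1 s, Fintype.sum_pi_prod (fun i o =>
    if Option.map Sigma.fst o = C i then
      (C i).elim (1 : ℝ) (fun x => (Fintype.card (S.Outcome i x) : ℝ)⁻¹) else 0)]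
  refine Finset.prod_eq_one fun i _ => ?_
  rw [Fintype.sum_option, Fintype.sum_sigma]
  cases hi : C i with
  | none => simp
  | some x =>
    rw [Finset.sum_eq_single x]
    · have := hC i x hi
      simp [this]
    · intro x' _ hx'
      simp [hx']
    · simp

theorem outcomeOperator_eq_localOperator {S : Scenario} {d : ℕ}
    (π : ∀ (i : S.Site) (x : S.Setting i), S.Outcome i x → Matrix (ZMod d) (ZMod d) ℂ)
    (i : S.Site) (o : Option (Σ x : S.Setting i, S.Outcome i x)) :
    outcomeOperator (π i) o = localOperator π i o := by
  cases o <;> rfl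

/-- The controlled measurements vanish outside the local sections, so their tensor product is a
projective measurement indexed by all joint outcomes, and it preserves total norm. -/
theorem sum_quantumModel {S : Scenario} {d : ℕ} [NeZero d] {ψ : (S.Site → ZMod d) → ℂ}
    (hψ : normSquared ψ = 1)
    {π : ∀ (i : S.Site) (x : S.Setting i), S.Outcome i x → Matrix (ZMod d) (ZMod d) ℂ}
    (hπ : ∀ i x, IsProjectiveMeasurement (π i x)) (C : Context S) :
    ∑ s, quantumModel ψ π C s = 1 := by
  classical
  have h := (isProjectiveMeasurement_tensorMatrix fun i =>
    isProjectiveMeasurement_controlledMeasurement (hπ i) (C i)).sum_normSquared ψ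
  rw [← hψ, ← h]
  refine Finset.sum_congr rfl fun s _ => ?_
  unfold quantumModel
  split_ifs with hs
  · have h1 : (fun i => controlledMeasurement (π i) (C i) (s i)) =
        fun i => localOperator π i (s i) := by
      funext i
      rw [controlledMeasurement_of_eq (hs i), outcomeOperator_eq_localOperator]
    rw [h1]
    rfl
  · have h2 : ∃ i, (s i).map Sigma.fst ≠ C i := by
      by_contra! h3
      exact hs h3
    obtain ⟨i, hi⟩ := h2
    have h1 : tensorMatrix (fun i => controlledMeasurement (π i) (C i) (s i)) = 0 := by
      ext a b
      refine Finset.prod_eq_zero (Finset.mem_univ i) ?_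
      exact congrFun (congrFun (controlledMeasurement_of_ne (M := π i) hi) (a i)) (b i)
    rw [h1, Matrix.zero_mulVec]
    simp [normSquared]

theorem quantumModel_nonneg {S : Scenario} {d : ℕ} [NeZero d] (ψ : (S.Site → ZMod d) → ℂ)
    (π : ∀ (i : S.Site) (x : S.Setting i), S.Outcome i x → Matrix (ZMod d) (ZMod d) ℂ)
    (C : Context S) (s : JointOutcome S) : 0 ≤ quantumModel ψ π C s := by
  unfold quantumModel
  split_ifs
  · exact normSquared_nonneg _
  · exact le_rfl

theorem successProb_quantumModel_le_one {S : Scenario} {d : ℕ} [NeZero d]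
    {ψ : (S.Site → ZMod d) → ℂ} (hψ : normSquared ψ = 1)
    {π : ∀ (i : S.Site) (x : S.Setting i), S.Outcome i x → Matrix (ZMod d) (ZMod d) ℂ}
    (hπ : ∀ i x, IsProjectiveMeasurement (π i x)) (Φ : Game S) :
    Φ.successProb (quantumModel ψ π) ≤ 1 := by
  classical
  rw [← Φ.weight_mem.2]
  refine Finset.sum_le_sum fun k _ => ?_
  refine mul_le_of_le_one_right (Φ.weight_mem.1 k) ?_
  rw [← sum_quantumModel hψ hπ (Φ.context k)]
  refine Finset.sum_le_sum fun s _ => ?_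
  split_ifs
  · exact le_rfl
  · exact quantumModel_nonneg ψ π _ s

section Quantum

variable {S : Scenario} {G : RootedGraph} {T : SpanningTree G} {d : ℕ} [NeZero d]

open Classical in
/-- The joint outcome of the second round from which the given answers are found at the
targets. -/
noncomputable def targetLift (T : SpanningTree G) (v : S.Site → G.V) (q : S.Site → ZMod d × ZMod d)
    (s : JointOutcome S) : JointOutcome (distributedScenario S G d) :=
  fun p : S.Site × G.V =>
    if p.2 = v p.1 then (s p.1).map (T.targetOutcome p.2 (q p.1)) else none

theorem targetAnswer_targetLift (v : S.Site → G.V) (q : S.Site → ZMod d × ZMod d)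
    (s : JointOutcome S) : targetAnswer v (targetLift T v q s) = s := by
  funext i
  have h : targetLift T v q s (i, v i) = (s i).map (T.targetOutcome (v i) (q i)) := if_pos rfl
  refine (congrArg (Option.bind · siteAnswer) h).trans ?_
  cases s i with
  | none => rfl
  | some z => exact T.siteAnswer_targetOutcome _ _ z

theorem targetLift_mem_localSections (v : S.Site → G.V) {C : Context S}
    (s₁ : JointOutcome (distributedScenario S G d)) {s : JointOutcome S}
    (hs : s ∈ localSections C) :
    targetLift T v (T.correction v s₁) s ∈ localSections (T.secondContext v C s₁) := by
  intro (p : S.Site × G.V)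
  by_cases hp : p.2 = v p.1
  · have h1 : targetLift T v (T.correction v s₁) s p =
      (s p.1).map (T.targetOutcome p.2 (T.correction v s₁ p.1)) := if_pos hp
    have h2 : T.secondContext v C s₁ p =
      (C p.1).map fun x => T.targetSetting p.2 x (T.correction v s₁ p.1) := if_pos hp
    refine ((congrArg (Option.map Sigma.fst) h1).trans ?_).trans h2.symm
    rw [← hs p.1, Option.map_map]
    refine (Option.map_map _ _ _).trans ?_
    refine congrFun (congrArg _ ?_) _
    funext z
    exact T.targetOutcome_fst _ _ z
  · have h1 : targetLift T v (T.correction v s₁) s p = none := if_neg hp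
    have h2 : T.secondContext v C s₁ p = none := if_neg hp
    exact (congrArg (Option.map Sigma.fst) h1).trans h2.symm

theorem exists_eq_targetLift (v : S.Site → G.V) {C : Context S}
    {s₁ s₂ : JointOutcome (distributedScenario S G d)}
    (hs : s₂ ∈ localSections (T.secondContext v C s₁)) :
    ∃ s ∈ localSections C, s₂ = targetLift T v (T.correction v s₁) s := by
  have h1 : ∀ i, ∃ o : Option (Σ x : S.Setting i, S.Outcome i x),
      o.map Sigma.fst = C i ∧
        s₂ (i, v i) = o.map (T.targetOutcome (v i) (T.correction v s₁ i)) := by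
    intro i
    have h2 : (s₂ (i, v i)).map Sigma.fst =
      (C i).map fun x => T.targetSetting (v i) x (T.correction v s₁ i) :=
      (hs (i, v i)).trans (if_pos rfl)
    cases hC : C i with
    | none =>
      rw [hC] at h2
      exact ⟨none, rfl, Option.map_eq_none_iff.1 h2⟩
    | some x =>
      rw [hC] at h2
      obtain ⟨z, hz, hz'⟩ := Option.map_eq_some_iff.1 h2
      obtain ⟨y, rfl⟩ := T.exists_eq_targetOutcome _ _ _ z hz'
      exact ⟨some ⟨x, y⟩, rfl, hz⟩
  choose s hs1 hs2 using h1
  refine ⟨s, hs1, ?_⟩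
  funext (p : S.Site × G.V)
  by_cases hp : p.2 = v p.1
  · obtain ⟨i, u⟩ := p
    simp only at hp
    subst hp
    exact (hs2 i).trans (if_pos rfl).symm
  · have h2 : T.secondContext v C s₁ p = none := if_neg hp
    have h3 : targetLift T v (T.correction v s₁) s p = none := if_neg hp
    exact (Option.map_eq_none_iff.1 ((hs p).trans h2)).trans h3.symm

open Classical in
-- For a fixed first-round outcome, `targetAnswer` and `targetLift` are inverse bijections between
-- the local sections of the second context and those of `C`.
theorem sum_targetAnswer (v : S.Site → G.V) (C : Context S)
    (s₁ : JointOutcome (distributedScenario S G d)) (g : JointOutcome S → ℝ) :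
    ∑ s₂, (if s₂ ∈ localSections (T.secondContext v C s₁) then g (targetAnswer v s₂) else 0) =
      ∑ s, if s ∈ localSections C then g s else 0 := by
  rw [← Finset.sum_filter, ← Finset.sum_filter]
  refine Finset.sum_nbij' (targetAnswer v) (targetLift T v (T.correction v s₁)) ?_ ?_ ?_ ?_ ?_
  · intro s₂ hs₂
    obtain ⟨s, hs, rfl⟩ := exists_eq_targetLift v (Finset.mem_filter.1 hs₂).2
    rw [targetAnswer_targetLift]
    exact Finset.mem_filter.2 ⟨Finset.mem_univ _, hs⟩
  · intro s hs
    exact Finset.mem_filter.2 ⟨Finset.mem_univ _,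
      targetLift_mem_localSections v s₁ (Finset.mem_filter.1 hs).2⟩
  · intro s₂ hs₂
    obtain ⟨s, hs, rfl⟩ := exists_eq_targetLift v (Finset.mem_filter.1 hs₂).2
    rw [targetAnswer_targetLift]
  · intro s _
    exact targetAnswer_targetLift v _ s
  · intro s₂ _
    rfl

open Classical in
-- Each Bell measurement has `d * d` outcomes, so the factor is the uniform distribution on the
-- first-round outcomes.
theorem sum_firstContext (v : S.Site → G.V) :
    ∑ s₁ : JointOutcome (distributedScenario S G d),
      (if s₁ ∈ localSections (T.firstContext v) then
        ∏ p : S.Site × G.V, (if T.Below p.2 (v p.1) then ((d : ℝ) * d)⁻¹ else 1) else 0) = 1 := by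
  have hd : d ≠ 0 := NeZero.ne d
  have hcard : ∀ (p : S.Site × G.V) (x : DistributedSetting S G d p.1 p.2),
      T.firstContext v p = some x →
      Fintype.card (DistributedOutcome S G d p.1 p.2 x) = d * d := by
    intro p x hx
    by_cases hp : T.Below p.2 (v p.1)
    · have h1 : T.firstContext v p =
        some (T.pathSetting S d p.1 hp.next_ne_root hp.parent_next) := dif_pos hp
      obtain rfl := Option.some.inj (h1.symm.trans hx)
      exact T.card_pathSetting _ _
    · have h1 : T.firstContext (d := d) v p = none := dif_neg hp
      cases h1.symm.trans hx
  refine Eq.trans ?_ (sum_localSections_inv_card (T.firstContext v) (S := distributedScenario S G d)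
    fun p x hx => (hcard p x hx).trans_ne (mul_ne_zero hd hd))
  refine Finset.sum_congr rfl fun s₁ _ => if_congr Iff.rfl ?_ rfl
  refine Finset.prod_congr rfl fun p _ => ?_
  by_cases hp : T.Below p.2 (v p.1)
  · have h1 : T.firstContext v p =
      some (T.pathSetting S d p.1 hp.next_ne_root hp.parent_next) := dif_pos hp
    have h2 := hcard p _ h1
    rw [if_pos hp, h1]
    refine Eq.trans ?_ (congrArg (fun n : ℕ => (n : ℝ)⁻¹) h2).symm
    push_cast
    rfl
  · have h1 : T.firstContext (d := d) v p = none := dif_neg hp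
    rw [if_neg hp, h1]
    rfl

/-- The two-round quantum strategy that uses the teleportation circuit. -/
noncomputable def teleportationStrategy (T : SpanningTree G) (l₀ : GlobalSection S)
    (π : ∀ (i : S.Site) (x : S.Setting i), S.Outcome i x → Matrix (ZMod d) (ZMod d) ℂ)
    (ψ : (S.Site → ZMod d) → ℂ) (hπ : ∀ i x, IsProjectiveMeasurement (π i x)) :
    QuantumStrategy d (distributedScenario S G d) where
  circuit := teleportationCircuit T l₀ π ψ hπ
  causal := teleportationCircuit_causal
  typed := teleportationCircuit_typed

theorem successProb_teleportationStrategy (T : SpanningTree G) (l₀ : GlobalSection S)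
    {π : ∀ (i : S.Site) (x : S.Setting i), S.Outcome i x → Matrix (ZMod d) (ZMod d) ℂ}
    {ψ : (S.Site → ZMod d) → ℂ} (hψ : normSquared ψ = 1)
    (hπ : ∀ i x, IsProjectiveMeasurement (π i x)) (Φ : Game S) :
    (distributedGame T Φ).successProb (teleportationStrategy T l₀ π ψ hπ).behaviour =
      Φ.successProb (quantumModel ψ π) := by
  classical
  rw [distributedGame_successProb]
  have h1 : ∀ (v : S.Site → G.V) k, (∑ r : JointOutcome (distributedScenario S G d) ×
        JointOutcome (distributedScenario S G d),
      if r ∈ (T.protocol v (Φ.context k)).runs ∧ targetAnswer v r.2 ∈ Φ.accept k then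
        (teleportationStrategy T l₀ π ψ hπ).behaviour (T.protocol v (Φ.context k)) r else 0) =
      ∑ s : JointOutcome S, if s ∈ localSections (Φ.context k) ∧ s ∈ Φ.accept k then
        quantumModel ψ π (Φ.context k) s else 0 := by
    intro v k
    set g : JointOutcome S → ℝ := fun s => if s ∈ Φ.accept k then
      normSquared (tensorMatrix (fun i => localOperator π i (s i)) *ᵥ ψ) else 0 with hg
    set κ : ℝ := ∏ p : S.Site × G.V,
      (if T.Below p.2 (v p.1) then ((d : ℝ) * d)⁻¹ else 1) with hκ
    -- A run probability is a uniform factor times a function of the target answers alone. The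
    -- first-round sum therefore separates, although the second context depends on the first
    -- outcome.
    have h2 : ∀ r : JointOutcome (distributedScenario S G d) ×
        JointOutcome (distributedScenario S G d),
        (if r ∈ (T.protocol v (Φ.context k)).runs ∧ targetAnswer v r.2 ∈ Φ.accept k then
          (teleportationStrategy T l₀ π ψ hπ).behaviour (T.protocol v (Φ.context k)) r else 0) =
        (if r.1 ∈ localSections (T.firstContext v) then κ else 0) *
          if r.2 ∈ localSections (T.secondContext v (Φ.context k) r.1) then
            g (targetAnswer v r.2) else 0 := by
      intro r
      by_cases hr : r ∈ (T.protocol v (Φ.context k)).runs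
      · have ha : r.1 ∈ localSections (T.firstContext v) := hr.1
        have hb : r.2 ∈ localSections (T.secondContext v (Φ.context k) r.1) := hr.2
        rw [if_pos ha, if_pos hb, hg]
        simp only [hr, true_and]
        split_ifs
        · exact teleportationCircuit_prob_run (hπ := hπ) hψ v (Φ.context k) r hr
        · rw [mul_zero]
      · rw [if_neg fun h => hr h.1]
        symm
        by_contra hne
        obtain ⟨h3, h4⟩ := mul_ne_zero_iff.1 hne
        exact hr ⟨by by_contra h5; exact h3 (if_neg h5), by by_contra h5; exact h4 (if_neg h5)⟩
    rw [Finset.sum_congr rfl fun r _ => h2 r, Fintype.sum_prod_type]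
    simp only
    have h3 : ∀ s₁ : JointOutcome (distributedScenario S G d),
        ∑ s₂, (if s₁ ∈ localSections (T.firstContext v) then κ else 0) *
          (if s₂ ∈ localSections (T.secondContext v (Φ.context k) s₁) then
            g (targetAnswer v s₂) else 0) =
        (if s₁ ∈ localSections (T.firstContext v) then κ else 0) *
          ∑ s, if s ∈ localSections (Φ.context k) then g s else 0 := by
      intro s₁
      rw [← Finset.mul_sum, ← sum_targetAnswer v (Φ.context k) s₁ g]
    rw [Finset.sum_congr rfl fun s₁ _ => h3 s₁, ← Finset.sum_mul, sum_firstContext v, one_mul]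
    refine Finset.sum_congr rfl fun s _ => ?_
    rw [hg, quantumModel]
    by_cases h4 : s ∈ localSections (Φ.context k)
    · simp only [h4, true_and, if_true]
      rfl
    · simp [h4]
  have hN : (Fintype.card (S.Site → G.V) : ℝ) ≠ 0 := by
    have : Nonempty (S.Site → G.V) := ⟨fun _ => G.root⟩
    exact_mod_cast Fintype.card_ne_zero
  have h5 : ∀ v : S.Site → G.V, (∑ k, Φ.weight k * ∑ r : JointOutcome (distributedScenario S G d) ×
        JointOutcome (distributedScenario S G d),
      if r ∈ (T.protocol v (Φ.context k)).runs ∧ targetAnswer v r.2 ∈ Φ.accept k then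
        (teleportationStrategy T l₀ π ψ hπ).behaviour (T.protocol v (Φ.context k)) r else 0) =
      Φ.successProb (quantumModel ψ π) := by
    intro v
    refine Finset.sum_congr rfl fun k _ => ?_
    rw [h1 v k]
  -- The value is the same for every choice of targets, so the average over them is this value.
  rw [← inv_mul_cancel_left₀ hN (Φ.successProb (quantumModel ψ π)), ← nsmul_eq_mul,
    ← Finset.card_univ, ← Finset.sum_const]
  congr 1
  refine Finset.sum_congr rfl fun v _ => ?_
  rw [← h5 v]

end Quantum

/-! ### The main theorem. -/

theorem theoremI (S : Scenario) (d : ℕ) [NeZero d] (hd : 2 ≤ d)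
    (ψ : (S.Site → ZMod d) → ℂ) (hψ : normSquared ψ = 1)
    (π : ∀ (i : S.Site) (x : S.Setting i), S.Outcome i x → Matrix (ZMod d) (ZMod d) ℂ)
    (hπ : ∀ i x, IsProjectiveMeasurement (π i x))
    (Φ : Game S) (γ : ℝ) (hγ : Φ.IsClassicalBound γ)
    (hviol : γ < Φ.successProb (quantumModel ψ π))
    (G : ℕ → RootedGraph) (hdeg : ∃ Δ : ℕ, ∀ n, (G n).degree ≤ Δ)
    (hsize : ∀ N : ℕ, ∃ n, N ≤ (G n).size) :
    γ < 1 ∧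
    ∃ (Φ' : ∀ n, TwoRoundGame (distributedScenario S (G n) d))
      (Q : ∀ n, QuantumStrategy d (distributedScenario S (G n) d)),
      ShallowQuantum Q ∧
      (∀ n, (Φ' n).successProb (Q n).behaviour = Φ.successProb (quantumModel ψ π) ∧
        γ < (Φ' n).successProb (Q n).behaviour) ∧
      ∀ C : ∀ n, ClassicalStrategy (distributedScenario S (G n) d),
        ShallowClassical C →
        ∃ ε : ℕ → ℝ,
          ε =O[atTop] (fun n => ((G n).size : ℝ)⁻¹) ∧
          ∀ n, (Φ' n).successProb (C n).behaviour ≤ γ + ε n := by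
  obtain ⟨l₀⟩ := hγ.nonempty_globalSection
  obtain ⟨Δ, hΔ⟩ := hdeg
  let T : ∀ n, SpanningTree (G n) := fun n => (exists_spanningTree (G n)).some
  -- The three layers are preparation, Bell measurements and target measurements, whatever the size
  -- of the graph.
  refine ⟨hviol.trans_le (successProb_quantumModel_le_one hψ hπ Φ),
    fun n => distributedGame (T n) Φ, fun n => teleportationStrategy (T n) l₀ π ψ hπ,
    ⟨Fintype.card S.Site + Δ + 2, 3, fun n => ⟨teleportationCircuit_fanInLE (hπ := hπ) (hΔ n), le_rfl⟩⟩,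
    fun n => ?_, ?_⟩
  · have h := successProb_teleportationStrategy (T n) l₀ hψ hπ Φ
    exact ⟨h, h ▸ hviol⟩
  · rintro C ⟨K, D, hKD⟩
    -- The constant is the number of ordered pairs of sites times the bound on the size of a light
    -- cone. It depends on `K` and `D`, but not on `n`.
    exact ⟨fun n => (Fintype.card S.Site ^ 2 * ∑ n ∈ Finset.range (D + 1), K ^ n : ℕ) *
      ((G n).size : ℝ)⁻¹, isBigO_const_mul_self _ _ _,
      fun n => classical_successProb_le (T n) hγ (C n) (hKD n).1 (hKD n).2⟩
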